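/- Let $k\ge 1$ be an integer, let $a,b,\omega\in\mathbb R$ with $b\neq 0$, let $p,q\in\mathbb C$ be such that $pq$ is real and $1+pq>0$, and let $t>0$. Put $\Theta(z)=a+bz^{k+1}$, $D_\pm=\{x\in\mathbb R:\pm\Theta'(x)>0\}$, $\nu=-\frac1{2\pi}\ln(1+pq)$, and let $\epsilon=0$ if $k$ is even and $\epsilon=\operatorname{sgn} b$ if $k$ is odd. For $z\in\mathbb C\setminus\mathbb R$ let $\delta(z)=\exp(i\omega+\beta(z))$, where $\beta(z)$ equals $0$, $i\epsilon\nu\ln(\epsilon z)$ (principal branch) or $-\pi\nu\,\operatorname{sgn}(\operatorname{Im} z)$ according as $0$ is an exterior point, an endpoint or an interior point of $\overline{D_-}$. The model weights on $\mathbb R\setminus\{0\}$ are $$(w^-_M,w^+_M)=\begin{cases}\Bigl(\begin{pmatrix}0&\delta_-^2pe^{-it\Theta}\\0&0\end{pmatrix},\begin{pmatrix}0&0\\\delta_+^{-2}qe^{it\Theta}&0\end{pmatrix}\Bigr)&\text{on }D_+,\\[2mm]\Bigl(\begin{pmatrix}0&0\\\delta_-^{-2}\frac{q}{1+pq}e^{it\Theta}&0\end{pmatrix},\begin{pmatrix}0&\delta_+^2\frac{p}{1+pq}e^{-it\Theta}\\0&0\end{pmatrix}\Bigr)&\text{on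 }D_-,\end{cases}$$ where $\delta_\pm$ are the boundary values of $\delta$ from the upper and lower half-planes. Let $0<\alpha<\frac{\pi}{k+1}$ and let $\Gamma=\Gamma_0\cup\dots\cup\Gamma_5$ with $\Gamma_0=\mathbb R_+$, $\Gamma_1=e^{i\alpha}\mathbb R_+$, $\Gamma_2=e^{-i\alpha}\mathbb R_-$, $\Gamma_3=\mathbb R_-$, $\Gamma_4=e^{i\alpha}\mathbb R_-$, $\Gamma_5=e^{-i\alpha}\mathbb R_+$, where $\Gamma_0,\Gamma_2,\Gamma_4$ are oriented outwards and $\Gamma_1,\Gamma_3,\Gamma_5$ inwards; the $+$ side is on the left. Let $(w^-_\Gamma,w^+_\Gamma)$ be $(0,0)$ on $\Gamma_0\cup\Gamma_3$; $(0,-w^+_M)$ on $\Gamma_1$ and $\Gamma_2$, where $w^+_M$ is continued analytically through the upper half-plane from $\mathbb R_+$ and from $\mathbb R_-$ respectively; and $(-w^-_M,0)$ on $\Gamma_4$ and $\Gamma_5$, where $w^-_M$ is continued analytically through the lower half-plane from $\mathbb R_-$ and from $\mathbb R_+$ respectively. The model RHP asks for a $2\times2$ matrix function $M_\Gamma$,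 analytic on $\mathbb C\setminus\Gamma$, with $M_\Gamma-I$ in the Hardy space $H_2$ of both sides of $\Gamma$, whose nontangential boundary values satisfy $M_{\Gamma+}=M_{\Gamma-}(I-w^-_\Gamma)^{-1}(I+w^+_\Gamma)$ a.e. on $\Gamma$. Then there are complex constants $U,V$, depending only on $pq$, $b$ and $k$, with $U=-\overline V$, such that whenever the model RHP is uniquely solvable, its solution $M_\Gamma$ has the potentials $$u_\Gamma(t)=\lim_{z\to\infty}z\,(M_\Gamma)_{12}(z)=pU\,t^{-\frac1{k+1}}e^{-2\Delta},\qquad v_\Gamma(t)=\lim_{z\to\infty}z\,(M_\Gamma)_{21}(z)=qV\,t^{-\frac1{k+1}}e^{2\Delta},$$ $$\Delta=\tfrac12 ita+\frac{i\epsilon\nu\ln t}{k+1}-i\omega,$$ where both limits exist as $z\to\infty$ nontangentially in $\mathbb C\setminus\Gamma$. -/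

import Mathlib

open Filter Topology MeasureTheory
open scoped ComplexConjugate NNReal ENNReal

noncomputable section

namespace ModelRHP

/-! ### The six-ray contour -/

/-- Directions of the rays `Γ₀ = ℝ₊`, `Γ₁ = e^{iα} ℝ₊`, `Γ₂ = e^{-iα} ℝ₋`, `Γ₃ = ℝ₋`,
`Γ₄ = e^{iα} ℝ₋`, `Γ₅ = e^{-iα} ℝ₊`, listed counter-clockwise. -/
def rayAngle (α : ℝ) : Fin 6 → ℝ :=
  ![0, α, Real.pi - α, Real.pi, Real.pi + α, 2 * Real.pi - α]

/-- Direction of the ray that follows `Γᵢ` counter-clockwise. -/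
def nextAngle (α : ℝ) : Fin 6 → ℝ :=
  ![α, Real.pi - α, Real.pi, Real.pi + α, 2 * Real.pi - α, 2 * Real.pi]

/-- The point `r e^{iθ}`. -/
def polar (r θ : ℝ) : ℂ := (r : ℂ) * Complex.exp (Complex.I * (θ : ℂ))

/-- The contour `Γ = Γ₀ ∪ ⋯ ∪ Γ₅`. -/
def contour (α : ℝ) : Set ℂ :=
  {z | ∃ i : Fin 6, ∃ r : ℝ, 0 ≤ r ∧ z = polar r (rayAngle α i)}

/-- The open sector between `Γᵢ` and the next ray. -/
def sector (α : ℝ) (i : Fin 6) : Set ℂ :=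
  {z | ∃ r θ : ℝ, 0 < r ∧ rayAngle α i < θ ∧ θ < nextAngle α i ∧ z = polar r θ}

/-- The `+` side of `Γ`. The rays `Γ₀, Γ₂, Γ₄` are oriented outwards and `Γ₁, Γ₃, Γ₅` inwards,
and the `+` side is on the left. -/
def plusSide (α : ℝ) : Set ℂ := sector α 0 ∪ sector α 2 ∪ sector α 4

/-- The `-` side of `Γ`. -/
def minusSide (α : ℝ) : Set ℂ := sector α 1 ∪ sector α 3 ∪ sector α 5

/-! ### Normalized `L²` Riemann-Hilbert problems on the contour -/

/-- `F` belongs to the Hardy space `H₂` of each of the six sectors cut out by the contour: it is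
analytic off the contour, and its `L²` norms over the rays from the vertex that lie in a sector
are uniformly bounded. -/
def MemHardyTwo (α : ℝ) (F : ℂ → ℂ) : Prop :=
  DifferentiableOn ℂ F (contour α)ᶜ ∧
    ∀ i : Fin 6, ∃ C : ℝ≥0, ∀ θ : ℝ, rayAngle α i < θ → θ < nextAngle α i →
      ∫⁻ r in Set.Ioi (0 : ℝ), ‖F (polar r θ)‖ₑ ^ 2 ≤ (C : ℝ≥0∞)

/-- `L` is the nontangential limit of `F` at the point `ζ` of the contour from the side `R`. -/
def HasNontangentialLimit (α : ℝ) (R : Set ℂ) (F : ℂ → Matrix (Fin 2) (Fin 2) ℂ) (ζ : ℂ)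
    (L : Matrix (Fin 2) (Fin 2) ℂ) : Prop :=
  ∀ c : ℝ, 0 < c →
    Tendsto F (𝓝[{z | z ∈ R ∧ c * ‖z - ζ‖ ≤ Metric.infDist z (contour α)}] ζ) (𝓝 L)

/-- `M` solves the normalized `L²` Riemann-Hilbert problem with jump matrix `j`, where `j i r` is
the jump at the point of `Γᵢ` at distance `r` from the origin: `M - I` is in `H₂` of both sides of
`Γ`, and `M₊ = M₋ j` almost everywhere on `Γ` for the nontangential boundary values. -/
def IsSolution (α : ℝ) (j : Fin 6 → ℝ → Matrix (Fin 2) (Fin 2) ℂ)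
    (M : ℂ → Matrix (Fin 2) (Fin 2) ℂ) : Prop :=
  (∀ m n : Fin 2, MemHardyTwo α (fun z => (M z - 1) m n)) ∧
    ∀ i : Fin 6, ∀ᵐ r ∂(volume.restrict (Set.Ioi (0 : ℝ))),
      ∃ Mplus Mminus : Matrix (Fin 2) (Fin 2) ℂ,
        HasNontangentialLimit α (plusSide α) M (polar r (rayAngle α i)) Mplus ∧
        HasNontangentialLimit α (minusSide α) M (polar r (rayAngle α i)) Mminus ∧
        Mplus = Mminus * j i r

/-- Unique solvability; a solution is a function on the complement of the contour. -/
def IsUniquelySolvable (α : ℝ) (j : Fin 6 → ℝ → Matrix (Fin 2) (Fin 2) ℂ) : Prop :=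
  (∃ M, IsSolution α j M) ∧
    ∀ M N, IsSolution α j M → IsSolution α j N → Set.EqOn M N (contour α)ᶜ

/-- `u` and `v` are the potentials recovered from `M`: the limits of `z M₁₂(z)` and `z M₂₁(z)` as
`z → ∞` nontangentially in the complement of the contour. -/
def HasPotentials (α : ℝ) (M : ℂ → Matrix (Fin 2) (Fin 2) ℂ) (u v : ℂ) : Prop :=
  ∀ c : ℝ, 0 < c →
    Tendsto (fun z : ℂ => z * M z 0 1)
      (Bornology.cobounded ℂ ⊓ 𝓟 {z | c * ‖z‖ ≤ Metric.infDist z (contour α)}) (𝓝 u) ∧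
    Tendsto (fun z : ℂ => z * M z 1 0)
      (Bornology.cobounded ℂ ⊓ 𝓟 {z | c * ‖z‖ ≤ Metric.infDist z (contour α)}) (𝓝 v)

/-! ### The model weights -/

/-- `D₊ = {x : Θ'(x) > 0}` for the phase `Θ(x) = a + b x^{k+1}`. -/
def Dplus (k : ℕ) (a b : ℝ) : Set ℝ := {x | 0 < deriv (fun y : ℝ => a + b * y ^ (k + 1)) x}

/-- `D₋ = {x : Θ'(x) < 0}`. -/
def Dminus (k : ℕ) (a b : ℝ) : Set ℝ := {x | deriv (fun y : ℝ => a + b * y ^ (k + 1)) x < 0}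

/-- The phase `Θ` on the complex plane. -/
def phase (k : ℕ) (a b : ℝ) (z : ℂ) : ℂ := (a : ℂ) + (b : ℂ) * z ^ (k + 1)

/-- `ε = 0` for even `k` and `ε = sgn b` for odd `k`. -/
def eps (k : ℕ) (b : ℝ) : ℝ := if Even k then 0 else Real.sign b

/-- `ν = -(1/2π) ln (1 + s)`, where `s = pq`. -/
def nu (s : ℝ) : ℝ := -(1 / (2 * Real.pi)) * Real.log (1 + s)

open Classical in
/-- The function `β`. The three cases are: `0` is an interior point of the closure of `D₋`, an
endpoint of it, or an exterior point. The logarithm is the principal one. -/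
def beta (k : ℕ) (a b s : ℝ) (z : ℂ) : ℂ :=
  if (0 : ℝ) ∈ interior (closure (Dminus k a b)) then
    ((-(Real.pi * nu s * Real.sign z.im) : ℝ) : ℂ)
  else if (0 : ℝ) ∈ closure (Dminus k a b) then
    Complex.I * (eps k b : ℂ) * (nu s : ℂ) * Complex.log ((eps k b : ℂ) * z)
  else 0

/-- `δ(z) = exp (iω + β(z))` on the complement of the real line. -/
def delta (k : ℕ) (a b s ω : ℝ) (z : ℂ) : ℂ :=
  Complex.exp (Complex.I * (ω : ℂ) + beta k a b s z)

open Classical in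
/-- Analytic continuation of the model weight `w⁺` from the half-line containing the real point
`x ≠ 0`, evaluated at a point `z` of the upper half-plane. On the half-line, `w⁺` is given by this
formula with the boundary value `δ₊`, so that `δ` itself appears in the continuation. -/
def weightPlus (k : ℕ) (a b s ω t : ℝ) (p q : ℂ) (x : ℝ) (z : ℂ) : Matrix (Fin 2) (Fin 2) ℂ :=
  if x ∈ Dplus k a b then
    !![0, 0;
       delta k a b s ω z ^ (-2 : ℤ) * q * Complex.exp (Complex.I * (t : ℂ) * phase k a b z), 0]
  else
    !![0, delta k a b s ω z ^ 2 * (p / (1 + p * q)) *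
            Complex.exp (-(Complex.I * (t : ℂ) * phase k a b z));
       0, 0]

open Classical in
/-- Analytic continuation of the model weight `w⁻` from the half-line containing the real point
`x ≠ 0`, evaluated at a point `z` of the lower half-plane. On the half-line, `w⁻` is given by this
formula with the boundary value `δ₋`. -/
def weightMinus (k : ℕ) (a b s ω t : ℝ) (p q : ℂ) (x : ℝ) (z : ℂ) : Matrix (Fin 2) (Fin 2) ℂ :=
  if x ∈ Dplus k a b then
    !![0, delta k a b s ω z ^ 2 * p * Complex.exp (-(Complex.I * (t : ℂ) * phase k a b z));
       0, 0]
  else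
    !![0, 0;
       delta k a b s ω z ^ (-2 : ℤ) * (q / (1 + p * q)) *
         Complex.exp (Complex.I * (t : ℂ) * phase k a b z), 0]

/-- The deformed weight `w⁺` on `Γᵢ`: minus the continuation of `w⁺` from `ℝ₊` on `Γ₁`, minus that
from `ℝ₋` on `Γ₂`, and zero on the other rays. -/
def deformedPlus (k : ℕ) (a b s ω t : ℝ) (p q : ℂ) (α : ℝ) (i : Fin 6) (r : ℝ) :
    Matrix (Fin 2) (Fin 2) ℂ :=
  ![0, -weightPlus k a b s ω t p q r (polar r (rayAngle α i)),
    -weightPlus k a b s ω t p q (-r) (polar r (rayAngle α i)), 0, 0, 0] i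

/-- The deformed weight `w⁻` on `Γᵢ`: minus the continuation of `w⁻` from `ℝ₋` on `Γ₄`, minus that
from `ℝ₊` on `Γ₅`, and zero on the other rays. -/
def deformedMinus (k : ℕ) (a b s ω t : ℝ) (p q : ℂ) (α : ℝ) (i : Fin 6) (r : ℝ) :
    Matrix (Fin 2) (Fin 2) ℂ :=
  ![0, 0, 0, 0, -weightMinus k a b s ω t p q (-r) (polar r (rayAngle α i)),
    -weightMinus k a b s ω t p q r (polar r (rayAngle α i))] i

/-- The jump matrix `(I - w⁻)⁻¹ (I + w⁺)` of the deformed model problem. -/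
def modelJump (k : ℕ) (a b s ω t : ℝ) (p q : ℂ) (α : ℝ) (i : Fin 6) (r : ℝ) :
    Matrix (Fin 2) (Fin 2) ℂ :=
  (1 - deformedMinus k a b s ω t p q α i r)⁻¹ * (1 + deformedPlus k a b s ω t p q α i r)

/-- `Δ = ita/2 + iεν ln t/(k+1) - iω`. -/
def Delta (k : ℕ) (a b s ω t : ℝ) : ℂ :=
  Complex.I * (t : ℂ) * (a : ℂ) / 2
    + Complex.I * (eps k b : ℂ) * (nu s : ℂ) * (Real.log t : ℂ) / ((k : ℂ) + 1)
    - Complex.I * (ω : ℂ)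

end ModelRHP

end

/-! Symmetries remove `a`, `ω` and `t`. With κ = t^{1/(k+1)} one has κ^{k+1} = t and β(κz) = β(z) +
iεν ln κ, hence δ(z)² e^{-itΘ(z)} = e^{-2Δ} exp(2β(κz) - ib(κz)^{k+1}) (`delta_sq_mul_exp`). So the
dilation by κ turns the model problem into the one with a = ω = 0, t = 1 and with p, q replaced by p
e^{-2Δ}, q e^{2Δ}, whose product is still pq (`modelJump_eq`). The dilation itself contributes the
factor 1/κ to the potentials.

In the normalized problem, conjugation by diag(d, 1) replaces (p, q) by (dp, q/d) and multiplies the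
upper right entry by d. Hence u/p depends only on pq when p ≠ 0 (`potential_eq_mul`); when p = 0,
uniqueness makes the first row trivial and u = 0 (`potential_eq_zero`). Reflection in the real axis
combined with the inverse adjoint replaces (p, q) by the conjugates of (q, p) and u by minus the
conjugate of v. This derives V, and its relation to U, from the statement about u
(`exists_normal_constants`).

Two analytic points take most of the work. The potentials exist because M - I is the Cauchy integral
of its jump, and the density M W is integrable thanks to the exponential decay of the weights W
along the rays (`IsSolution.exists_hasPotentials`). The constants must also serve every opening α,
so a solution on one contour has to be carried to another (`IsSolution.exists_change_opening`).
Classically M is multiplied by I ± W between an old and a new ray and left alone elsewhere. Here the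
candidate is defined as a Cauchy integral over the new rays, so that analyticity across the old rays
is automatic, and Cauchy's formula for M W in the wedges identifies it with the classical
expression.

Both points rest on Cauchy's formula in H₂ of a sector (`HardySector.cauchy_formula`). It is
obtained by rotating ray integrals and passing to the boundary rays by weak L² convergence. -/

namespace ModelRHP

/-! ### Rotation of ray integrals -/

/-- Contour shift in a strip: only the parts of the horizontal lines near infinity have to be
bounded uniformly. -/
theorem integral_horizontal_eq {H : ℂ → ℂ} {ya yb X : ℝ} (hab : ya ≤ yb)
    (hd : ∀ z : ℂ, z.im ∈ Set.Icc ya yb → DifferentiableAt ℂ H z)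
    (ha : Integrable fun x : ℝ => H (x + ya * Complex.I))
    (hb : Integrable fun x : ℝ => H (x + yb * Complex.I)) {C : ℝ≥0∞} (hC : C ≠ ∞)
    (hT : ∀ y ∈ Set.Icc ya yb, ∫⁻ x in {x : ℝ | X ≤ |x|}, ‖H (x + y * Complex.I)‖ₑ ≤ C) :
    ∫ x : ℝ, H (x + ya * Complex.I) = ∫ x : ℝ, H (x + yb * Complex.I) := by
  set S : Set ℝ := {x : ℝ | X ≤ |x|} with hS
  have hSm : MeasurableSet S := (isClosed_le continuous_const continuous_abs).measurableSet
  -- The vertical sides are not bounded pointwise. Instead, Tonelli makes `V` integrable near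
  -- infinity, the rectangle identity gives `V T - V (-T)` a limit, and an integrable function can
  -- only converge to 0.
  set V : ℝ → ℂ := fun T => ∫ y in ya..yb, H (T + y * Complex.I) with hV
  have hcont : ContinuousOn (fun z : ℝ × ℝ => H (z.1 + z.2 * Complex.I)) (S ×ˢ Set.Ioc ya yb) := by
    intro z hz
    have hz2 : ((z.1 : ℂ) + z.2 * Complex.I).im ∈ Set.Icc ya yb := by
      simpa using Set.Ioc_subset_Icc_self hz.2
    have h1 := (hd _ hz2).continuousAt
    have h2 : Continuous fun z : ℝ × ℝ => (z.1 : ℂ) + z.2 * Complex.I := by fun_prop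
    exact (ContinuousAt.comp (f := fun z : ℝ × ℝ => (z.1 : ℂ) + z.2 * Complex.I) h1
      h2.continuousAt).continuousWithinAt
  have hprod : Integrable (fun z : ℝ × ℝ => H (z.1 + z.2 * Complex.I))
      ((volume.restrict S).prod (volume.restrict (Set.Ioc ya yb))) := by
    have hmeas : AEStronglyMeasurable (fun z : ℝ × ℝ => H (z.1 + z.2 * Complex.I))
      ((volume.restrict S).prod (volume.restrict (Set.Ioc ya yb))) := by
      rw [Measure.prod_restrict]
      exact hcont.aestronglyMeasurable (hSm.prod measurableSet_Ioc)
    refine ⟨hmeas, ?_⟩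
    rw [hasFiniteIntegral_iff_enorm, lintegral_prod_symm _ hmeas.enorm]
    calc ∫⁻ y in Set.Ioc ya yb, ∫⁻ x in S, ‖H (x + y * Complex.I)‖ₑ
        ≤ ∫⁻ y in Set.Ioc ya yb, C := by
          refine lintegral_mono_ae ?_
          filter_upwards [ae_restrict_mem measurableSet_Ioc] with y hy
          exact hT y (Set.Ioc_subset_Icc_self hy)
      _ < ∞ := by
          simp only [lintegral_const, Measure.restrict_apply MeasurableSet.univ, Set.univ_inter,
            Real.volume_Ioc]
          exact ENNReal.mul_lt_top hC.lt_top ENNReal.ofReal_lt_top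
  have hVint : IntegrableOn V S := by
    have := hprod.integral_prod_left
    simpa [hV, intervalIntegral.integral_of_le hab, IntegrableOn] using this
  have hVneg : IntegrableOn (fun x => V (-x)) S := by
    have : S = Neg.neg ⁻¹' S := by ext x; simp [hS]
    rw [this]
    exact (MeasurePreserving.integrableOn_comp_preimage (Measure.measurePreserving_neg volume)
      (Homeomorph.neg ℝ).measurableEmbedding).2 hVint
  have hD : IntegrableAtFilter (fun T => V T - V (-T)) atTop volume :=
    ⟨S, (eventually_ge_atTop X).mono fun x hx => hx.trans (le_abs_self x), hVint.sub hVneg⟩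
  have hrect : ∀ T : ℝ, V T - V (-T) = Complex.I *
      ((∫ x in (-T)..T, H (x + ya * Complex.I)) - ∫ x in (-T)..T, H (x + yb * Complex.I)) := by
    intro T
    have h := Complex.integral_boundary_rect_eq_zero_of_differentiableOn H
      (⟨-T, ya⟩ : ℂ) (⟨T, yb⟩ : ℂ) (by
        intro z hz
        refine (hd z ?_).differentiableWithinAt
        have := (Complex.mem_reProdIm.1 hz).2
        simpa [Set.uIcc_of_le hab] using this)
    simp only [smul_eq_mul, Complex.ofReal_neg] at h
    have hVT : V (-T) = ∫ y in ya..yb, H (-(T : ℂ) + y * Complex.I) := by simp [hV]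
    rw [hVT]
    simp only [hV]
    linear_combination (-Complex.I) * h +
      ((∫ y in ya..yb, H ((T : ℂ) + y * Complex.I)) -
        ∫ y in ya..yb, H (-(T : ℂ) + y * Complex.I)) * Complex.I_mul_I
  have hlim : Tendsto (fun T => V T - V (-T)) atTop (𝓝 (Complex.I *
      ((∫ x : ℝ, H (x + ya * Complex.I)) - ∫ x : ℝ, H (x + yb * Complex.I)))) := by
    simp_rw [hrect]
    exact ((intervalIntegral_tendsto_integral ha tendsto_neg_atTop_atBot tendsto_id).sub
      (intervalIntegral_tendsto_integral hb tendsto_neg_atTop_atBot tendsto_id)).const_mul _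
  have h0 := hD.eq_zero_of_tendsto (fun s hs => by
    obtain ⟨a, ha⟩ := mem_atTop_sets.1 hs
    exact top_unique (by
      calc (∞ : ℝ≥0∞) = volume (Set.Ici a) := by simp
        _ ≤ volume s := measure_mono fun x hx => ha x hx)) hlim
  simpa [Complex.I_ne_zero, sub_eq_zero] using h0

theorem exp_eq_polar (x y : ℝ) :
    Complex.exp (x + y * Complex.I) = polar (Real.exp x) y := by
  rw [Complex.exp_add, polar, Complex.ofReal_exp, mul_comm (y : ℂ)]

theorem image_exp_univ : Real.exp '' Set.univ = Set.Ioi 0 := by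
  rw [Set.image_univ, Real.range_exp]

theorem norm_polar {r : ℝ} (hr : 0 ≤ r) (θ : ℝ) : ‖polar r θ‖ = r := by
  rw [polar, norm_mul, mul_comm Complex.I, Complex.norm_exp_ofReal_mul_I, mul_one,
    Complex.norm_real, Real.norm_of_nonneg hr]

theorem continuous_polar_left (θ : ℝ) : Continuous fun r : ℝ => polar r θ := by
  unfold polar; fun_prop

theorem continuous_polar_right (r : ℝ) : Continuous fun θ : ℝ => polar r θ := by
  unfold polar; fun_prop

/-- Rotation of a ray integral within a sector of analyticity. -/
theorem integral_ray_eq {K : ℂ → ℂ} {θa θb R : ℝ} (hab : θa ≤ θb)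
    (hd : ∀ r : ℝ, 0 < r → ∀ θ ∈ Set.Icc θa θb, DifferentiableAt ℂ K (polar r θ))
    (ha : IntegrableOn (fun r : ℝ => K (polar r θa)) (Set.Ioi 0))
    (hb : IntegrableOn (fun r : ℝ => K (polar r θb)) (Set.Ioi 0)) (hR : 0 < R)
    {C : ℝ≥0∞} (hC : C ≠ ∞)
    (hT : ∀ θ ∈ Set.Icc θa θb,
      ∫⁻ r in {r : ℝ | 0 < r ∧ (r ≤ R⁻¹ ∨ R ≤ r)}, ‖K (polar r θ)‖ₑ ≤ C) :
    ∫ r in Set.Ioi (0 : ℝ), K (polar r θa) * Complex.exp (Complex.I * θa) =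
      ∫ r in Set.Ioi (0 : ℝ), K (polar r θb) * Complex.exp (Complex.I * θb) := by
  -- In the coordinate ζ = e^w a rotation of the ray is a vertical shift of a horizontal line, and
  -- radii near 0 and near infinity both become large `|x|`.
  set H : ℂ → ℂ := fun w => K (Complex.exp w) * Complex.exp w with hH
  have hderiv : ∀ s : Set ℝ, ∀ x ∈ s, HasDerivWithinAt Real.exp (Real.exp x) s x :=
    fun s x _ => (Real.hasDerivAt_exp x).hasDerivWithinAt
  have hHx : ∀ x y : ℝ, H (x + y * Complex.I) =
      |Real.exp x| • (K (polar (Real.exp x) y) * Complex.exp (Complex.I * y)) := by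
    intro x y
    simp only [hH, exp_eq_polar, abs_of_pos (Real.exp_pos x)]
    rw [polar, Complex.real_smul]; ring
  have hint : ∀ y : ℝ, ∫ r in Set.Ioi (0 : ℝ), K (polar r y) * Complex.exp (Complex.I * y) =
      ∫ x : ℝ, H (x + y * Complex.I) := by
    intro y
    rw [← image_exp_univ, integral_image_eq_integral_abs_deriv_smul MeasurableSet.univ
      (hderiv _) Real.exp_injective.injOn, Measure.restrict_univ]
    simp_rw [hHx]
  have hintble : ∀ y : ℝ, IntegrableOn (fun r : ℝ => K (polar r y)) (Set.Ioi 0) →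
      Integrable fun x : ℝ => H (x + y * Complex.I) := by
    intro y hy
    have h1 : IntegrableOn (fun r : ℝ => K (polar r y) * Complex.exp (Complex.I * y))
      (Set.Ioi 0) := Integrable.mul_const hy _
    rw [← image_exp_univ, integrableOn_image_iff_integrableOn_abs_deriv_smul MeasurableSet.univ
      (hderiv _) Real.exp_injective.injOn, integrableOn_univ] at h1
    simpa only [hHx] using h1
  rw [hint, hint]
  refine integral_horizontal_eq (X := Real.log R) hab ?_ (hintble _ ha) (hintble _ hb) hC ?_
  · intro z hz
    have hz' : Complex.exp z = polar (Real.exp z.re) z.im := by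
      rw [← exp_eq_polar, Complex.re_add_im]
    have h1 : DifferentiableAt ℂ K (Complex.exp z) := by
      rw [hz']; exact hd _ (Real.exp_pos _) _ hz
    exact (h1.comp z Complex.differentiableAt_exp).mul Complex.differentiableAt_exp
  · intro y hy
    refine le_trans (le_of_eq ?_) (hT y hy)
    have himage : {r : ℝ | 0 < r ∧ (r ≤ R⁻¹ ∨ R ≤ r)} =
        Real.exp '' {x : ℝ | Real.log R ≤ |x|} := by
      ext r
      constructor
      · rintro ⟨hr, h⟩
        refine ⟨Real.log r, ?_, Real.exp_log hr⟩
        rcases h with h | h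
        · have := Real.log_le_log hr h
          rw [Real.log_inv] at this
          exact (le_neg_of_le_neg this).trans (neg_le_abs _)
        · exact (Real.log_le_log hR h).trans (le_abs_self _)
      · rintro ⟨x, hx, rfl⟩
        refine ⟨Real.exp_pos x, ?_⟩
        rcases le_abs.1 (show Real.log R ≤ |x| from hx) with h | h
        · right; rw [← Real.exp_log hR]; exact Real.exp_le_exp.2 h
        · left; rw [← Real.exp_log hR, ← Real.exp_neg]; exact Real.exp_le_exp.2 (by linarith)
    rw [himage, lintegral_image_eq_lintegral_abs_deriv_mul
      (isClosed_le continuous_const continuous_abs).measurableSet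
      (hderiv _) Real.exp_injective.injOn]
    refine lintegral_congr fun x => ?_
    rw [hHx, enorm_smul, enorm_mul]
    have : ‖Complex.exp (Complex.I * y)‖ₑ = 1 := by
      rw [mul_comm, ← ofReal_norm, Complex.norm_exp_ofReal_mul_I, ENNReal.ofReal_one]
    rw [this, mul_one, Real.enorm_eq_ofReal_abs, abs_abs]

/-! ### Weak convergence of `L²`-bounded families -/

section Vitali

variable {X : Type*} [MeasurableSpace X] {μ : Measure X}

theorem eLpNorm_two_le {f : X → ℂ} {C : ℝ≥0∞} (h : ∫⁻ x, ‖f x‖ₑ ^ 2 ∂μ ≤ C) :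
    eLpNorm f 2 μ ≤ C ^ (1 / 2 : ℝ) := by
  rw [eLpNorm_eq_lintegral_rpow_enorm_toReal (by norm_num) (by norm_num)]
  simp only [ENNReal.toReal_ofNat, ENNReal.rpow_ofNat]
  exact ENNReal.rpow_le_rpow h (by norm_num)

theorem memLp_two_of_lintegral_le {f : X → ℂ} {C : ℝ≥0∞} (hC : C ≠ ∞)
    (hf : AEStronglyMeasurable f μ) (h : ∫⁻ x, ‖f x‖ₑ ^ 2 ∂μ ≤ C) : MemLp f 2 μ :=
  ⟨hf, (eLpNorm_two_le h).trans_lt (ENNReal.rpow_lt_top_of_nonneg (by norm_num) hC)⟩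

/-- Fatou's lemma for `L²` bounds. -/
theorem lintegral_sq_le_of_tendsto {ι : Type*} {l : Filter ι} [l.IsCountablyGenerated] [l.NeBot]
    {f : ι → X → ℂ} {g : X → ℂ} {C : ℝ≥0∞} (hf : ∀ i, AEStronglyMeasurable (f i) μ)
    (hC : ∀ᶠ i in l, ∫⁻ x, ‖f i x‖ₑ ^ 2 ∂μ ≤ C)
    (hfg : ∀ᵐ x ∂μ, Tendsto (fun i => f i x) l (𝓝 (g x))) : ∫⁻ x, ‖g x‖ₑ ^ 2 ∂μ ≤ C := by
  calc ∫⁻ x, ‖g x‖ₑ ^ 2 ∂μ = ∫⁻ x, liminf (fun i => ‖f i x‖ₑ ^ 2) l ∂μ := by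
        refine lintegral_congr_ae (hfg.mono fun x hx => ?_)
        exact (ENNReal.Tendsto.pow hx.enorm).liminf_eq.symm
    _ ≤ liminf (fun i => ∫⁻ x, ‖f i x‖ₑ ^ 2 ∂μ) l :=
        lintegral_liminf_le' fun i => (hf i).enorm.pow_const 2
    _ ≤ C := by
        refine (liminf_le_liminf hC).trans ?_
        rw [liminf_const]

/-- An `L²`-bounded sequence that converges almost everywhere converges weakly, also when it is
tested against a convergent sequence of kernels with a common square integrable majorant. -/
theorem tendsto_integral_mul_of_bounded_sq {f K : ℕ → X → ℂ} {g k : X → ℂ} {κ : X → ℝ}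
    {C : ℝ≥0∞} (hC : C ≠ ∞) (hf : ∀ n, AEStronglyMeasurable (f n) μ)
    (hfC : ∀ n, ∫⁻ x, ‖f n x‖ₑ ^ 2 ∂μ ≤ C) (hK : ∀ n, AEStronglyMeasurable (K n) μ)
    (hκ : MemLp κ 2 μ) (hKκ : ∀ n, ∀ᵐ x ∂μ, ‖K n x‖ ≤ κ x)
    (hfg : ∀ᵐ x ∂μ, Tendsto (fun n => f n x) atTop (𝓝 (g x)))
    (hKk : ∀ᵐ x ∂μ, Tendsto (fun n => K n x) atTop (𝓝 (k x))) :
    Tendsto (fun n => ∫ x, f n x * K n x ∂μ) atTop (𝓝 (∫ x, g x * k x ∂μ)) := by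
  have hgm : AEStronglyMeasurable g μ := aestronglyMeasurable_of_tendsto_ae atTop hf hfg
  have hkm : AEStronglyMeasurable k μ := aestronglyMeasurable_of_tendsto_ae atTop hK hKk
  have hg2 : MemLp g 2 μ :=
    memLp_two_of_lintegral_le hC hgm (lintegral_sq_le_of_tendsto hf (.of_forall hfC) hfg)
  have hkκ : ∀ᵐ x ∂μ, ‖k x‖ ≤ κ x := by
    filter_upwards [hKk, ae_all_iff.2 hKκ] with x hx hx'
    exact le_of_tendsto hx.norm (.of_forall hx')
  have hk2 : MemLp k 2 μ := hκ.of_le hkm (hkκ.mono fun x hx => hx.trans (le_abs_self _))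
  have hK2 : ∀ n, MemLp (K n) 2 μ := fun n =>
    hκ.of_le (hK n) ((hKκ n).mono fun x hx => hx.trans (le_abs_self _))
  have hf2 : ∀ n, MemLp (f n) 2 μ := fun n => memLp_two_of_lintegral_le hC (hf n) (hfC n)
  -- The summand 1 keeps `D` nonzero, so that ε can be divided by it below.
  set D : ℝ≥0∞ := C ^ (1 / 2 : ℝ) + 1 with hD
  have hDtop : D ≠ ∞ := ENNReal.add_ne_top.2
    ⟨(ENNReal.rpow_lt_top_of_nonneg (by norm_num) hC).ne, ENNReal.one_ne_top⟩
  have hDpos : D ≠ 0 := by simp [hD]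
  -- By Hölder the constant `D` absorbs `f n`; smallness on small sets and off a set of finite
  -- measure is inherited from `κ` alone. These are the two hypotheses of Vitali's convergence
  -- theorem.
  have hbound : ∀ n s, MeasurableSet s →
      eLpNorm (s.indicator (fun x => f n x * K n x)) 1 μ ≤ D * eLpNorm (s.indicator κ) 2 μ := by
    intro n s hs
    have h1 : s.indicator (fun x => f n x * K n x) = (f n) • (s.indicator (K n)) := by
      ext x; by_cases hx : x ∈ s <;> simp [hx]
    rw [h1]
    refine (eLpNorm_smul_le_mul_eLpNorm (p := 2) (q := 2) ((hK n).indicator hs) (hf n)).trans ?_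
    refine mul_le_mul' ((eLpNorm_two_le (hfC n)).trans le_self_add) ?_
    refine eLpNorm_mono_ae ((hKκ n).mono fun x hx => ?_)
    by_cases hxs : x ∈ s
    · simpa [hxs] using hx.trans (le_abs_self _)
    · simp [hxs]
  have hui : UnifIntegrable (fun n x => f n x * K n x) 1 μ := by
    intro ε hε
    have hε' : 0 < ε / D.toReal := div_pos hε (ENNReal.toReal_pos hDpos hDtop)
    obtain ⟨δ, hδ, h⟩ := hκ.eLpNorm_indicator_le (by norm_num) (by norm_num) hε'
    refine ⟨δ, hδ, fun n s hs hμs => (hbound n s hs).trans ?_⟩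
    refine (mul_le_mul' le_rfl (h s hs hμs)).trans (le_of_eq ?_)
    rw [ENNReal.ofReal_div_of_pos (ENNReal.toReal_pos hDpos hDtop), ENNReal.ofReal_toReal hDtop,
      ENNReal.mul_div_cancel hDpos hDtop]
  have hut : UnifTight (fun n x => f n x * K n x) 1 μ := by
    intro ε hε
    have hε' : (ε : ℝ≥0∞) / D ≠ 0 :=
      (ENNReal.div_pos (ENNReal.coe_ne_zero.2 hε.ne') hDtop).ne'
    obtain ⟨s, hs, hμs, h⟩ := hκ.exists_eLpNorm_indicator_compl_lt (by norm_num) hε'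
    refine ⟨s, hμs.ne, fun n => (hbound n sᶜ hs.compl).trans ?_⟩
    refine (mul_le_mul' le_rfl h.le).trans (le_of_eq ?_)
    rw [ENNReal.mul_div_cancel hDpos hDtop]
  have hgk : MemLp (fun x => g x * k x) 1 μ := hk2.mul' hg2
  have hlim := tendsto_Lp_of_tendsto_ae le_rfl ENNReal.one_ne_top
    (fun n => (hf n).mul (hK n)) hgk hui hut
    (by filter_upwards [hfg, hKk] with x h1 h2 using h1.mul h2)
  exact tendsto_integral_of_L1' _ hgk.1
    (.of_forall fun n => memLp_one_iff_integrable.1 ((hK2 n).mul' (hf2 n))) hlim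

end Vitali

/-! ### Bounds for the Cauchy kernel on rays -/

/-- This is the square integrable majorant, up to a constant, of the Cauchy kernel on rays that
avoid the pole. -/
theorem memLp_inv_one_add : MemLp (fun r : ℝ => (1 + r)⁻¹) 2 (volume.restrict (Set.Ioi 0)) := by
  have hm : AEStronglyMeasurable (fun r : ℝ => (1 + r)⁻¹) (volume.restrict (Set.Ioi 0)) :=
    (measurable_const.add measurable_id).inv.aestronglyMeasurable
  rw [memLp_two_iff_integrable_sq hm]
  refine (integrable_inv_one_add_sq.integrableOn (s := Set.Ioi (0 : ℝ))).mono' (hm.pow 2) ?_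
  filter_upwards [ae_restrict_mem measurableSet_Ioi] with r hr
  have hr' : 0 < r := hr
  rw [Real.norm_of_nonneg (by positivity), inv_pow]
  exact inv_anti₀ (by positivity) (by nlinarith)

theorem lintegral_inv_one_add_sq_ne_top :
    ∫⁻ r in Set.Ioi (0 : ℝ), ENNReal.ofReal ((1 + r)⁻¹ ^ 2) ≠ ∞ := by
  have h := (memLp_two_iff_integrable_sq memLp_inv_one_add.1).1 memLp_inv_one_add
  exact h.lintegral_lt_top.ne

theorem polar_re (r θ : ℝ) : (polar r θ).re = r * Real.cos θ := by
  rw [polar, mul_comm Complex.I, Complex.exp_mul_I, ← Complex.ofReal_cos, ← Complex.ofReal_sin]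
  simp only [Complex.mul_re, Complex.add_re, Complex.add_im, Complex.ofReal_re, Complex.ofReal_im,
    Complex.I_re, Complex.I_im, Complex.mul_im]
  ring

theorem polar_im (r θ : ℝ) : (polar r θ).im = r * Real.sin θ := by
  rw [polar, mul_comm Complex.I, Complex.exp_mul_I, ← Complex.ofReal_cos, ← Complex.ofReal_sin]
  simp only [Complex.mul_re, Complex.add_re, Complex.add_im, Complex.ofReal_re, Complex.ofReal_im,
    Complex.I_re, Complex.I_im, Complex.mul_im]
  ring

/-- The cosine rule. -/
theorem normSq_polar_sub_polar (r ρ θ φ : ℝ) :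
    ‖polar r θ - polar ρ φ‖ ^ 2 = r ^ 2 + ρ ^ 2 - 2 * r * ρ * Real.cos (θ - φ) := by
  rw [← Complex.normSq_eq_norm_sq, Complex.normSq_apply]
  rw [Complex.sub_re, Complex.sub_im, polar_re, polar_re, polar_im, polar_im, Real.cos_sub]
  linear_combination r ^ 2 * Real.sin_sq_add_cos_sq θ + ρ ^ 2 * Real.sin_sq_add_cos_sq φ

/-- The distance of a point from a family of rays that stays away from it. -/
theorem exists_le_norm_polar_sub {ρ φ κ : ℝ} (hρ : 0 < ρ) (hκ : κ < 1) :
    ∃ c : ℝ, 0 < c ∧ ∀ r θ : ℝ, 0 ≤ r → Real.cos (θ - φ) ≤ κ →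
      c * (1 + r) ≤ ‖polar r θ - polar ρ φ‖ := by
  set m : ℝ := min 1 ρ with hm
  have hm0 : 0 < m := lt_min one_pos hρ
  -- Truncation at 0 allows 2rρ ≤ r² + ρ² to be multiplied by `κ'`. The cosine rule then gives at
  -- least (1 - κ')(r² + ρ²), and `m` compares r² + ρ² with 1 + r².
  set κ' : ℝ := max κ 0 with hκ'
  have hκ'1 : κ' < 1 := max_lt hκ one_pos
  have hκ'0 : 0 ≤ κ' := le_max_right _ _
  refine ⟨(1 - κ') * m / 2, by have := sub_pos.2 hκ'1; positivity, fun r θ hr hc => ?_⟩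
  refine le_of_sq_le_sq ?_ (norm_nonneg _)
  rw [normSq_polar_sub_polar]
  have h1 : 2 * r * ρ * Real.cos (θ - φ) ≤ 2 * r * ρ * κ' :=
    mul_le_mul_of_nonneg_left (hc.trans (le_max_left _ _)) (by positivity)
  have h2 : 2 * r * ρ * κ' ≤ (r ^ 2 + ρ ^ 2) * κ' :=
    mul_le_mul_of_nonneg_right (by nlinarith [sq_nonneg (r - ρ)]) hκ'0
  have h3 : m ^ 2 * (1 + r ^ 2) ≤ r ^ 2 + ρ ^ 2 := by
    have h31 : m ^ 2 ≤ 1 := by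
      have : m ≤ 1 := min_le_left _ _
      nlinarith
    have h32 : m ^ 2 ≤ ρ ^ 2 := by
      have : m ≤ ρ := min_le_right _ _
      nlinarith
    nlinarith [sq_nonneg r]
  have h4 : (1 - κ') ^ 2 ≤ 1 - κ' := by nlinarith
  have h5 : (1 + r) ^ 2 ≤ 2 * (1 + r ^ 2) := by nlinarith [sq_nonneg (1 - r)]
  calc ((1 - κ') * m / 2 * (1 + r)) ^ 2
      = (1 - κ') ^ 2 * (m ^ 2 * (1 + r) ^ 2) / 4 := by ring
    _ ≤ (1 - κ') * (r ^ 2 + ρ ^ 2) := by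
        have h6 : m ^ 2 * (1 + r) ^ 2 ≤ 2 * (r ^ 2 + ρ ^ 2) := by nlinarith [sq_nonneg m]
        have h7 : 0 ≤ m ^ 2 * (1 + r) ^ 2 := by positivity
        nlinarith [mul_le_mul h4 h6 h7 (by linarith : (0 : ℝ) ≤ 1 - κ'), sq_nonneg r, sq_nonneg ρ,
          mul_nonneg (by linarith : (0 : ℝ) ≤ 1 - κ') (by positivity : 0 ≤ r ^ 2 + ρ ^ 2)]
    _ ≤ _ := by linarith

theorem exists_cos_le {φ θa θb : ℝ} (h : ∀ θ ∈ Set.Icc θa θb, Real.cos (θ - φ) < 1) :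
    ∃ κ < (1 : ℝ), ∀ θ ∈ Set.Icc θa θb, Real.cos (θ - φ) ≤ κ := by
  rcases (Set.Icc θa θb).eq_empty_or_nonempty with he | hne
  · exact ⟨0, one_pos, by simp [he]⟩
  · obtain ⟨x, hx, hmax⟩ := isCompact_Icc.exists_isMaxOn hne
      (f := fun θ => Real.cos (θ - φ)) (by fun_prop)
    exact ⟨_, h x hx, fun θ hθ => hmax hθ⟩

theorem cos_lt_one {x : ℝ} (h0 : 0 < x) (h1 : x < 2 * Real.pi) : Real.cos x < 1 := by
  refine lt_of_le_of_ne (Real.cos_le_one x) fun h => ?_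
  rw [Real.cos_eq_one_iff_of_lt_of_lt (by linarith [Real.pi_pos]) h1] at h
  exact h0.ne' h

theorem cos_lt_one_of_neg {x : ℝ} (h0 : x < 0) (h1 : -(2 * Real.pi) < x) : Real.cos x < 1 := by
  rw [← Real.cos_neg]; exact cos_lt_one (by linarith) (by linarith)

/-! ### The Cauchy formula for the Hardy space of a sector -/

/-- The Cauchy integral of `g` over the ray with direction `θ`, without the factor `1/(2πi)`. -/
noncomputable def cauchyRay (θ : ℝ) (g : ℝ → ℂ) (z : ℂ) : ℂ :=
  ∫ r in Set.Ioi (0 : ℝ), g r * (Complex.exp (Complex.I * θ) / (polar r θ - z))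

/-- `G` belongs to the Hardy space `H₂` of the sector `θ₁ < arg z < θ₂`. -/
def HardySector (G : ℂ → ℂ) (θ₁ θ₂ : ℝ) : Prop :=
  (∀ r : ℝ, 0 < r → ∀ θ ∈ Set.Ioo θ₁ θ₂, DifferentiableAt ℂ G (polar r θ)) ∧
    ∃ C : ℝ≥0∞, C ≠ ∞ ∧
      ∀ θ ∈ Set.Ioo θ₁ θ₂, ∫⁻ r in Set.Ioi (0 : ℝ), ‖G (polar r θ)‖ₑ ^ 2 ≤ C

theorem polar_add_pi (r θ : ℝ) : polar r (θ + Real.pi) = -polar r θ := by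
  rw [polar, polar, Complex.ofReal_add, mul_add, Complex.exp_add, mul_comm Complex.I (Real.pi : ℂ),
    Complex.exp_pi_mul_I]
  ring

theorem polar_add_two_pi (r θ : ℝ) : polar r (θ + 2 * Real.pi) = polar r θ := by
  rw [two_mul, ← add_assoc, polar_add_pi, polar_add_pi, neg_neg]

/-- Points near `ρ e^{iφ}` have polar coordinates near `(ρ, φ)`. -/
theorem eventually_polar {ρ φ ε : ℝ} (hρ : 0 < ρ) (hε : 0 < ε) :
    ∀ᶠ ζ in 𝓝 (polar ρ φ), ∃ r θ : ℝ, 0 < r ∧ |r - ρ| < ε ∧ |θ - φ| < ε ∧ ζ = polar r θ := by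
  -- Rotation by -φ moves the base point to the positive axis, away from the branch cut of the
  -- argument.
  set f : ℂ → ℂ := fun ζ => ζ * Complex.exp (-(Complex.I * φ)) with hf
  have hf0 : f (polar ρ φ) = (ρ : ℂ) := by
    simp only [hf, polar]
    rw [mul_assoc, ← Complex.exp_add, add_neg_cancel, Complex.exp_zero, mul_one]
  have hfc : Continuous f := by fun_prop
  have harg : Tendsto (fun ζ => Complex.arg (f ζ)) (𝓝 (polar ρ φ)) (𝓝 0) := by
    have h1 : ContinuousAt Complex.arg (f (polar ρ φ)) :=
      Complex.continuousAt_arg (by rw [hf0]; exact Complex.ofReal_mem_slitPlane.2 hρ)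
    have h2 := ContinuousAt.comp (f := f) h1 hfc.continuousAt
    have h3 : Complex.arg (f (polar ρ φ)) = 0 := by
      rw [hf0]; exact Complex.arg_ofReal_of_nonneg hρ.le
    rw [← h3]; exact h2
  have hnorm : Tendsto (fun ζ : ℂ => ‖ζ‖) (𝓝 (polar ρ φ)) (𝓝 ρ) := by
    have := (continuous_norm (E := ℂ)).tendsto (polar ρ φ)
    rwa [norm_polar hρ.le] at this
  filter_upwards [harg.eventually (Metric.ball_mem_nhds 0 hε),
    hnorm.eventually (Metric.ball_mem_nhds ρ hε), hnorm.eventually (lt_mem_nhds hρ)]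
    with ζ h1 h2 h3
  refine ⟨‖ζ‖, φ + Complex.arg (f ζ), h3, by simpa [Real.dist_eq] using h2,
    by simpa [Real.dist_eq] using h1, ?_⟩
  have h4 : ‖f ζ‖ = ‖ζ‖ := by
    simp only [hf]
    rw [norm_mul, ← mul_neg, mul_comm Complex.I, ← Complex.ofReal_neg,
      Complex.norm_exp_ofReal_mul_I, mul_one]
  have h5 := Complex.norm_mul_exp_arg_mul_I (f ζ)
  rw [h4] at h5
  rw [polar, Complex.ofReal_add, mul_add, Complex.exp_add, mul_comm Complex.I
    (Complex.arg (f ζ) : ℂ), mul_left_comm, h5]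
  simp only [hf]
  rw [mul_left_comm, ← Complex.exp_add, add_neg_cancel, Complex.exp_zero, mul_one]

theorem HardySector.eventually_differentiableAt {G : ℂ → ℂ} {θ₁ θ₂ ρ φ : ℝ}
    (hG : HardySector G θ₁ θ₂) (hρ : 0 < ρ) (hφ : φ ∈ Set.Ioo θ₁ θ₂) :
    ∀ᶠ ζ in 𝓝 (polar ρ φ), DifferentiableAt ℂ G ζ := by
  have hε : 0 < min (φ - θ₁) (θ₂ - φ) := lt_min (sub_pos.2 hφ.1) (sub_pos.2 hφ.2)
  filter_upwards [eventually_polar (φ := φ) hρ hε] with ζ hζ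
  obtain ⟨r, θ, hr, -, hθ, rfl⟩ := hζ
  have := abs_lt.1 hθ
  exact hG.1 r hr θ ⟨by linarith [min_le_left (φ - θ₁) (θ₂ - φ)],
    by linarith [min_le_right (φ - θ₁) (θ₂ - φ)]⟩

theorem HardySector.mono {G : ℂ → ℂ} {θ₁ θ₂ η₁ η₂ : ℝ} (hG : HardySector G θ₁ θ₂)
    (h₁ : θ₁ ≤ η₁) (h₂ : η₂ ≤ θ₂) : HardySector G η₁ η₂ :=
  ⟨fun r hr θ hθ => hG.1 r hr θ ⟨h₁.trans_lt hθ.1, hθ.2.trans_le h₂⟩,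
    hG.2.imp fun _ h => ⟨h.1, fun θ hθ => h.2 θ ⟨h₁.trans_lt hθ.1, hθ.2.trans_le h₂⟩⟩⟩

theorem HardySector.continuousOn_ray {G : ℂ → ℂ} {θ₁ θ₂ θ : ℝ} (hG : HardySector G θ₁ θ₂)
    (hθ : θ ∈ Set.Ioo θ₁ θ₂) : ContinuousOn (fun r : ℝ => G (polar r θ)) (Set.Ioi 0) :=
  fun r hr => (ContinuousAt.comp (f := fun r : ℝ => polar r θ) (hG.1 r hr θ hθ).continuousAt
    (continuous_polar_left θ).continuousAt).continuousWithinAt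

theorem HardySector.aestronglyMeasurable {G : ℂ → ℂ} {θ₁ θ₂ θ : ℝ} (hG : HardySector G θ₁ θ₂)
    (hθ : θ ∈ Set.Ioo θ₁ θ₂) :
    AEStronglyMeasurable (fun r : ℝ => G (polar r θ)) (volume.restrict (Set.Ioi 0)) :=
  (hG.continuousOn_ray hθ).aestronglyMeasurable measurableSet_Ioi

/-- The inequality of arithmetic and geometric means trades the mixed product for two squares, so
the L¹ bound depends on `f` only through `C` and is uniform over the rays of a sector. The set `S`
is the whole ray or its part far from a pole. -/
theorem lintegral_enorm_le_of_sq {f K : ℝ → ℂ} {A : ℝ} (hA : 0 ≤ A) {C : ℝ≥0∞} {S : Set ℝ}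
    (hS : MeasurableSet S) (hS' : S ⊆ Set.Ioi 0)
    (hf : ∫⁻ r in Set.Ioi (0 : ℝ), ‖f r‖ₑ ^ 2 ≤ C)
    (hK : ∀ r ∈ S, ‖K r‖ ≤ A * (‖f r‖ * (1 + r)⁻¹ + (1 + r)⁻¹ ^ 2)) :
    ∫⁻ r in S, ‖K r‖ₑ ≤ ENNReal.ofReal A *
      (C + ENNReal.ofReal 2 * ∫⁻ r in Set.Ioi (0 : ℝ), ENNReal.ofReal ((1 + r)⁻¹ ^ 2)) := by
  have hm : Measurable fun r : ℝ => ENNReal.ofReal ((1 + r)⁻¹ ^ 2) := by fun_prop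
  calc ∫⁻ r in S, ‖K r‖ₑ
      ≤ ∫⁻ r in S, ENNReal.ofReal A *
          (‖f r‖ₑ ^ 2 + ENNReal.ofReal 2 * ENNReal.ofReal ((1 + r)⁻¹ ^ 2)) := by
        refine lintegral_mono_ae ?_
        filter_upwards [ae_restrict_mem hS] with r hr
        have h1 : ‖K r‖ ≤ A * (‖f r‖ ^ 2 + 2 * (1 + r)⁻¹ ^ 2) := by
          refine (hK r hr).trans (mul_le_mul_of_nonneg_left ?_ hA)
          nlinarith [sq_nonneg (‖f r‖ - (1 + r)⁻¹), sq_nonneg ‖f r‖, sq_nonneg (1 + r)⁻¹]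
        rw [← ofReal_norm, ← ofReal_norm, ← ENNReal.ofReal_pow (norm_nonneg _),
          ← ENNReal.ofReal_mul (by norm_num), ← ENNReal.ofReal_add (by positivity) (by positivity),
          ← ENNReal.ofReal_mul hA]
        exact ENNReal.ofReal_le_ofReal h1
    _ ≤ ∫⁻ r in Set.Ioi (0 : ℝ), ENNReal.ofReal A *
          (‖f r‖ₑ ^ 2 + ENNReal.ofReal 2 * ENNReal.ofReal ((1 + r)⁻¹ ^ 2)) :=
        lintegral_mono_set hS'
    _ = ENNReal.ofReal A * ((∫⁻ r in Set.Ioi (0 : ℝ), ‖f r‖ₑ ^ 2) +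
          ENNReal.ofReal 2 * ∫⁻ r in Set.Ioi (0 : ℝ), ENNReal.ofReal ((1 + r)⁻¹ ^ 2)) := by
        rw [lintegral_const_mul' _ _ ENNReal.ofReal_ne_top,
          lintegral_add_right _ (hm.const_mul _), lintegral_const_mul _ hm]
    _ ≤ _ := by gcongr

theorem sq_bound_ne_top {A : ℝ} {C : ℝ≥0∞} (hC : C ≠ ∞) : ENNReal.ofReal A *
      (C + ENNReal.ofReal 2 * ∫⁻ r in Set.Ioi (0 : ℝ), ENNReal.ofReal ((1 + r)⁻¹ ^ 2)) ≠ ∞ :=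
  ENNReal.mul_ne_top ENNReal.ofReal_ne_top (ENNReal.add_ne_top.2
    ⟨hC, ENNReal.mul_ne_top ENNReal.ofReal_ne_top lintegral_inv_one_add_sq_ne_top⟩)

/-- Rotation of ray integrals for functions with a square integrable majorant. -/
theorem integral_ray_eq_of_sq {K G : ℂ → ℂ} {θa θb R A : ℝ} (hab : θa ≤ θb) (hR : 0 < R)
    (hA : 0 ≤ A) (hd : ∀ r : ℝ, 0 < r → ∀ θ ∈ Set.Icc θa θb, DifferentiableAt ℂ K (polar r θ))
    {C : ℝ≥0∞} (hC : C ≠ ∞)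
    (hG : ∀ θ ∈ Set.Icc θa θb, ∫⁻ r in Set.Ioi (0 : ℝ), ‖G (polar r θ)‖ₑ ^ 2 ≤ C)
    (hK : ∀ θ ∈ Set.Icc θa θb, ∀ r : ℝ, 0 < r → (θ = θa ∨ θ = θb ∨ r ≤ R⁻¹ ∨ R ≤ r) →
      ‖K (polar r θ)‖ ≤ A * (‖G (polar r θ)‖ * (1 + r)⁻¹ + (1 + r)⁻¹ ^ 2)) :
    ∫ r in Set.Ioi (0 : ℝ), K (polar r θa) * Complex.exp (Complex.I * θa) =
      ∫ r in Set.Ioi (0 : ℝ), K (polar r θb) * Complex.exp (Complex.I * θb) := by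
  have hint : ∀ θ ∈ Set.Icc θa θb, θ = θa ∨ θ = θb →
      IntegrableOn (fun r : ℝ => K (polar r θ)) (Set.Ioi 0) := by
    intro θ hθ h
    refine ⟨ContinuousOn.aestronglyMeasurable (fun r hr => (ContinuousAt.comp
      (f := fun r : ℝ => polar r θ) (hd r hr θ hθ).continuousAt
      (continuous_polar_left θ).continuousAt).continuousWithinAt) measurableSet_Ioi, ?_⟩
    rw [hasFiniteIntegral_iff_enorm]
    exact (lintegral_enorm_le_of_sq hA measurableSet_Ioi le_rfl (hG θ hθ)
      fun r hr => hK θ hθ r hr (by tauto)).trans_lt (sq_bound_ne_top hC).lt_top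
  have hSm : MeasurableSet {r : ℝ | 0 < r ∧ (r ≤ R⁻¹ ∨ R ≤ r)} :=
    measurableSet_Ioi.inter (measurableSet_Iic.union measurableSet_Ici)
  exact integral_ray_eq hab hd (hint θa ⟨le_rfl, hab⟩ (.inl rfl)) (hint θb ⟨hab, le_rfl⟩ (.inr rfl))
    hR (sq_bound_ne_top hC) fun θ hθ => lintegral_enorm_le_of_sq hA hSm (fun r hr => hr.1)
      (hG θ hθ) fun r hr => hK θ hθ r hr.1 (by have := hr.2; tauto)

theorem inv_le_of_le_mul {c x y : ℝ} (hc : 0 < c) (hx : 0 < x) (h : c * x ≤ y) :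
    y⁻¹ ≤ c⁻¹ * x⁻¹ := by
  rw [← mul_inv]; exact inv_anti₀ (by positivity) h

/-- `hcos` keeps the pole off every ray between `θa` and `θb`, so the integrand is analytic there
and has the majorant required for rotation. -/
theorem HardySector.cauchyRay_eq {G : ℂ → ℂ} {θ₁ θ₂ θa θb ρ φ : ℝ} (hG : HardySector G θ₁ θ₂)
    (ha : θ₁ < θa) (hab : θa ≤ θb) (hb : θb < θ₂) (hρ : 0 < ρ)
    (hcos : ∀ θ ∈ Set.Icc θa θb, Real.cos (θ - φ) < 1) :
    cauchyRay θa (fun r => G (polar r θa)) (polar ρ φ) =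
      cauchyRay θb (fun r => G (polar r θb)) (polar ρ φ) := by
  obtain ⟨κ, hκ, hκ'⟩ := exists_cos_le hcos
  obtain ⟨c, hc, hc'⟩ := exists_le_norm_polar_sub (φ := φ) hρ hκ
  obtain ⟨C, hC, hGC⟩ := hG.2
  have hsub : ∀ θ ∈ Set.Icc θa θb, θ ∈ Set.Ioo θ₁ θ₂ :=
    fun θ hθ => ⟨ha.trans_le hθ.1, hθ.2.trans_lt hb⟩
  have hne : ∀ θ ∈ Set.Icc θa θb, ∀ r : ℝ, 0 < r → polar r θ - polar ρ φ ≠ 0 := by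
    intro θ hθ r hr
    exact norm_pos_iff.1 ((by positivity : 0 < c * (1 + r)).trans_le
      (hc' r θ hr.le (hκ' θ hθ)))
  have h := integral_ray_eq_of_sq (K := fun ζ => G ζ / (ζ - polar ρ φ)) (G := G) (R := 1)
    (A := c⁻¹) hab one_pos (by positivity)
    (fun r hr θ hθ => (hG.1 r hr θ (hsub θ hθ)).div (by fun_prop) (hne θ hθ r hr)) hC
    (fun θ hθ => hGC θ (hsub θ hθ)) (fun θ hθ r hr _ => by
      rw [norm_div, div_eq_mul_inv]
      have h1 := inv_le_of_le_mul hc (by linarith) (hc' r θ hr.le (hκ' θ hθ))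
      have h2 : 0 ≤ c⁻¹ * (1 + r)⁻¹ ^ 2 := by positivity
      nlinarith [mul_le_mul_of_nonneg_left h1 (norm_nonneg (G (polar r θ)))])
  simp only [cauchyRay]
  convert h using 3 <;> ring

theorem integral_two_mul_div_sq_add_sq {ρ : ℝ} (hρ : 0 < ρ) :
    ∫ r in Set.Ioi (0 : ℝ), 2 * ρ / (r ^ 2 + ρ ^ 2) = Real.pi := by
  have h := integral_comp_mul_left_Ioi (fun x : ℝ => (1 + x ^ 2)⁻¹) 0 (inv_pos.2 hρ)
  rw [mul_zero, integral_Ioi_inv_one_add_sq, inv_inv, smul_eq_mul, Real.arctan_zero, sub_zero] at h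
  have h2 : ∀ r : ℝ, 2 * ρ / (r ^ 2 + ρ ^ 2) = 2 / ρ * (1 + (ρ⁻¹ * r) ^ 2)⁻¹ := by
    intro r
    have : r ^ 2 + ρ ^ 2 ≠ 0 := by positivity
    have h3 : 1 + (ρ⁻¹ * r) ^ 2 = (r ^ 2 + ρ ^ 2) / ρ ^ 2 := by field_simp; ring
    rw [h3, inv_div]; field_simp
  simp_rw [h2]
  rw [integral_const_mul, h]
  field_simp

/-- The Cauchy integral of the comparison function `2z / (ζ + z)`. -/
theorem integral_comparison {ρ φ θ : ℝ} (hρ : 0 < ρ) (h₁ : φ - Real.pi < θ) (h₂ : θ < φ) :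
    ∫ r in Set.Ioi (0 : ℝ), 2 * polar ρ φ / (polar r θ + polar ρ φ) / (polar r θ - polar ρ φ) *
      Complex.exp (Complex.I * θ) = Complex.I * Real.pi := by
  set z := polar ρ φ with hz
  -- On the ray perpendicular to `z` the product (ζ + z)(ζ - z) is -(r² + ρ²)e^{2iφ}, so the
  -- integrand is `I` times a real density of mass π. The other rays are reached by rotation
  -- (`key`), since `z` and `-z` both lie outside the range φ - π < θ < φ.
  have hmid : ∫ r in Set.Ioi (0 : ℝ), 2 * z / (polar r (φ - Real.pi / 2) + z) /
      (polar r (φ - Real.pi / 2) - z) * Complex.exp (Complex.I * (φ - Real.pi / 2 : ℝ)) =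
      Complex.I * Real.pi := by
    have hexp : Complex.exp (Complex.I * (φ - Real.pi / 2 : ℝ)) =
        -Complex.I * Complex.exp (Complex.I * φ) := by
      rw [Complex.ofReal_sub, mul_sub, sub_eq_add_neg, Complex.exp_add, mul_comm]
      congr 1
      rw [← mul_neg, mul_comm, Complex.ofReal_div, Complex.ofReal_ofNat, ← neg_div,
        Complex.exp_mul_I, neg_div, Complex.cos_neg, Complex.sin_neg, Complex.cos_pi_div_two,
        Complex.sin_pi_div_two]
      ring
    have hint : ∀ r : ℝ, 2 * z / (polar r (φ - Real.pi / 2) + z) /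
        (polar r (φ - Real.pi / 2) - z) * Complex.exp (Complex.I * (φ - Real.pi / 2 : ℝ)) =
        Complex.I * ((2 * ρ / (r ^ 2 + ρ ^ 2) : ℝ) : ℂ) := by
      intro r
      simp only [polar, hexp, hz]
      set e := Complex.exp (Complex.I * φ) with he
      have he0 : e ≠ 0 := Complex.exp_ne_zero _
      have hpos : ((r ^ 2 + ρ ^ 2 : ℝ) : ℂ) ≠ 0 := by
        exact_mod_cast (by positivity : r ^ 2 + ρ ^ 2 ≠ 0)
      have hprod : ((r : ℂ) * (-Complex.I * e) + ρ * e) * ((r : ℂ) * (-Complex.I * e) - ρ * e) =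
          -((r ^ 2 + ρ ^ 2 : ℝ) : ℂ) * e ^ 2 := by
        push_cast
        linear_combination (r : ℂ) ^ 2 * e ^ 2 * Complex.I_sq
      rw [div_div, hprod, Complex.ofReal_div]
      push_cast at hpos ⊢
      field_simp
    simp_rw [hint]
    rw [integral_const_mul, integral_complex_ofReal, integral_two_mul_div_sq_add_sq hρ]
  have key : ∀ θa θb : ℝ, φ - Real.pi < θa → θa ≤ θb → θb < φ →
      ∫ r in Set.Ioi (0 : ℝ), 2 * z / (polar r θa + z) / (polar r θa - z) *
        Complex.exp (Complex.I * θa) =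
      ∫ r in Set.Ioi (0 : ℝ), 2 * z / (polar r θb + z) / (polar r θb - z) *
        Complex.exp (Complex.I * θb) := by
    intro θa θb ha hab hb
    have hpi := Real.pi_pos
    obtain ⟨κ, hκ, hκ'⟩ := exists_cos_le (φ := φ) (θa := θa) (θb := θb)
      fun θ hθ => cos_lt_one_of_neg (by linarith [hθ.2]) (by linarith [hθ.1])
    obtain ⟨κ₂, hκ₂, hκ₂'⟩ := exists_cos_le (φ := φ + Real.pi) (θa := θa) (θb := θb)
      fun θ hθ => cos_lt_one_of_neg (by linarith [hθ.2]) (by linarith [hθ.1])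
    obtain ⟨c, hc, hc'⟩ := exists_le_norm_polar_sub (φ := φ) hρ hκ
    obtain ⟨c₂, hc₂, hc₂'⟩ := exists_le_norm_polar_sub (φ := φ + Real.pi) hρ hκ₂
    simp only [polar_add_pi, sub_neg_eq_add] at hc₂'
    have hne : ∀ θ ∈ Set.Icc θa θb, ∀ r : ℝ, 0 < r → polar r θ - z ≠ 0 ∧ polar r θ + z ≠ 0 :=
      fun θ hθ r hr => ⟨norm_pos_iff.1 ((by positivity : 0 < c * (1 + r)).trans_le
        (hc' r θ hr.le (hκ' θ hθ))), norm_pos_iff.1 ((by positivity : 0 < c₂ * (1 + r)).trans_le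
        (hc₂' r θ hr.le (hκ₂' θ hθ)))⟩
    refine integral_ray_eq_of_sq (K := fun ζ => 2 * z / (ζ + z) / (ζ - z)) (G := 0)
      (R := 1) (A := 2 * ρ * (c⁻¹ * c₂⁻¹)) hab one_pos (by positivity) (fun r hr θ hθ => ?_)
      ENNReal.zero_ne_top (fun θ hθ => by simp) (fun θ hθ r hr _ => ?_)
    · exact ((differentiableAt_const (2 * z)).div (differentiableAt_id.add_const z)
        (hne θ hθ r hr).2).div (differentiableAt_id.sub_const z) (hne θ hθ r hr).1
    · have h1 := inv_le_of_le_mul hc (by linarith) (hc' r θ hr.le (hκ' θ hθ))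
      have h2 := inv_le_of_le_mul hc₂ (by linarith) (hc₂' r θ hr.le (hκ₂' θ hθ))
      have h3 := mul_le_mul h1 h2 (by positivity) (by positivity)
      rw [div_div, norm_div, norm_mul, norm_mul, hz, norm_polar hρ.le, div_eq_mul_inv, mul_inv,
        Complex.norm_ofNat]
      simp only [Pi.zero_apply, norm_zero, zero_mul, zero_add]
      calc 2 * ρ * (‖polar r θ + polar ρ φ‖⁻¹ * ‖polar r θ - polar ρ φ‖⁻¹)
          = 2 * ρ * (‖polar r θ - polar ρ φ‖⁻¹ * ‖polar r θ + polar ρ φ‖⁻¹) := by ring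
        _ ≤ 2 * ρ * (c⁻¹ * (1 + r)⁻¹ * (c₂⁻¹ * (1 + r)⁻¹)) := by gcongr
        _ = _ := by ring
  have hpi := Real.pi_pos
  rcases le_total θ (φ - Real.pi / 2) with h | h
  · rw [key θ _ h₁ h (by linarith)]; exact hmid
  · rw [← key _ θ (by linarith) h h₂]; exact hmid

/-- Replacing φ by φ + π changes `z` to `-z`, which turns the integrand into its negative. -/
theorem integral_comparison' {ρ φ θ : ℝ} (hρ : 0 < ρ) (h₁ : φ < θ) (h₂ : θ < φ + Real.pi) :
    ∫ r in Set.Ioi (0 : ℝ), 2 * polar ρ φ / (polar r θ + polar ρ φ) / (polar r θ - polar ρ φ) *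
      Complex.exp (Complex.I * θ) = -(Complex.I * Real.pi) := by
  have h := integral_comparison (φ := φ + Real.pi) hρ (by linarith) h₂
  rw [← h, ← integral_neg]
  refine integral_congr_ae (.of_forall fun r => ?_)
  simp only [polar_add_pi, sub_neg_eq_add, ← sub_eq_add_neg]
  rw [div_div, div_div, mul_comm (polar r θ + _)]
  ring

/-- Only the difference of the radii is used, so the bound is uniform in the angle and holds even on
the ray through the pole. -/
theorem le_norm_polar_sub_of_far {ρ r θ φ : ℝ} (hρ : 0 < ρ) (hr : 0 < r)
    (h : r ≤ ρ / 2 ∨ 2 * ρ ≤ r) :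
    ρ / (2 * (1 + ρ)) * (1 + r) ≤ ‖polar r θ - polar ρ φ‖ := by
  have h1 : |r - ρ| ≤ ‖polar r θ - polar ρ φ‖ := by
    have := abs_norm_sub_norm_le (polar r θ) (polar ρ φ)
    rwa [norm_polar hr.le, norm_polar hρ.le] at this
  refine le_trans ?_ h1
  rw [div_mul_eq_mul_div, div_le_iff₀ (by positivity)]
  rcases h with h | h
  · rw [abs_sub_comm, abs_of_nonneg (by linarith)]
    nlinarith
  · rw [abs_of_nonneg (by linarith)]
    nlinarith

theorem hcomparison_integrable {ρ φ θ : ℝ} (hρ : 0 < ρ) (hc₁ : Real.cos (θ - φ) < 1)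
    (hc₂ : Real.cos (θ - (φ + Real.pi)) < 1) : IntegrableOn (fun r : ℝ =>
      2 * polar ρ φ / (polar r θ + polar ρ φ) / (polar r θ - polar ρ φ) *
      Complex.exp (Complex.I * θ)) (Set.Ioi 0) := by
  obtain ⟨c, hc, hc'⟩ := exists_le_norm_polar_sub (φ := φ) hρ hc₁
  obtain ⟨c₂, hc₂, hc₂'⟩ := exists_le_norm_polar_sub (φ := φ + Real.pi) hρ hc₂
  simp only [polar_add_pi, sub_neg_eq_add] at hc₂'
  have hm : ∀ w : ℂ, Measurable fun r : ℝ => polar r θ + w := fun w =>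
    ((continuous_polar_left θ).add continuous_const).measurable
  have hi := ((memLp_two_iff_integrable_sq memLp_inv_one_add.1).1 memLp_inv_one_add).const_mul
    (2 * ρ * (c⁻¹ * c₂⁻¹))
  refine hi.mono' ?_ ?_
  · refine Measurable.aestronglyMeasurable ?_
    simp_rw [sub_eq_add_neg]
    exact ((measurable_const.div (hm _)).div (hm _)).mul_const _
  · filter_upwards [ae_restrict_mem measurableSet_Ioi] with r hr
    have hr' : 0 < r := hr
    have h1 := inv_le_of_le_mul hc (by linarith) (hc' r θ hr'.le le_rfl)
    have h2 := inv_le_of_le_mul hc₂ (by linarith) (hc₂' r θ hr'.le le_rfl)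
    rw [norm_mul, mul_comm Complex.I, Complex.norm_exp_ofReal_mul_I, mul_one, div_div, norm_div,
      norm_mul, norm_mul, norm_polar hρ.le, div_eq_mul_inv, mul_inv, Complex.norm_ofNat]
    calc 2 * ρ * (‖polar r θ + polar ρ φ‖⁻¹ * ‖polar r θ - polar ρ φ‖⁻¹)
        = 2 * ρ * (‖polar r θ - polar ρ φ‖⁻¹ * ‖polar r θ + polar ρ φ‖⁻¹) := by ring
      _ ≤ 2 * ρ * (c⁻¹ * (1 + r)⁻¹ * (c₂⁻¹ * (1 + r)⁻¹)) := by gcongr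
      _ = _ := by ring

theorem HardySector.memLp {G : ℂ → ℂ} {θ₁ θ₂ θ : ℝ} (hG : HardySector G θ₁ θ₂)
    (hθ : θ ∈ Set.Ioo θ₁ θ₂) :
    MemLp (fun r : ℝ => G (polar r θ)) 2 (volume.restrict (Set.Ioi 0)) :=
  hG.2.elim fun _ h => memLp_two_of_lintegral_le h.1 (hG.aestronglyMeasurable hθ) (h.2 θ hθ)

theorem measurable_kernel (θ : ℝ) (z : ℂ) :
    Measurable fun r : ℝ => Complex.exp (Complex.I * θ) / (polar r θ - z) :=
  measurable_const.div ((continuous_polar_left θ).measurable.sub_const z)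

theorem norm_kernel_le {c : ℝ} {z : ℂ} {r θ : ℝ} (hc : 0 < c) (hr : 0 < r)
    (h : c * (1 + r) ≤ ‖polar r θ - z‖) :
    ‖Complex.exp (Complex.I * θ) / (polar r θ - z)‖ ≤ c⁻¹ * (1 + r)⁻¹ := by
  rw [norm_div, mul_comm, Complex.norm_exp_ofReal_mul_I, one_div]
  exact inv_le_of_le_mul hc (by linarith) h

theorem memLp_kernel {ρ φ θ : ℝ} (hρ : 0 < ρ) (hcos : Real.cos (θ - φ) < 1) :
    MemLp (fun r : ℝ => Complex.exp (Complex.I * θ) / (polar r θ - polar ρ φ)) 2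
      (volume.restrict (Set.Ioi 0)) := by
  obtain ⟨c, hc, hc'⟩ := exists_le_norm_polar_sub (φ := φ) hρ hcos
  refine (memLp_inv_one_add.const_mul c⁻¹).of_le (measurable_kernel θ _).aestronglyMeasurable ?_
  filter_upwards [ae_restrict_mem measurableSet_Ioi] with r hr
  exact (norm_kernel_le hc hr (hc' r θ (le_of_lt hr) le_rfl)).trans (le_abs_self _)

theorem integrable_mul_kernel {g : ℝ → ℂ} {ρ φ θ : ℝ}
    (hg : MemLp g 2 (volume.restrict (Set.Ioi 0))) (hρ : 0 < ρ)
    (hcos : Real.cos (θ - φ) < 1) :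
    IntegrableOn (fun r : ℝ => g r * (Complex.exp (Complex.I * θ) / (polar r θ - polar ρ φ)))
      (Set.Ioi 0) :=
  memLp_one_iff_integrable.1 ((memLp_kernel hρ hcos).mul' hg)

/-- The jump of the Cauchy integrals over rotating rays when the ray crosses the point `z`. -/
theorem HardySector.cauchyRay_sub {G : ℂ → ℂ} {θ₁ θ₂ θa θb ρ φ : ℝ} (hG : HardySector G θ₁ θ₂)
    (ha : θ₁ < θa) (haφ : θa < φ) (hφb : φ < θb) (hb : θb < θ₂) (hρ : 0 < ρ)
    (hpa : φ - Real.pi < θa) (hpb : θb < φ + Real.pi) :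
    cauchyRay θa (fun r => G (polar r θa)) (polar ρ φ) -
      cauchyRay θb (fun r => G (polar r θb)) (polar ρ φ) =
      2 * Real.pi * Complex.I * G (polar ρ φ) := by
  have hpi := Real.pi_pos
  set z := polar ρ φ with hz
  have hz0 : z ≠ 0 := norm_pos_iff.1 (by rw [hz, norm_polar hρ.le]; exact hρ)
  -- The comparison function 2z/(ζ + z) equals 1 at `z`, decays at infinity, and has its pole at
  -- `-z`, outside the swept sector. Subtracting its multiple gives `f z = 0`, so f(ζ)/(ζ - z)
  -- extends analytically across `z` and has equal integrals over both rays. The factor 2πi comes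
  -- from the explicit integrals of the comparison function.
  set f : ℂ → ℂ := fun ζ => G ζ - G z * (2 * z / (ζ + z)) with hf
  have hfz : f z = 0 := by
    simp only [hf]
    rw [← two_mul, div_self (mul_ne_zero two_ne_zero hz0)]; ring
  have hsub : ∀ θ ∈ Set.Icc θa θb, θ ∈ Set.Ioo θ₁ θ₂ :=
    fun θ hθ => ⟨ha.trans_le hθ.1, hθ.2.trans_lt hb⟩
  obtain ⟨κ₂, hκ₂, hκ₂'⟩ := exists_cos_le (φ := φ + Real.pi) (θa := θa) (θb := θb)
    fun θ hθ => cos_lt_one_of_neg (by linarith [hθ.2]) (by linarith [hθ.1])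
  obtain ⟨c₂, hc₂, hc₂'⟩ := exists_le_norm_polar_sub (φ := φ + Real.pi) hρ hκ₂
  simp only [polar_add_pi, sub_neg_eq_add] at hc₂'
  have hne₂ : ∀ θ ∈ Set.Icc θa θb, ∀ r : ℝ, 0 < r → polar r θ + z ≠ 0 := fun θ hθ r hr =>
    norm_pos_iff.1 ((by positivity : 0 < c₂ * (1 + r)).trans_le (hc₂' r θ hr.le (hκ₂' θ hθ)))
  have hcosa : Real.cos (θa - φ) < 1 := cos_lt_one_of_neg (by linarith) (by linarith)
  have hcosb : Real.cos (θb - φ) < 1 := cos_lt_one (by linarith) (by linarith)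
  obtain ⟨ca, hca, hca'⟩ := exists_le_norm_polar_sub (φ := φ) hρ hcosa
  obtain ⟨cb, hcb, hcb'⟩ := exists_le_norm_polar_sub (φ := φ) hρ hcosb
  set c : ℝ := min (min ca cb) (ρ / (2 * (1 + ρ))) with hcdef
  have hc : 0 < c := lt_min (lt_min hca hcb) (by positivity)
  -- The choice makes r ≤ R⁻¹ imply r ≤ ρ/2 and r ≥ R imply r ≥ 2ρ, where the pole is far whatever
  -- the angle.
  set R : ℝ := max (2 * ρ) (2 / ρ) with hR
  have hRpos : 0 < R := lt_max_of_lt_left (by positivity)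
  have hRinv : R⁻¹ ≤ ρ / 2 := by
    rw [← inv_div]; exact inv_anti₀ (by positivity) (le_max_right _ _)
  have hfar : ∀ θ : ℝ, ∀ r : ℝ, 0 < r → (θ = θa ∨ θ = θb ∨ r ≤ R⁻¹ ∨ R ≤ r) →
      c * (1 + r) ≤ ‖polar r θ - z‖ := by
    intro θ r hr h
    have h1r : 0 ≤ 1 + r := by linarith
    rcases h with rfl | rfl | h | h
    · exact (mul_le_mul_of_nonneg_right ((min_le_left _ _).trans (min_le_left _ _)) h1r).trans
        (hca' r _ hr.le le_rfl)
    · exact (mul_le_mul_of_nonneg_right ((min_le_left _ _).trans (min_le_right _ _)) h1r).trans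
        (hcb' r _ hr.le le_rfl)
    · exact (mul_le_mul_of_nonneg_right (min_le_right _ _) h1r).trans
        (le_norm_polar_sub_of_far hρ hr (.inl (h.trans hRinv)))
    · exact (mul_le_mul_of_nonneg_right (min_le_right _ _) h1r).trans
        (le_norm_polar_sub_of_far hρ hr (.inr ((le_max_left _ _).trans h)))
  have hfd : ∀ r : ℝ, 0 < r → ∀ θ ∈ Set.Icc θa θb,
      ∀ᶠ ζ in 𝓝 (polar r θ), DifferentiableAt ℂ f ζ := by
    intro r hr θ hθ
    have h1 : ∀ᶠ ζ in 𝓝 (polar r θ), ζ + z ≠ 0 :=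
      (continuous_id.add continuous_const).continuousAt.eventually_ne (hne₂ θ hθ r hr)
    filter_upwards [hG.eventually_differentiableAt hr (hsub θ hθ), h1] with ζ h2 h3
    exact h2.sub (((differentiableAt_const (2 * z)).div (differentiableAt_id.add_const z)
      h3).const_mul _)
  have hdslope : ∀ ζ, ζ ≠ z → dslope f z ζ = f ζ / (ζ - z) := by
    intro ζ hζ
    rw [dslope_of_ne _ hζ, slope_def_field, hfz, sub_zero]
  obtain ⟨C, hC, hGC⟩ := hG.2
  have hmain := integral_ray_eq_of_sq (K := dslope f z) (G := G) (R := R)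
    (A := c⁻¹ * (1 + ‖G z‖ * (2 * ρ * c₂⁻¹))) (haφ.trans hφb).le hRpos (by positivity)
    (fun r hr θ hθ => by
      by_cases h : polar r θ = z
      · have h1 := hfd r hr θ hθ
        rw [h] at h1 ⊢
        exact ((Complex.differentiableOn_dslope h1).2 fun ζ hζ =>
          DifferentiableAt.differentiableWithinAt hζ).differentiableAt h1
      · exact (differentiableAt_dslope_of_ne h).2 (hfd r hr θ hθ).self_of_nhds)
    hC (fun θ hθ => hGC θ (hsub θ hθ)) (fun θ hθ r hr h => by
      have h1 := hfar θ r hr h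
      have hne : polar r θ ≠ z := fun h2 => by
        rw [h2, sub_self, norm_zero] at h1
        exact absurd h1 (not_le.2 (by positivity))
      have h2 := inv_le_of_le_mul hc (by linarith) h1
      have h3 := inv_le_of_le_mul hc₂ (by linarith) (hc₂' r θ hr.le (hκ₂' θ hθ))
      have h4 : ‖f (polar r θ)‖ ≤ ‖G (polar r θ)‖ + ‖G z‖ * (2 * ρ * (c₂⁻¹ * (1 + r)⁻¹)) := by
        refine (norm_sub_le _ _).trans (add_le_add le_rfl ?_)
        rw [norm_mul, norm_div, norm_mul, hz, norm_polar hρ.le, Complex.norm_ofNat, div_eq_mul_inv]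
        gcongr
      rw [hdslope _ hne, norm_div, div_eq_mul_inv]
      have h5 : 0 ≤ (1 + r)⁻¹ := by positivity
      have h6 : 0 ≤ ‖G z‖ * (2 * ρ * c₂⁻¹) := by positivity
      calc ‖f (polar r θ)‖ * ‖polar r θ - z‖⁻¹
          ≤ (‖G (polar r θ)‖ + ‖G z‖ * (2 * ρ * (c₂⁻¹ * (1 + r)⁻¹))) * (c⁻¹ * (1 + r)⁻¹) := by
            gcongr
        _ = c⁻¹ * (‖G (polar r θ)‖ * (1 + r)⁻¹ +
              ‖G z‖ * (2 * ρ * c₂⁻¹) * (1 + r)⁻¹ ^ 2) := by ring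
        _ ≤ c⁻¹ * ((1 + ‖G z‖ * (2 * ρ * c₂⁻¹)) * (‖G (polar r θ)‖ * (1 + r)⁻¹) +
              (1 + ‖G z‖ * (2 * ρ * c₂⁻¹)) * (1 + r)⁻¹ ^ 2) := by
            refine mul_le_mul_of_nonneg_left (add_le_add
              (le_mul_of_one_le_left (by positivity) (le_add_of_nonneg_right h6)) ?_)
              (by positivity)
            exact mul_le_mul_of_nonneg_right (le_add_of_nonneg_left zero_le_one) (by positivity)
        _ = _ := by ring)
  have hsplit : ∀ θ : ℝ, θ = θa ∨ θ = θb → Real.cos (θ - φ) < 1 →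
      Real.cos (θ - (φ + Real.pi)) < 1 → θ ∈ Set.Ioo θ₁ θ₂ →
      ∫ r in Set.Ioi (0 : ℝ), dslope f z (polar r θ) * Complex.exp (Complex.I * θ) =
      cauchyRay θ (fun r => G (polar r θ)) z - G z * ∫ r in Set.Ioi (0 : ℝ),
        2 * z / (polar r θ + z) / (polar r θ - z) * Complex.exp (Complex.I * θ) := by
    intro θ hθ hc1 hc2 hmem
    rw [← integral_const_mul, cauchyRay, ← integral_sub
      (integrable_mul_kernel (hG.memLp hmem) hρ hc1)
      ((hcomparison_integrable hρ hc1 hc2).const_mul _)]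
    refine setIntegral_congr_fun measurableSet_Ioi fun r hr => ?_
    have h1 := hfar θ r hr (by tauto)
    have hne : polar r θ ≠ z := fun h2 => by
      rw [h2, sub_self, norm_zero] at h1
      have : 0 < r := hr
      exact absurd h1 (not_le.2 (by positivity))
    have h2 := hdslope _ hne
    simp only [hf] at h2 ⊢
    rw [h2, hz]
    ring
  rw [hsplit θa (.inl rfl) hcosa (cos_lt_one_of_neg (by linarith) (by linarith)) ⟨ha, by linarith⟩,
    hsplit θb (.inr rfl) hcosb (cos_lt_one_of_neg (by linarith) (by linarith)) ⟨by linarith, hb⟩,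
    hz, integral_comparison hρ hpa haφ, integral_comparison' hρ hφb hpb] at hmain
  linear_combination hmain

/-- Boundary values of the Cauchy integrals over rotating rays. -/
theorem HardySector.tendsto_cauchyRay {G : ℂ → ℂ} {θ₁ θ₂ θ₀ ρ φ : ℝ} (hG : HardySector G θ₁ θ₂)
    {l : Filter ℝ} [l.IsCountablyGenerated] (hl : l ≤ 𝓝 θ₀) (hl' : ∀ᶠ θ in l, θ ∈ Set.Ioo θ₁ θ₂)
    (hρ : 0 < ρ) (hcos : Real.cos (θ₀ - φ) < 1) {g : ℝ → ℂ}
    (hg : ∀ᵐ r ∂(volume.restrict (Set.Ioi (0 : ℝ))),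
      Tendsto (fun θ => G (polar r θ)) l (𝓝 (g r))) :
    Tendsto (fun θ => cauchyRay θ (fun r => G (polar r θ)) (polar ρ φ)) l
      (𝓝 (cauchyRay θ₀ g (polar ρ φ))) := by
  -- The filter is countably generated, so sequences of angles suffice. The Hardy bound controls the
  -- L² norms, and the kernels share a majorant once the angles are close to `θ₀`.
  refine tendsto_of_seq_tendsto fun u hu => ?_
  obtain ⟨κ, hκ1, hκ2⟩ := exists_between hcos
  have hev : ∀ᶠ n in atTop, u n ∈ Set.Ioo θ₁ θ₂ ∧ Real.cos (u n - φ) ≤ κ := by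
    have hcont : ContinuousAt (fun θ : ℝ => Real.cos (θ - φ)) θ₀ := by fun_prop
    exact (hu.eventually hl').and ((hu.mono_right hl).eventually
      ((hcont.eventually (gt_mem_nhds hκ1)).mono fun _ h => le_of_lt h))
  obtain ⟨N, hN⟩ := eventually_atTop.1 hev
  rw [← tendsto_add_atTop_iff_nat N]
  have hu' : Tendsto (fun n => u (n + N)) atTop l := (tendsto_add_atTop_iff_nat N).2 hu
  obtain ⟨c, hc, hc'⟩ := exists_le_norm_polar_sub (φ := φ) hρ hκ2
  obtain ⟨C, hC, hGC⟩ := hG.2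
  have hmem : ∀ n, u (n + N) ∈ Set.Ioo θ₁ θ₂ := fun n => (hN _ (Nat.le_add_left _ _)).1
  refine tendsto_integral_mul_of_bounded_sq hC (fun n => hG.aestronglyMeasurable (hmem n))
    (fun n => hGC _ (hmem n)) (fun n => (measurable_kernel _ _).aestronglyMeasurable)
    (memLp_inv_one_add.const_mul c⁻¹) (fun n => ?_) (hg.mono fun r hr => hr.comp hu') ?_
  · filter_upwards [ae_restrict_mem measurableSet_Ioi] with r hr
    exact norm_kernel_le hc hr (hc' r _ (le_of_lt hr) (hN _ (Nat.le_add_left _ _)).2)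
  · filter_upwards [ae_restrict_mem measurableSet_Ioi] with r hr
    have hne : polar r θ₀ - polar ρ φ ≠ 0 := norm_pos_iff.1
      ((mul_pos hc (add_pos one_pos hr)).trans_le (hc' r θ₀ (le_of_lt hr) hκ1.le))
    have hcont : ContinuousAt (fun θ : ℝ => Complex.exp (Complex.I * θ) /
        (polar r θ - polar ρ φ)) θ₀ :=
      ContinuousAt.div (by fun_prop)
        ((continuous_polar_right r).continuousAt.sub continuousAt_const) hne
    exact hcont.tendsto.comp (hu'.mono_right hl)

/-- Cauchy's formula for the Hardy space of a sector, at a point of the sector. -/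
theorem HardySector.cauchy_formula {G : ℂ → ℂ} {θ₁ θ₂ ρ φ : ℝ} (hG : HardySector G θ₁ θ₂)
    (hπ : θ₂ - θ₁ < Real.pi) (hρ : 0 < ρ) (hφ : φ ∈ Set.Ioo θ₁ θ₂) {g₁ g₂ : ℝ → ℂ}
    (h₁ : ∀ᵐ r ∂(volume.restrict (Set.Ioi (0 : ℝ))),
      Tendsto (fun θ => G (polar r θ)) (𝓝[>] θ₁) (𝓝 (g₁ r)))
    (h₂ : ∀ᵐ r ∂(volume.restrict (Set.Ioi (0 : ℝ))),
      Tendsto (fun θ => G (polar r θ)) (𝓝[<] θ₂) (𝓝 (g₂ r))) :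
    cauchyRay θ₁ g₁ (polar ρ φ) - cauchyRay θ₂ g₂ (polar ρ φ) =
      2 * Real.pi * Complex.I * G (polar ρ φ) := by
  obtain ⟨hφ1, hφ2⟩ := hφ
  have hpi := Real.pi_pos
  obtain ⟨θa, ha1, ha2⟩ := exists_between hφ1
  obtain ⟨θb, hb1, hb2⟩ := exists_between hφ2
  have hlim1 := hG.tendsto_cauchyRay (φ := φ) nhdsWithin_le_nhds
    (Ioo_mem_nhdsGT (hφ1.trans hφ2)) hρ (cos_lt_one_of_neg (by linarith) (by linarith)) h₁
  have hlim2 := hG.tendsto_cauchyRay (φ := φ) nhdsWithin_le_nhds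
    (Ioo_mem_nhdsLT (hφ1.trans hφ2)) hρ (cos_lt_one (by linarith) (by linarith)) h₂
  -- On either side of `z` the Cauchy integral does not change with the angle, so its boundary limit
  -- is the value on an interior ray, and the jump formula for two interior rays applies. The
  -- opening below π keeps `-z` away.
  have hev1 : (fun θ => cauchyRay θ (fun r => G (polar r θ)) (polar ρ φ)) =ᶠ[𝓝[>] θ₁]
      fun _ => cauchyRay θa (fun r => G (polar r θa)) (polar ρ φ) := by
    filter_upwards [Ioo_mem_nhdsGT ha1] with θ hθ
    exact hG.cauchyRay_eq hθ.1 hθ.2.le (ha2.trans hφ2) hρ fun η hη =>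
      cos_lt_one_of_neg (by linarith [hη.2]) (by linarith [hη.1, hθ.1])
  have hev2 : (fun θ => cauchyRay θ (fun r => G (polar r θ)) (polar ρ φ)) =ᶠ[𝓝[<] θ₂]
      fun _ => cauchyRay θb (fun r => G (polar r θb)) (polar ρ φ) := by
    filter_upwards [Ioo_mem_nhdsLT hb2] with θ hθ
    exact (hG.cauchyRay_eq (hφ1.trans hb1) hθ.1.le hθ.2 hρ fun η hη =>
      cos_lt_one (by linarith [hη.1]) (by linarith [hη.2, hθ.2])).symm
  rw [tendsto_nhds_unique hlim1 (tendsto_const_nhds.congr' hev1.symm),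
    tendsto_nhds_unique hlim2 (tendsto_const_nhds.congr' hev2.symm)]
  exact hG.cauchyRay_sub ha1 ha2 hb1 hb2 hρ (by linarith) (by linarith)

/-- Cauchy's formula for the Hardy space of a sector, at a point outside the closed sector. -/
theorem HardySector.cauchy_formula_outside {G : ℂ → ℂ} {θ₁ θ₂ ρ φ : ℝ} (hG : HardySector G θ₁ θ₂)
    (h₁₂ : θ₁ < θ₂) (hρ : 0 < ρ) (hφ₁ : θ₂ < φ) (hφ₂ : φ < θ₁ + 2 * Real.pi) {g₁ g₂ : ℝ → ℂ}
    (h₁ : ∀ᵐ r ∂(volume.restrict (Set.Ioi (0 : ℝ))),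
      Tendsto (fun θ => G (polar r θ)) (𝓝[>] θ₁) (𝓝 (g₁ r)))
    (h₂ : ∀ᵐ r ∂(volume.restrict (Set.Ioi (0 : ℝ))),
      Tendsto (fun θ => G (polar r θ)) (𝓝[<] θ₂) (𝓝 (g₂ r))) :
    cauchyRay θ₁ g₁ (polar ρ φ) - cauchyRay θ₂ g₂ (polar ρ φ) = 0 := by
  have hlim1 := hG.tendsto_cauchyRay (φ := φ) nhdsWithin_le_nhds
    (Ioo_mem_nhdsGT h₁₂) hρ (cos_lt_one_of_neg (by linarith) (by linarith)) h₁
  have hlim2 := hG.tendsto_cauchyRay (φ := φ) nhdsWithin_le_nhds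
    (Ioo_mem_nhdsLT h₁₂) hρ (cos_lt_one_of_neg (by linarith) (by linarith)) h₂
  obtain ⟨θm, hm1, hm2⟩ := exists_between h₁₂
  have hcos : ∀ η, θ₁ ≤ η → η ≤ θ₂ → Real.cos (η - φ) < 1 := fun η h1 h2 =>
    cos_lt_one_of_neg (by linarith) (by linarith)
  have hev1 : (fun θ => cauchyRay θ (fun r => G (polar r θ)) (polar ρ φ)) =ᶠ[𝓝[>] θ₁]
      fun _ => cauchyRay θm (fun r => G (polar r θm)) (polar ρ φ) := by
    filter_upwards [Ioo_mem_nhdsGT hm1] with θ hθ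
    exact hG.cauchyRay_eq hθ.1 hθ.2.le hm2 hρ fun η hη =>
      hcos η (hθ.1.le.trans hη.1) (hη.2.trans hm2.le)
  have hev2 : (fun θ => cauchyRay θ (fun r => G (polar r θ)) (polar ρ φ)) =ᶠ[𝓝[<] θ₂]
      fun _ => cauchyRay θm (fun r => G (polar r θm)) (polar ρ φ) := by
    filter_upwards [Ioo_mem_nhdsLT hm2] with θ hθ
    exact (hG.cauchyRay_eq hm1 hθ.1.le hθ.2 hρ fun η hη =>
      hcos η (hm1.le.trans hη.1) (hη.2.trans hθ.2.le)).symm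
  rw [tendsto_nhds_unique hlim1 (tendsto_const_nhds.congr' hev1.symm),
    tendsto_nhds_unique hlim2 (tendsto_const_nhds.congr' hev2.symm), sub_self]

/-! ### Geometry of the contour -/

section Geometry

variable {α β γ : ℝ}

/-- Two openings occur because rays of different contours will be compared; their order does not
depend on the opening. -/
theorem rayAngle_lt_rayAngle (hβ₀ : 0 < β) (hβ : β < Real.pi / 2) (hγ₀ : 0 < γ)
    (hγ : γ < Real.pi / 2) {i j : Fin 6} (hij : i < j) : rayAngle β i < rayAngle γ j := by
  have hpi := Real.pi_pos
  fin_cases i <;> fin_cases j <;> simp [rayAngle] at hij ⊢ <;> linarith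

theorem rayAngle_nonneg (hα₀ : 0 < α) (hα : α < Real.pi / 2) (i : Fin 6) : 0 ≤ rayAngle α i := by
  have hpi := Real.pi_pos
  fin_cases i <;> simp [rayAngle] <;> linarith

theorem rayAngle_lt_two_pi (hα₀ : 0 < α) (hα : α < Real.pi / 2) (i : Fin 6) :
    rayAngle α i < 2 * Real.pi := by
  have hpi := Real.pi_pos
  fin_cases i <;> simp [rayAngle] <;> linarith

theorem rayAngle_lt_nextAngle (hα₀ : 0 < α) (hα : α < Real.pi / 2) (i : Fin 6) :
    rayAngle α i < nextAngle α i := by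
  have hpi := Real.pi_pos
  fin_cases i <;> simp [rayAngle, nextAngle] <;> linarith

theorem nextAngle_sub_rayAngle_lt (hα₀ : 0 < α) (hα : α < Real.pi / 2) (i : Fin 6) :
    nextAngle α i - rayAngle α i < Real.pi := by
  have hpi := Real.pi_pos
  fin_cases i <;> simp [rayAngle, nextAngle] <;> linarith

theorem nextAngle_le_rayAngle (hα₀ : 0 < α) (hα : α < Real.pi / 2) {i j : Fin 6} (hij : i < j) :
    nextAngle α i ≤ rayAngle α j := by
  have hpi := Real.pi_pos
  fin_cases i <;> fin_cases j <;> simp [rayAngle, nextAngle] at hij ⊢ <;> linarith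

theorem nextAngle_le_two_pi (hα₀ : 0 < α) (hα : α < Real.pi / 2) (i : Fin 6) :
    nextAngle α i ≤ 2 * Real.pi := by
  have hpi := Real.pi_pos
  fin_cases i <;> simp [nextAngle] <;> linarith

theorem polar_injective {r s θ η : ℝ} (hr : 0 < r) (hs : 0 ≤ s) (h : polar r θ = polar s η)
    (hθη : |θ - η| < 2 * Real.pi) : r = s ∧ θ = η := by
  have hrs : r = s := by rw [← norm_polar hr.le θ, h, norm_polar hs]
  refine ⟨hrs, ?_⟩
  subst hrs
  have hr' : (r : ℂ) ≠ 0 := by exact_mod_cast hr.ne'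
  obtain ⟨n, hn⟩ := Complex.exp_eq_exp_iff_exists_int.1 (mul_left_cancel₀ hr' h)
  have h1 : θ = η + n * (2 * Real.pi) := by
    have h2 : (θ : ℂ) = ((η + n * (2 * Real.pi) : ℝ) : ℂ) := by
      push_cast
      refine mul_left_cancel₀ Complex.I_ne_zero ?_
      rw [hn]; ring
    exact_mod_cast h2
  have h3 : |(n : ℝ)| < 1 := by
    have : θ - η = n * (2 * Real.pi) := by linarith
    rw [this, abs_mul, abs_of_pos Real.two_pi_pos] at hθη
    exact (mul_lt_iff_lt_one_left Real.two_pi_pos).1 hθη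
  have h4 : n = 0 := by
    have : |n| < 1 := by exact_mod_cast h3
    exact Int.abs_lt_one_iff.1 this
  rw [h1, h4]; simp

theorem exists_eq_polar {z : ℂ} (hz : z ≠ 0) :
    ∃ r θ : ℝ, 0 < r ∧ 0 ≤ θ ∧ θ < 2 * Real.pi ∧ z = polar r θ := by
  have h : z = polar ‖z‖ z.arg := by
    rw [polar, mul_comm Complex.I, Complex.norm_mul_exp_arg_mul_I]
  have hpi := Real.pi_pos
  rcases le_or_gt 0 z.arg with h0 | h0
  · exact ⟨‖z‖, z.arg, norm_pos_iff.2 hz, h0, by linarith [Complex.arg_le_pi z], h⟩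
  · exact ⟨‖z‖, z.arg + 2 * Real.pi, norm_pos_iff.2 hz, by linarith [Complex.neg_pi_lt_arg z],
      by linarith, by rw [polar_add_two_pi]; exact h⟩

theorem polar_ray_mem_contour (i : Fin 6) {r : ℝ} (hr : 0 ≤ r) :
    polar r (rayAngle α i) ∈ contour α := ⟨i, r, hr, rfl⟩

theorem zero_mem_contour : (0 : ℂ) ∈ contour α := ⟨0, 0, le_rfl, by simp [polar]⟩

theorem polar_notMem_contour (hα₀ : 0 < α) (hα : α < Real.pi / 2) {r θ : ℝ} (hr : 0 < r)
    (hθ₀ : 0 ≤ θ) (hθ : θ < 2 * Real.pi) (h : ∀ i, θ ≠ rayAngle α i) :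
    polar r θ ∉ contour α := by
  rintro ⟨i, s, hs, hz⟩
  refine h i (polar_injective hr hs hz (abs_lt.2 ⟨?_, ?_⟩)).2
  · linarith [rayAngle_lt_two_pi hα₀ hα i]
  · linarith [rayAngle_nonneg hα₀ hα i]

theorem isClosed_ray (θ : ℝ) : IsClosed {z : ℂ | ∃ r : ℝ, 0 ≤ r ∧ z = polar r θ} := by
  have : {z : ℂ | ∃ r : ℝ, 0 ≤ r ∧ z = polar r θ} = {z : ℂ | z = polar ‖z‖ θ} := by
    ext z
    constructor
    · rintro ⟨r, hr, rfl⟩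
      change polar r θ = polar ‖polar r θ‖ θ
      rw [norm_polar hr]
    · intro h
      exact ⟨‖z‖, norm_nonneg _, h⟩
  rw [this]
  exact isClosed_eq continuous_id ((continuous_polar_left θ).comp continuous_norm)

theorem isClosed_contour : IsClosed (contour α) := by
  have : contour α = ⋃ i : Fin 6, {z : ℂ | ∃ r : ℝ, 0 ≤ r ∧ z = polar r (rayAngle α i)} := by
    ext z; simp [contour]
  rw [this]
  exact isClosed_iUnion_of_finite fun i => isClosed_ray _

theorem ne_rayAngle_of_mem_Ioo (hα₀ : 0 < α) (hα : α < Real.pi / 2) {i : Fin 6} {θ : ℝ}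
    (h : θ ∈ Set.Ioo (rayAngle α i) (nextAngle α i)) (j : Fin 6) : θ ≠ rayAngle α j := by
  rcases lt_trichotomy i j with hij | rfl | hij
  · exact (h.2.trans_le (nextAngle_le_rayAngle hα₀ hα hij)).ne
  · exact h.1.ne'
  · exact ((rayAngle_lt_rayAngle hα₀ hα hα₀ hα hij).trans h.1).ne'

theorem notMem_contour_of_mem_Ioo (hα₀ : 0 < α) (hα : α < Real.pi / 2) {i : Fin 6} {r θ : ℝ}
    (hr : 0 < r) (h : θ ∈ Set.Ioo (rayAngle α i) (nextAngle α i)) : polar r θ ∉ contour α :=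
  polar_notMem_contour hα₀ hα hr ((rayAngle_nonneg hα₀ hα i).trans h.1.le)
    (h.2.trans_le (nextAngle_le_two_pi hα₀ hα i)) (ne_rayAngle_of_mem_Ioo hα₀ hα h)

theorem exists_Ioo_of_ne {θ : ℝ} (hθ₀ : 0 ≤ θ)
    (hθ : θ < 2 * Real.pi) (h : ∀ i, θ ≠ rayAngle α i) :
    ∃ i, θ ∈ Set.Ioo (rayAngle α i) (nextAngle α i) := by
  by_contra! hcon
  have h0 := h 0; have h1 := h 1; have h2 := h 2; have h3 := h 3; have h4 := h 4; have h5 := h 5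
  have c0 := hcon 0; have c1 := hcon 1; have c2 := hcon 2; have c3 := hcon 3
  have c4 := hcon 4; have c5 := hcon 5
  simp only [rayAngle, nextAngle, Set.mem_Ioo, not_and, not_lt, Matrix.cons_val] at *
  have e0 := lt_of_le_of_ne hθ₀ (Ne.symm h0)
  have e1 := lt_of_le_of_ne (c0 e0) (Ne.symm h1)
  have e2 := lt_of_le_of_ne (c1 e1) (Ne.symm h2)
  have e3 := lt_of_le_of_ne (c2 e2) (Ne.symm h3)
  have e4 := lt_of_le_of_ne (c3 e3) (Ne.symm h4)
  have e5 := lt_of_le_of_ne (c4 e4) (Ne.symm h5)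
  exact absurd hθ (not_lt.2 (c5 e5))

theorem exists_sector {z : ℂ} (hz : z ∉ contour α) :
    ∃ (i : Fin 6) (r θ : ℝ), 0 < r ∧ θ ∈ Set.Ioo (rayAngle α i) (nextAngle α i) ∧
      z = polar r θ := by
  have hz0 : z ≠ 0 := fun h => hz (h ▸ zero_mem_contour)
  obtain ⟨r, θ, hr, hθ₀, hθ, rfl⟩ := exists_eq_polar hz0
  obtain ⟨i, hi⟩ := exists_Ioo_of_ne hθ₀ hθ fun i h =>
    hz (h ▸ polar_ray_mem_contour i hr.le)
  exact ⟨i, r, θ, hr, hi, rfl⟩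

theorem sector_eq_of_mem (hα₀ : 0 < α) (hα : α < Real.pi / 2) {i j : Fin 6} {z : ℂ}
    (hi : z ∈ sector α i) (hj : z ∈ sector α j) : i = j := by
  obtain ⟨r, θ, hr, h1, h2, rfl⟩ := hi
  obtain ⟨s, η, hs, h3, h4, h⟩ := hj
  have hθη := (polar_injective hr hs.le h (abs_lt.2
    ⟨by linarith [rayAngle_nonneg hα₀ hα i, nextAngle_le_two_pi hα₀ hα j],
      by linarith [rayAngle_nonneg hα₀ hα j, nextAngle_le_two_pi hα₀ hα i]⟩)).2
  subst hθη
  rcases lt_trichotomy i j with hij | hij | hij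
  · linarith [nextAngle_le_rayAngle hα₀ hα hij]
  · exact hij
  · linarith [nextAngle_le_rayAngle hα₀ hα hij]

theorem sector_subset_compl (hα₀ : 0 < α) (hα : α < Real.pi / 2) (i : Fin 6) :
    sector α i ⊆ (contour α)ᶜ := by
  rintro z ⟨r, θ, hr, h1, h2, rfl⟩
  exact notMem_contour_of_mem_Ioo hα₀ hα hr ⟨h1, h2⟩

/-- The side of `Γ` that follows `Γᵢ` counter-clockwise. -/
def leftOf (α : ℝ) : Fin 6 → Set ℂ :=
  ![plusSide α, minusSide α, plusSide α, minusSide α, plusSide α, minusSide α]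

/-- The side of `Γ` that precedes `Γᵢ` counter-clockwise. -/
def rightOf (α : ℝ) : Fin 6 → Set ℂ :=
  ![minusSide α, plusSide α, minusSide α, plusSide α, minusSide α, plusSide α]

theorem disjoint_sides (hα₀ : 0 < α) (hα : α < Real.pi / 2) :
    Disjoint (plusSide α) (minusSide α) := by
  refine Set.disjoint_left.2 fun z hp hm => ?_
  rcases hp with (hp | hp) | hp <;> rcases hm with (hm | hm) | hm <;>
    exact absurd (sector_eq_of_mem hα₀ hα hp hm) (by decide)

theorem disjoint_leftOf_rightOf (hα₀ : 0 < α) (hα : α < Real.pi / 2) (i : Fin 6) :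
    Disjoint (leftOf α i) (rightOf α i) := by
  have h := disjoint_sides hα₀ hα
  fin_cases i
  exacts [h, h.symm, h, h.symm, h, h.symm]

theorem plusSide_subset_compl (hα₀ : 0 < α) (hα : α < Real.pi / 2) :
    plusSide α ⊆ (contour α)ᶜ := by
  rintro z ((h | h) | h) <;> exact sector_subset_compl hα₀ hα _ h

theorem minusSide_subset_compl (hα₀ : 0 < α) (hα : α < Real.pi / 2) :
    minusSide α ⊆ (contour α)ᶜ := by
  rintro z ((h | h) | h) <;> exact sector_subset_compl hα₀ hα _ h

theorem leftOf_subset_compl (hα₀ : 0 < α) (hα : α < Real.pi / 2) (i : Fin 6) :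
    leftOf α i ⊆ (contour α)ᶜ := by
  have hp := plusSide_subset_compl hα₀ hα
  have hm := minusSide_subset_compl hα₀ hα
  fin_cases i
  exacts [hp, hm, hp, hm, hp, hm]

theorem rightOf_subset_compl (hα₀ : 0 < α) (hα : α < Real.pi / 2) (i : Fin 6) :
    rightOf α i ⊆ (contour α)ᶜ := by
  have hp := plusSide_subset_compl hα₀ hα
  have hm := minusSide_subset_compl hα₀ hα
  fin_cases i
  exacts [hm, hp, hm, hp, hm, hp]

theorem polar_mem_leftOf {i : Fin 6} {r θ : ℝ} (hr : 0 < r)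
    (h : θ ∈ Set.Ioo (rayAngle α i) (nextAngle α i)) : polar r θ ∈ leftOf α i := by
  have hs : polar r θ ∈ sector α i := ⟨r, θ, hr, h.1, h.2, rfl⟩
  fin_cases i
  exacts [Or.inl (.inl hs), Or.inl (.inl hs), Or.inl (.inr hs), Or.inl (.inr hs), Or.inr hs,
    Or.inr hs]

/-- Half of the smallest opening of a sector of the contour. -/
theorem exists_gap (hα₀ : 0 < α) (hα : α < Real.pi / 2) : ∃ ε : ℝ, 0 < ε ∧ ∀ i : Fin 6,
    rayAngle α i + ε ≤ nextAngle α i ∧ ∀ r θ : ℝ, 0 < r → rayAngle α i - ε < θ →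
      θ < rayAngle α i → polar r θ ∈ rightOf α i := by
  have hpi := Real.pi_pos
  set ε := min α (Real.pi - 2 * α) with hε
  have h1 : ε ≤ α := min_le_left _ _
  have h2 : ε ≤ Real.pi - 2 * α := min_le_right _ _
  have key : ∀ (i : Fin 6) (r θ : ℝ), 0 < r → rayAngle α i < θ → θ < nextAngle α i →
    polar r θ ∈ sector α i := fun i r θ hr h1 h2 => ⟨r, θ, hr, h1, h2, rfl⟩
  refine ⟨ε, lt_min hα₀ (by linarith), fun i => ⟨?_, fun r θ hr h3 h4 => ?_⟩⟩
  · fin_cases i <;> simp [rayAngle, nextAngle] <;> linarith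
  -- Angles just below 0 belong to the last sector, which is parametrized by angles just below 2π.
  · rcases eq_or_ne i 0 with rfl | hi
    · rw [← polar_add_two_pi]
      refine Or.inr (key 5 r _ hr ?_ ?_) <;> simp [rayAngle, nextAngle] at h3 h4 ⊢ <;> linarith
    · have h5 : polar r θ ∈ sector α (i - 1) := by
        refine key _ r θ hr ?_ ?_ <;> fin_cases i <;>
          simp [rayAngle, nextAngle] at hi h3 h4 ⊢ <;> linarith
      fin_cases i
      exacts [absurd rfl hi, Or.inl (.inl h5), Or.inl (.inl h5), Or.inl (.inr h5),
        Or.inl (.inr h5), Or.inr h5]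

/-! ### Angular limits -/

theorem mul_abs_sin_le_norm_sub {r s θ η : ℝ} :
    r * |Real.sin (θ - η)| ≤ ‖polar r θ - polar s η‖ := by
  refine le_of_sq_le_sq ?_ (norm_nonneg _)
  rw [normSq_polar_sub_polar, mul_pow, sq_abs, Real.sin_sq]
  nlinarith [sq_nonneg (s - r * Real.cos (θ - η))]

theorem norm_polar_sub_polar_le {r θ η : ℝ} (hr : 0 ≤ r) :
    ‖polar r θ - polar r η‖ ≤ r * |θ - η| := by
  refine le_of_sq_le_sq ?_ (by positivity)
  rw [normSq_polar_sub_polar, mul_pow, sq_abs]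
  nlinarith [Real.one_sub_sq_div_two_le_cos (x := θ - η), sq_nonneg r]

/-- If `θ₀` and `η` are directions of the same line, then |sin x| ≥ (2/π)|x| applies, and 2/π ≥ 1/2
because π ≤ 4. Otherwise the sine stays away from zero while the left side is small. -/
theorem eventually_half_le_abs_sin (θ₀ η : ℝ) :
    ∀ᶠ θ in 𝓝 θ₀, 1 / 2 * |θ - θ₀| ≤ |Real.sin (θ - η)| := by
  have hlim : Tendsto (fun θ : ℝ => |θ - θ₀|) (𝓝 θ₀) (𝓝 0) := by
    have : Continuous fun θ : ℝ => |θ - θ₀| := by fun_prop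
    simpa using this.tendsto θ₀
  by_cases h : Real.sin (θ₀ - η) = 0
  · filter_upwards [hlim.eventually (gt_mem_nhds (by positivity : 0 < Real.pi / 2))] with θ hθ
    have h1 : |Real.sin (θ - η)| = |Real.sin (θ - θ₀)| := by
      have h2 : |Real.cos (θ₀ - η)| = 1 := by
        rw [← abs_one, ← sq_eq_sq_iff_abs_eq_abs]
        linarith [Real.sin_sq_add_cos_sq (θ₀ - η), (by rw [h]; ring : Real.sin (θ₀ - η) ^ 2 = 0)]
      have h3 : θ - η = (θ - θ₀) + (θ₀ - η) := by ring
      rw [h3, Real.sin_add, h, mul_zero, add_zero, abs_mul, h2, mul_one]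
    rw [h1]
    refine le_trans ?_ (Real.mul_abs_le_abs_sin hθ.le)
    refine mul_le_mul_of_nonneg_right ?_ (abs_nonneg _)
    rw [div_le_div_iff₀ two_pos Real.pi_pos]
    linarith [Real.pi_le_four]
  · have hcont : Tendsto (fun θ : ℝ => |Real.sin (θ - η)| - 1 / 2 * |θ - θ₀|) (𝓝 θ₀)
        (𝓝 (|Real.sin (θ₀ - η)| - 1 / 2 * 0)) := by
      refine Tendsto.sub ?_ (hlim.const_mul _)
      have : Continuous fun θ : ℝ => |Real.sin (θ - η)| := by fun_prop
      exact this.tendsto θ₀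
    filter_upwards [hcont.eventually (lt_mem_nhds (a := 0) (by simpa using h))] with θ hθ
    linarith

/-- Circular arcs about the vertex meet the rays at right angles, so they are nontangential paths.
This reduces nontangential limits to limits in the angle at fixed radius, the form used by the
Cauchy formulas. -/
theorem eventually_le_infDist {i : Fin 6} {r : ℝ} (hr : 0 < r) :
    ∀ᶠ θ in 𝓝 (rayAngle α i), 1 / 2 * ‖polar r θ - polar r (rayAngle α i)‖ ≤
      Metric.infDist (polar r θ) (contour α) := by
  have h : ∀ᶠ θ in 𝓝 (rayAngle α i), ∀ j, 1 / 2 * |θ - rayAngle α i| ≤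
      |Real.sin (θ - rayAngle α j)| :=
    eventually_all.2 fun j => eventually_half_le_abs_sin _ _
  filter_upwards [h] with θ hθ
  refine (Metric.le_infDist ⟨0, zero_mem_contour⟩).2 ?_
  rintro w ⟨j, s, hs, rfl⟩
  rw [dist_eq_norm]
  calc 1 / 2 * ‖polar r θ - polar r (rayAngle α i)‖
      ≤ 1 / 2 * (r * |θ - rayAngle α i|) := by gcongr; exact norm_polar_sub_polar_le hr.le
    _ = r * (1 / 2 * |θ - rayAngle α i|) := by ring
    _ ≤ r * |Real.sin (θ - rayAngle α j)| := by gcongr; exact hθ j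
    _ ≤ _ := mul_abs_sin_le_norm_sub

theorem HasNontangentialLimit.tendsto_angle {R : Set ℂ} {F : ℂ → Matrix (Fin 2) (Fin 2) ℂ}
    {i : Fin 6} {r : ℝ} {L : Matrix (Fin 2) (Fin 2) ℂ} (hr : 0 < r)
    (h : HasNontangentialLimit α R F (polar r (rayAngle α i)) L) {l : Filter ℝ}
    (hl : l ≤ 𝓝 (rayAngle α i)) (hR : ∀ᶠ θ in l, polar r θ ∈ R) :
    Tendsto (fun θ => F (polar r θ)) l (𝓝 L) := by
  refine (h (1 / 2) (by norm_num)).comp (tendsto_nhdsWithin_iff.2 ⟨?_, ?_⟩)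
  · exact ((continuous_polar_right r).tendsto _).mono_left hl
  · filter_upwards [hR, hl (eventually_le_infDist hr)] with θ h1 h2
    exact ⟨h1, h2⟩

theorem HasNontangentialLimit.tendsto_left (hα₀ : 0 < α) (hα : α < Real.pi / 2)
    {F : ℂ → Matrix (Fin 2) (Fin 2) ℂ} {i : Fin 6} {r : ℝ} {L : Matrix (Fin 2) (Fin 2) ℂ}
    (hr : 0 < r) (h : HasNontangentialLimit α (leftOf α i) F (polar r (rayAngle α i)) L) :
    Tendsto (fun θ => F (polar r θ)) (𝓝[>] (rayAngle α i)) (𝓝 L) :=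
  h.tendsto_angle hr nhdsWithin_le_nhds
    (by filter_upwards [Ioo_mem_nhdsGT (rayAngle_lt_nextAngle hα₀ hα i)] with θ hθ
        exact polar_mem_leftOf hr hθ)

theorem HasNontangentialLimit.tendsto_right (hα₀ : 0 < α) (hα : α < Real.pi / 2)
    {F : ℂ → Matrix (Fin 2) (Fin 2) ℂ} {i : Fin 6} {r : ℝ} {L : Matrix (Fin 2) (Fin 2) ℂ}
    (hr : 0 < r) (h : HasNontangentialLimit α (rightOf α i) F (polar r (rayAngle α i)) L) :
    Tendsto (fun θ => F (polar r θ)) (𝓝[<] (rayAngle α i)) (𝓝 L) := by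
  obtain ⟨ε, hε, hgap⟩ := exists_gap hα₀ hα
  refine h.tendsto_angle hr nhdsWithin_le_nhds ?_
  filter_upwards [Ioo_mem_nhdsLT (sub_lt_self (rayAngle α i) hε)] with θ hθ
  exact (hgap i).2 r θ hr hθ.1 hθ.2

end Geometry

/-! ### Operations on Hardy functions of a sector -/

theorem enorm_add_sq_le (x y : ℂ) : ‖x + y‖ₑ ^ 2 ≤ 2 * ‖x‖ₑ ^ 2 + 2 * ‖y‖ₑ ^ 2 := by
  have h : ‖x + y‖ ^ 2 ≤ 2 * ‖x‖ ^ 2 + 2 * ‖y‖ ^ 2 := by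
    nlinarith [norm_add_le x y, sq_nonneg (‖x‖ - ‖y‖), norm_nonneg (x + y), norm_nonneg x,
      norm_nonneg y]
  have h2 : (2 : ℝ≥0∞) = ENNReal.ofReal 2 := by simp
  rw [← ofReal_norm, ← ofReal_norm, ← ofReal_norm, ← ENNReal.ofReal_pow (norm_nonneg _),
    ← ENNReal.ofReal_pow (norm_nonneg _), ← ENNReal.ofReal_pow (norm_nonneg _), h2,
    ← ENNReal.ofReal_mul (by norm_num), ← ENNReal.ofReal_mul (by norm_num),
    ← ENNReal.ofReal_add (by positivity) (by positivity)]
  exact ENNReal.ofReal_le_ofReal h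

theorem HardySector.add {F G : ℂ → ℂ} {θ₁ θ₂ : ℝ} (hF : HardySector F θ₁ θ₂)
    (hG : HardySector G θ₁ θ₂) : HardySector (fun z => F z + G z) θ₁ θ₂ := by
  refine ⟨fun r hr θ hθ => (hF.1 r hr θ hθ).add (hG.1 r hr θ hθ), ?_⟩
  obtain ⟨C, hC, h⟩ := hF.2
  obtain ⟨D, hD, h'⟩ := hG.2
  refine ⟨2 * C + 2 * D, by finiteness, fun θ hθ => ?_⟩
  calc ∫⁻ r in Set.Ioi (0 : ℝ), ‖F (polar r θ) + G (polar r θ)‖ₑ ^ 2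
      ≤ ∫⁻ r in Set.Ioi (0 : ℝ), (2 * ‖F (polar r θ)‖ₑ ^ 2 + 2 * ‖G (polar r θ)‖ₑ ^ 2) :=
        lintegral_mono fun r => enorm_add_sq_le _ _
    _ = 2 * (∫⁻ r in Set.Ioi (0 : ℝ), ‖F (polar r θ)‖ₑ ^ 2) +
          2 * ∫⁻ r in Set.Ioi (0 : ℝ), ‖G (polar r θ)‖ₑ ^ 2 := by
        rw [lintegral_add_left' (((hF.aestronglyMeasurable hθ).enorm.pow_const 2).const_mul 2),
          lintegral_const_mul' _ _ (by finiteness), lintegral_const_mul' _ _ (by finiteness)]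
    _ ≤ _ := by gcongr; exacts [h θ hθ, h' θ hθ]

theorem HardySector.mul_bounded {F w : ℂ → ℂ} {θ₁ θ₂ A : ℝ} (hF : HardySector F θ₁ θ₂)
    (hw : ∀ r : ℝ, 0 < r → ∀ θ ∈ Set.Ioo θ₁ θ₂, DifferentiableAt ℂ w (polar r θ))
    (hA : ∀ r : ℝ, 0 < r → ∀ θ ∈ Set.Ioo θ₁ θ₂, ‖w (polar r θ)‖ ≤ A) :
    HardySector (fun z => F z * w z) θ₁ θ₂ := by
  refine ⟨fun r hr θ hθ => (hF.1 r hr θ hθ).mul (hw r hr θ hθ), ?_⟩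
  obtain ⟨C, hC, h⟩ := hF.2
  refine ⟨C * ENNReal.ofReal A ^ 2, by finiteness, fun θ hθ => ?_⟩
  calc ∫⁻ r in Set.Ioi (0 : ℝ), ‖F (polar r θ) * w (polar r θ)‖ₑ ^ 2
      ≤ ∫⁻ r in Set.Ioi (0 : ℝ), ‖F (polar r θ)‖ₑ ^ 2 * ENNReal.ofReal A ^ 2 := by
        refine lintegral_mono_ae ?_
        filter_upwards [ae_restrict_mem measurableSet_Ioi] with r hr
        rw [enorm_mul, mul_pow]
        gcongr
        rw [← ofReal_norm]
        exact ENNReal.ofReal_le_ofReal (hA r hr θ hθ)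
    _ = (∫⁻ r in Set.Ioi (0 : ℝ), ‖F (polar r θ)‖ₑ ^ 2) * ENNReal.ofReal A ^ 2 :=
        lintegral_mul_const' _ _ (by finiteness)
    _ ≤ _ := by gcongr; exact h θ hθ

theorem integrableOn_exp_neg_mul {c : ℝ} (hc : 0 < c) :
    IntegrableOn (fun r : ℝ => Real.exp (-(c * r))) (Set.Ioi 0) := by
  simpa [neg_mul] using integrableOn_exp_mul_Ioi (neg_neg_of_pos hc) 0

theorem lintegral_sq_le_of_exp {f : ℝ → ℂ} {A c : ℝ} (hc : 0 < c)
    (h : ∀ r : ℝ, 0 < r → ‖f r‖ ≤ A * Real.exp (-(c * r))) :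
    ∫⁻ r in Set.Ioi (0 : ℝ), ‖f r‖ₑ ^ 2 ≤
      ∫⁻ r in Set.Ioi (0 : ℝ), ENNReal.ofReal (A ^ 2 * Real.exp (-(c * r))) := by
  refine lintegral_mono_ae ?_
  filter_upwards [ae_restrict_mem measurableSet_Ioi] with r hr
  have hr' : 0 < r := hr
  rw [← ofReal_norm, ← ENNReal.ofReal_pow (norm_nonneg _)]
  refine ENNReal.ofReal_le_ofReal ?_
  have h1 := pow_le_pow_left₀ (norm_nonneg _) (h r hr) 2
  refine h1.trans ?_
  rw [mul_pow, sq (Real.exp _)]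
  have h2 : Real.exp (-(c * r)) ≤ 1 := Real.exp_le_one_iff.2 (by nlinarith)
  exact mul_le_mul_of_nonneg_left (mul_le_of_le_one_left (Real.exp_pos _).le h2) (sq_nonneg A)

theorem lintegral_exp_ne_top {A c : ℝ} (hc : 0 < c) :
    ∫⁻ r in Set.Ioi (0 : ℝ), ENNReal.ofReal (A ^ 2 * Real.exp (-(c * r))) ≠ ∞ :=
  ((integrableOn_exp_neg_mul hc).const_mul (A ^ 2)).lintegral_lt_top.ne

theorem HardySector.of_exp {w : ℂ → ℂ} {θ₁ θ₂ A c : ℝ} (hc : 0 < c)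
    (hw : ∀ r : ℝ, 0 < r → ∀ θ ∈ Set.Ioo θ₁ θ₂, DifferentiableAt ℂ w (polar r θ))
    (hA : ∀ r : ℝ, 0 < r → ∀ θ ∈ Set.Ioo θ₁ θ₂, ‖w (polar r θ)‖ ≤ A * Real.exp (-(c * r))) :
    HardySector w θ₁ θ₂ :=
  ⟨hw, _, lintegral_exp_ne_top hc, fun θ hθ => lintegral_sq_le_of_exp hc
    fun r hr => hA r hr θ hθ⟩

/-- Boundary values of Hardy functions are square integrable. -/
theorem HardySector.memLp_of_tendsto {G : ℂ → ℂ} {θ₁ θ₂ : ℝ} (hG : HardySector G θ₁ θ₂)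
    {l : Filter ℝ} [l.IsCountablyGenerated] [l.NeBot] (hl : ∀ᶠ θ in l, θ ∈ Set.Ioo θ₁ θ₂)
    {g : ℝ → ℂ} (hg : ∀ᵐ r ∂(volume.restrict (Set.Ioi (0 : ℝ))),
      Tendsto (fun θ => G (polar r θ)) l (𝓝 (g r))) :
    MemLp g 2 (volume.restrict (Set.Ioi 0)) := by
  obtain ⟨u, hu⟩ := exists_seq_tendsto l
  obtain ⟨N, hN⟩ := eventually_atTop.1 (hu.eventually hl)
  have hu' : Tendsto (fun n => u (n + N)) atTop l := (tendsto_add_atTop_iff_nat N).2 hu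
  have hmem : ∀ n, u (n + N) ∈ Set.Ioo θ₁ θ₂ := fun n => hN _ (Nat.le_add_left _ _)
  obtain ⟨C, hC, hGC⟩ := hG.2
  have hlim : ∀ᵐ r ∂(volume.restrict (Set.Ioi (0 : ℝ))),
      Tendsto (fun n => G (polar r (u (n + N)))) atTop (𝓝 (g r)) :=
    hg.mono fun r hr => hr.comp hu'
  have hm := fun n => hG.aestronglyMeasurable (hmem n)
  exact memLp_two_of_lintegral_le hC (aestronglyMeasurable_of_tendsto_ae atTop hm hlim)
    (lintegral_sq_le_of_tendsto hm (.of_forall fun n => hGC _ (hmem n)) hlim)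

theorem MemHardyTwo.hardySector {α : ℝ} (hα₀ : 0 < α) (hα : α < Real.pi / 2) {F : ℂ → ℂ}
    (hF : MemHardyTwo α F) (i : Fin 6) :
    HardySector F (rayAngle α i) (nextAngle α i) := by
  obtain ⟨C, hC⟩ := hF.2 i
  exact ⟨fun r hr θ hθ => hF.1.differentiableAt
      (isClosed_contour.isOpen_compl.mem_nhds (notMem_contour_of_mem_Ioo hα₀ hα hr hθ)),
    C, ENNReal.coe_ne_top, fun θ hθ => hC θ hθ.1 hθ.2⟩

/-! ### The Cauchy representation -/

theorem cauchyRay_add_two_pi (θ : ℝ) (g : ℝ → ℂ) (z : ℂ) :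
    cauchyRay (θ + 2 * Real.pi) g z = cauchyRay θ g z := by
  have h : Complex.exp (Complex.I * (θ + 2 * Real.pi : ℝ)) = Complex.exp (Complex.I * θ) := by
    have := polar_add_two_pi 1 θ
    simpa [polar] using this
  simp only [cauchyRay, polar_add_two_pi, h]

/-- The last sector ends at 2π while `Γ₀` has angle 0: indices wrap around in `Fin 6`, and the
discrepancy is a full turn. -/
theorem nextAngle_eq (α : ℝ) (i : Fin 6) : nextAngle α i = rayAngle α (i + 1) ∨
    nextAngle α i = rayAngle α (i + 1) + 2 * Real.pi := by
  fin_cases i <;> simp [nextAngle, rayAngle]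

theorem cauchyRay_nextAngle (α : ℝ) (i : Fin 6) (g : ℝ → ℂ) (z : ℂ) :
    cauchyRay (nextAngle α i) g z = cauchyRay (rayAngle α (i + 1)) g z := by
  rcases nextAngle_eq α i with h | h
  · rw [h]
  · rw [h, cauchyRay_add_two_pi]

theorem tendsto_nextAngle {X : Type*} {α : ℝ} {i : Fin 6} {F : ℂ → X} {r : ℝ} {l : Filter X}
    (h : Tendsto (fun θ => F (polar r θ)) (𝓝[<] (rayAngle α (i + 1))) l) :
    Tendsto (fun θ => F (polar r θ)) (𝓝[<] (nextAngle α i)) l := by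
  rcases nextAngle_eq α i with h' | h'
  · rwa [h']
  · have h1 : Tendsto (fun θ : ℝ => θ - 2 * Real.pi) (𝓝[<] (nextAngle α i))
        (𝓝[<] (rayAngle α (i + 1))) := by
      refine tendsto_nhdsWithin_iff.2 ⟨?_, ?_⟩
      · have : Continuous fun θ : ℝ => θ - 2 * Real.pi := by fun_prop
        have h2 := this.tendsto (nextAngle α i)
        rw [h', add_sub_cancel_right] at h2
        rw [h']
        exact h2.mono_left nhdsWithin_le_nhds
      · filter_upwards [self_mem_nhdsWithin] with θ hθ
        have : θ < nextAngle α i := hθ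
        exact Set.mem_Iio.2 (by linarith)
    refine (h.comp h1).congr fun θ => ?_
    simp only [Function.comp]
    rw [← polar_add_two_pi, sub_add_cancel]

theorem cos_sub_lt_one_of_ne {θ φ : ℝ} (hθ₀ : 0 ≤ θ) (hθ : θ < 2 * Real.pi) (hφ₀ : 0 ≤ φ)
    (hφ : φ < 2 * Real.pi) (h : φ ≠ θ) : Real.cos (θ - φ) < 1 := by
  rcases lt_or_gt_of_ne h with h | h
  · exact cos_lt_one (by linarith) (by linarith)
  · exact cos_lt_one_of_neg (by linarith) (by linarith)

theorem cauchyRay_sub' {f g : ℝ → ℂ} {ρ φ θ : ℝ} (hf : MemLp f 2 (volume.restrict (Set.Ioi 0)))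
    (hg : MemLp g 2 (volume.restrict (Set.Ioi 0))) (hρ : 0 < ρ) (hcos : Real.cos (θ - φ) < 1) :
    cauchyRay θ (fun r => f r - g r) (polar ρ φ) =
      cauchyRay θ f (polar ρ φ) - cauchyRay θ g (polar ρ φ) := by
  simp only [cauchyRay, sub_mul]
  exact integral_sub (integrable_mul_kernel hf hρ hcos) (integrable_mul_kernel hg hρ hcos)

/-- The Cauchy representation of a function in the Hardy space of the six sectors by the jump of
its boundary values. -/
theorem MemHardyTwo.sum_cauchyRay {α : ℝ} (hα₀ : 0 < α) (hα : α < Real.pi / 2) {F : ℂ → ℂ}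
    (hF : MemHardyTwo α F) {A B : Fin 6 → ℝ → ℂ}
    (hA : ∀ i, ∀ᵐ r ∂(volume.restrict (Set.Ioi (0 : ℝ))),
      Tendsto (fun θ => F (polar r θ)) (𝓝[>] (rayAngle α i)) (𝓝 (A i r)))
    (hB : ∀ i, ∀ᵐ r ∂(volume.restrict (Set.Ioi (0 : ℝ))),
      Tendsto (fun θ => F (polar r θ)) (𝓝[<] (rayAngle α i)) (𝓝 (B i r)))
    {z : ℂ} (hz : z ∉ contour α) :
    ∑ i, cauchyRay (rayAngle α i) (fun r => A i r - B i r) z =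
      2 * Real.pi * Complex.I * F z := by
  obtain ⟨j, ρ, φ, hρ, hφ, rfl⟩ := exists_sector hz
  have hH := hF.hardySector hα₀ hα
  have hB' : ∀ i, ∀ᵐ r ∂(volume.restrict (Set.Ioi (0 : ℝ))),
      Tendsto (fun θ => F (polar r θ)) (𝓝[<] (nextAngle α i)) (𝓝 (B (i + 1) r)) :=
    fun i => (hB (i + 1)).mono fun r hr => tendsto_nextAngle hr
  have hA2 : ∀ i, MemLp (A i) 2 (volume.restrict (Set.Ioi 0)) := fun i =>
    (hH i).memLp_of_tendsto (Ioo_mem_nhdsGT (rayAngle_lt_nextAngle hα₀ hα i)) (hA i)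
  have hB2' : ∀ i, MemLp (B (i + 1)) 2 (volume.restrict (Set.Ioi 0)) := fun i =>
    (hH i).memLp_of_tendsto (Ioo_mem_nhdsLT (rayAngle_lt_nextAngle hα₀ hα i)) (hB' i)
  have hB2 : ∀ i, MemLp (B i) 2 (volume.restrict (Set.Ioi 0)) := fun i => by
    have := hB2' (i - 1)
    rwa [sub_add_cancel] at this
  have hφ0 : 0 ≤ φ := (rayAngle_nonneg hα₀ hα j).trans hφ.1.le
  have hφ2 : φ < 2 * Real.pi := hφ.2.trans_le (nextAngle_le_two_pi hα₀ hα j)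
  have hcos : ∀ i, Real.cos (rayAngle α i - φ) < 1 := fun i =>
    cos_sub_lt_one_of_ne (rayAngle_nonneg hα₀ hα i) (rayAngle_lt_two_pi hα₀ hα i) hφ0 hφ2
      (ne_rayAngle_of_mem_Ioo hα₀ hα hφ i)
  have hpi := Real.pi_pos
  -- Only the sector that contains the point contributes. For a sector with a larger index the
  -- argument of the point is raised by 2π, which places it beyond that sector.
  have hsec : ∀ i, cauchyRay (rayAngle α i) (A i) (polar ρ φ) -
      cauchyRay (nextAngle α i) (B (i + 1)) (polar ρ φ) =
      if i = j then 2 * Real.pi * Complex.I * F (polar ρ φ) else 0 := by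
    intro i
    split_ifs with hij
    · subst hij
      exact (hH i).cauchy_formula (nextAngle_sub_rayAngle_lt hα₀ hα i) hρ hφ (hA i) (hB' i)
    · rcases lt_or_gt_of_ne hij with h | h
      · exact (hH i).cauchy_formula_outside (rayAngle_lt_nextAngle hα₀ hα i) hρ
          ((nextAngle_le_rayAngle hα₀ hα h).trans_lt hφ.1)
          (by linarith [rayAngle_nonneg hα₀ hα i]) (hA i) (hB' i)
      · rw [← polar_add_two_pi]
        exact (hH i).cauchy_formula_outside (rayAngle_lt_nextAngle hα₀ hα i) hρ
          (by linarith [nextAngle_le_two_pi hα₀ hα i, (rayAngle_nonneg hα₀ hα j).trans_lt hφ.1])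
          (by linarith [nextAngle_le_rayAngle hα₀ hα h, hφ.2]) (hA i) (hB' i)
  -- Every ray closes one sector and opens the next, so a cyclic shift of the index regroups the
  -- boundary terms into one jump per ray.
  have hsum : ∑ i, cauchyRay (rayAngle α (i + 1)) (B (i + 1)) (polar ρ φ) =
      ∑ i, cauchyRay (rayAngle α i) (B i) (polar ρ φ) :=
    Equiv.sum_comp (Equiv.addRight (1 : Fin 6))
      fun i => cauchyRay (rayAngle α i) (B i) (polar ρ φ)
  calc ∑ i, cauchyRay (rayAngle α i) (fun r => A i r - B i r) (polar ρ φ)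
      = ∑ i, (cauchyRay (rayAngle α i) (A i) (polar ρ φ) -
          cauchyRay (nextAngle α i) (B (i + 1)) (polar ρ φ)) := by
        simp_rw [cauchyRay_sub' (hA2 _) (hB2 _) hρ (hcos _), cauchyRay_nextAngle,
          Finset.sum_sub_distrib, hsum]
    _ = 2 * Real.pi * Complex.I * F (polar ρ φ) := by
        simp_rw [hsec]
        simp

/-! ### Asymptotics and analyticity of Cauchy integrals -/

/-- In the nontangential region z/(ζ - z) is bounded by `c⁻¹`, and it tends to -1 at infinity, so
dominated convergence applies to any integrable density. -/
theorem tendsto_mul_cauchyRay {α : ℝ} {i : Fin 6} {g : ℝ → ℂ} (hg : IntegrableOn g (Set.Ioi 0))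
    {c : ℝ} (hc : 0 < c) :
    Tendsto (fun z : ℂ => z * cauchyRay (rayAngle α i) g z)
      (Bornology.cobounded ℂ ⊓ 𝓟 {z | c * ‖z‖ ≤ Metric.infDist z (contour α)})
      (𝓝 (∫ r in Set.Ioi (0 : ℝ), g r * -Complex.exp (Complex.I * rayAngle α i))) := by
  set θ := rayAngle α i with hθ
  have hcg : (Bornology.cobounded ℂ).IsCountablyGenerated := by
    rw [← comap_norm_atTop]; infer_instance
  have hrw : ∀ z : ℂ, z * cauchyRay θ g z = ∫ r in Set.Ioi (0 : ℝ),
      g r * (Complex.exp (Complex.I * θ) * (z / (polar r θ - z))) := by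
    intro z
    rw [cauchyRay, ← integral_const_mul]
    refine integral_congr_ae (.of_forall fun r => ?_)
    simp only
    ring
  simp_rw [hrw]
  refine tendsto_integral_filter_of_dominated_convergence (fun r => ‖g r‖ * c⁻¹) ?_ ?_
    (hg.norm.mul_const _) ?_
  · refine .of_forall fun z => hg.aestronglyMeasurable.mul ?_
    exact (measurable_const.mul (measurable_const.div
      ((continuous_polar_left θ).measurable.sub_const z))).aestronglyMeasurable
  · refine Eventually.filter_mono inf_le_right (eventually_principal.2 fun z hz => ?_)
    filter_upwards [ae_restrict_mem measurableSet_Ioi] with r hr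
    have hr' : 0 < r := hr
    rw [norm_mul, norm_mul, mul_comm Complex.I, Complex.norm_exp_ofReal_mul_I, one_mul, norm_div]
    refine mul_le_mul_of_nonneg_left ?_ (norm_nonneg _)
    have h1 : c * ‖z‖ ≤ ‖polar r θ - z‖ := by
      have h2 := Metric.infDist_le_dist_of_mem (x := z) (polar_ray_mem_contour (α := α) i hr'.le)
      rw [dist_comm, dist_eq_norm] at h2
      exact le_trans hz h2
    rcases eq_or_ne z 0 with rfl | hz0
    · simp [hc.le]
    · have h3 : 0 < ‖z‖ := norm_pos_iff.2 hz0
      rw [div_le_iff₀ ((mul_pos hc h3).trans_le h1), ← div_eq_inv_mul, le_div_iff₀ hc, mul_comm]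
      exact h1
  · refine .of_forall fun r => ?_
    refine Tendsto.const_mul _ ?_
    have h1 : Tendsto (fun z : ℂ => polar r θ - z) (Bornology.cobounded ℂ)
        (Bornology.cobounded ℂ) := by
      rw [← tendsto_norm_atTop_iff_cobounded]
      refine tendsto_atTop_mono (f := fun z : ℂ => ‖z‖ - ‖polar r θ‖) (fun z => ?_)
        (tendsto_atTop_add_const_right _ _ tendsto_norm_cobounded_atTop)
      rw [norm_sub_rev]
      exact norm_sub_norm_le _ _
    have h2 : Tendsto (fun z : ℂ => polar r θ * (polar r θ - z)⁻¹ - 1) (Bornology.cobounded ℂ)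
        (𝓝 (polar r θ * 0 - 1)) :=
      ((tendsto_inv₀_cobounded.comp h1).const_mul _).sub_const 1
    have h3 : Tendsto (fun z : ℂ => z / (polar r θ - z)) (Bornology.cobounded ℂ) (𝓝 (-1)) := by
      rw [mul_zero, zero_sub] at h2
      refine h2.congr' ?_
      filter_upwards [h1.eventually (Bornology.eventually_ne_cobounded (0 : ℂ))] with z hz
      field_simp
      ring
    have := (h3.mono_left (inf_le_left (b := 𝓟 {z | c * ‖z‖ ≤ Metric.infDist z (contour α)}))
      ).const_mul (Complex.exp (Complex.I * θ))
    simpa using this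

theorem differentiableAt_cauchyRay {θ : ℝ} {g : ℝ → ℂ} (hg : IntegrableOn g (Set.Ioi 0)) {z : ℂ}
    (hz : ∀ r : ℝ, 0 ≤ r → z ≠ polar r θ) : DifferentiableAt ℂ (cauchyRay θ g) z := by
  set S : Set ℂ := {w : ℂ | ∃ r : ℝ, 0 ≤ r ∧ w = polar r θ} with hS
  have hzS : z ∉ S := fun ⟨r, hr, h⟩ => hz r hr h
  have hd : 0 < Metric.infDist z S :=
    ((isClosed_ray θ).notMem_iff_infDist_pos ⟨polar 0 θ, 0, le_rfl, rfl⟩).1 hzS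
  set d := Metric.infDist z S with hdd
  have hdist : ∀ w ∈ Metric.ball z (d / 2), ∀ r : ℝ, 0 < r → d / 2 ≤ ‖polar r θ - w‖ := by
    intro w hw r hr
    have h1 : d ≤ dist z (polar r θ) := Metric.infDist_le_dist_of_mem ⟨r, hr.le, rfl⟩
    have h2 : dist w z < d / 2 := hw
    have h3 := dist_triangle z w (polar r θ)
    rw [← dist_eq_norm, dist_comm (polar r θ)]
    rw [dist_comm] at h2
    linarith
  have hne : ∀ w ∈ Metric.ball z (d / 2), ∀ r : ℝ, 0 < r → polar r θ - w ≠ 0 := fun w hw r hr =>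
    norm_pos_iff.1 ((half_pos hd).trans_le (hdist w hw r hr))
  have hball : Metric.ball z (d / 2) ∈ 𝓝 z := Metric.ball_mem_nhds z (half_pos hd)
  have hmeas : ∀ w, AEStronglyMeasurable
      (fun r => g r * (Complex.exp (Complex.I * θ) / (polar r θ - w)))
      (volume.restrict (Set.Ioi 0)) := fun w =>
    hg.aestronglyMeasurable.mul (measurable_kernel θ w).aestronglyMeasurable
  have key := hasDerivAt_integral_of_dominated_loc_of_deriv_le (𝕜 := ℂ) (x₀ := z)
    (μ := volume.restrict (Set.Ioi (0 : ℝ)))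
    (F := fun w r => g r * (Complex.exp (Complex.I * θ) / (polar r θ - w)))
    (F' := fun w r => g r * (Complex.exp (Complex.I * θ) / (polar r θ - w) ^ 2))
    (bound := fun r => ‖g r‖ * (d / 2)⁻¹ ^ 2) hball (.of_forall hmeas) ?_ ?_ ?_
    (hg.norm.mul_const _) ?_
  · exact key.2.differentiableAt
  · refine Integrable.mono' (hg.norm.mul_const (d / 2)⁻¹) (hmeas z) ?_
    filter_upwards [ae_restrict_mem measurableSet_Ioi] with r hr
    rw [norm_mul, norm_div, mul_comm Complex.I, Complex.norm_exp_ofReal_mul_I, one_div]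
    exact mul_le_mul_of_nonneg_left (inv_anti₀ (half_pos hd)
      (hdist z (Metric.mem_ball_self (half_pos hd)) r hr)) (norm_nonneg _)
  · exact hg.aestronglyMeasurable.mul (measurable_const.div
      (((continuous_polar_left θ).measurable.sub_const z).pow_const 2)).aestronglyMeasurable
  · filter_upwards [ae_restrict_mem measurableSet_Ioi] with r hr w hw
    rw [norm_mul, norm_div, mul_comm Complex.I, Complex.norm_exp_ofReal_mul_I, one_div, norm_pow,
      ← inv_pow]
    gcongr
    exact hdist w hw r hr
  · filter_upwards [ae_restrict_mem measurableSet_Ioi] with r hr w hw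
    have h1 : HasDerivAt (fun w : ℂ => polar r θ - w) (-1) w := by
      simpa using (hasDerivAt_id w).const_sub (polar r θ)
    have h2 := ((h1.inv (hne w hw r hr)).const_mul (Complex.exp (Complex.I * θ))).const_mul (g r)
    convert! h2 using 1
    ring

/-! ### Problems with nilpotent weights -/

/-- Weights that are nilpotent and analytic, decay exponentially along the rays of all contours
with opening less than `b₀`, and vanish on the real axis. -/
structure IsWeight (b₀ : ℝ) (W : Fin 6 → ℂ → Matrix (Fin 2) (Fin 2) ℂ) : Prop where
  le_half_pi : b₀ ≤ Real.pi / 2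
  zero : ∀ z, W 0 z = 0
  three : ∀ z, W 3 z = 0
  nilpotent : ∀ i z, W i z * W i z = 0
  differentiableAt : ∀ (i : Fin 6) (β r : ℝ), 0 < β → β < b₀ → 0 < r → ∀ m n : Fin 2,
    DifferentiableAt ℂ (fun z => W i z m n) (polar r (rayAngle β i))
  bound : ∀ β₁ β₂ : ℝ, 0 < β₁ → β₂ < b₀ → ∃ A c : ℝ, 0 ≤ A ∧ 0 < c ∧
    ∀ (i : Fin 6) (β r : ℝ), β₁ ≤ β → β ≤ β₂ → 0 < r → ∀ m n : Fin 2,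
      ‖W i (polar r (rayAngle β i)) m n‖ ≤ A * Real.exp (-(c * r))

/-- The jump matrix `I - W` on the rays of `Γ`. -/
noncomputable def weightJump (α : ℝ) (W : Fin 6 → ℂ → Matrix (Fin 2) (Fin 2) ℂ) (i : Fin 6) (r : ℝ) :
    Matrix (Fin 2) (Fin 2) ℂ :=
  1 - W i (polar r (rayAngle α i))

/-- `-1` on the rays oriented outwards and `1` on the rays oriented inwards. -/
noncomputable def raySign : Fin 6 → ℂ := ![-1, 1, -1, 1, -1, 1]

/-- `P` and `Q` are the limits of `M` at `r e^{iθ}` on `Γᵢ` as the argument decreases, respectively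
increases to `θ`, and they satisfy the jump relation. -/
def BoundaryRel (α : ℝ) (W : Fin 6 → ℂ → Matrix (Fin 2) (Fin 2) ℂ)
    (M : ℂ → Matrix (Fin 2) (Fin 2) ℂ) (i : Fin 6) (r : ℝ) (P Q : Matrix (Fin 2) (Fin 2) ℂ) :
    Prop :=
  Tendsto (fun θ => M (polar r θ)) (𝓝[>] (rayAngle α i)) (𝓝 P) ∧
    Tendsto (fun θ => M (polar r θ)) (𝓝[<] (rayAngle α i)) (𝓝 Q) ∧
    P - Q = raySign i • (P * W i (polar r (rayAngle α i))) ∧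
    P * W i (polar r (rayAngle α i)) = Q * W i (polar r (rayAngle α i))

section Weights

variable {α b₀ : ℝ} {W : Fin 6 → ℂ → Matrix (Fin 2) (Fin 2) ℂ}
  {M : ℂ → Matrix (Fin 2) (Fin 2) ℂ}

/-- Nilpotency makes the two boundary values agree after multiplication by `w`, so the jump can be
expressed through either of them. Together with the inward case this puts all rays into one form, up
to a sign. -/
theorem jump_outwards {P Q w : Matrix (Fin 2) (Fin 2) ℂ} (hw : w * w = 0) (h : P = Q * (1 - w)) :
    P - Q = (-1 : ℂ) • (P * w) ∧ P * w = Q * w := by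
  have h2 : P * w = Q * w := by
    rw [h, mul_assoc, sub_mul, one_mul, hw, sub_zero]
  refine ⟨?_, h2⟩
  rw [h2, h, mul_sub, mul_one, neg_one_smul]
  abel

theorem jump_inwards {P Q w : Matrix (Fin 2) (Fin 2) ℂ} (hw : w * w = 0) (h : Q = P * (1 - w)) :
    P - Q = (1 : ℂ) • (P * w) ∧ P * w = Q * w := by
  have h2 : Q * w = P * w := by
    rw [h, mul_assoc, sub_mul, one_mul, hw, sub_zero]
  refine ⟨?_, h2.symm⟩
  rw [h, mul_sub, mul_one, one_smul]
  abel

theorem IsSolution.ae_boundaryRel (hα₀ : 0 < α) (hα : α < Real.pi / 2) (hW : IsWeight b₀ W)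
    (hM : IsSolution α (weightJump α W) M) (i : Fin 6) :
    ∀ᵐ r ∂(volume.restrict (Set.Ioi (0 : ℝ))), ∃ P Q, BoundaryRel α W M i r P Q := by
  filter_upwards [hM.2 i, ae_restrict_mem measurableSet_Ioi] with r ⟨P, Q, hP, hQ, hPQ⟩ hr
  have hn := hW.nilpotent i (polar r (rayAngle α i))
  have hout : leftOf α i = plusSide α → rightOf α i = minusSide α → raySign i = -1 →
      ∃ P Q, BoundaryRel α W M i r P Q := fun h1 h2 h3 =>
    ⟨P, Q, HasNontangentialLimit.tendsto_left hα₀ hα hr (h1 ▸ hP),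
      HasNontangentialLimit.tendsto_right hα₀ hα hr (h2 ▸ hQ), h3 ▸ jump_outwards hn hPQ⟩
  have hin : leftOf α i = minusSide α → rightOf α i = plusSide α → raySign i = 1 →
      ∃ P Q, BoundaryRel α W M i r P Q := fun h1 h2 h3 =>
    ⟨Q, P, HasNontangentialLimit.tendsto_left hα₀ hα hr (h1 ▸ hQ),
      HasNontangentialLimit.tendsto_right hα₀ hα hr (h2 ▸ hP), h3 ▸ jump_inwards hn hPQ⟩
  fin_cases i
  exacts [hout rfl rfl rfl, hin rfl rfl rfl, hout rfl rfl rfl, hin rfl rfl rfl, hout rfl rfl rfl,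
    hin rfl rfl rfl]

theorem IsSolution.exists_boundaryValues (hα₀ : 0 < α) (hα : α < Real.pi / 2)
    (hW : IsWeight b₀ W) (hM : IsSolution α (weightJump α W) M) :
    ∃ A B : Fin 6 → ℝ → Matrix (Fin 2) (Fin 2) ℂ, ∀ i,
      ∀ᵐ r ∂(volume.restrict (Set.Ioi (0 : ℝ))), BoundaryRel α W M i r (A i r) (B i r) := by
  have h : ∀ (i : Fin 6) (r : ℝ), ∃ P Q, (∃ P Q, BoundaryRel α W M i r P Q) →
      BoundaryRel α W M i r P Q := by
    intro i r
    by_cases h : ∃ P Q, BoundaryRel α W M i r P Q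
    · obtain ⟨P, Q, hPQ⟩ := h
      exact ⟨P, Q, fun _ => hPQ⟩
    · exact ⟨0, 0, fun h' => absurd h' h⟩
  choose A B hAB using h
  exact ⟨A, B, fun i => (hM.ae_boundaryRel hα₀ hα hW i).mono fun r hr => hAB i r hr⟩

/-- Hardy bounds concern `P - 1` and not `P`. Splitting off the identity leaves products with a
Hardy factor and the decaying weight itself. -/
theorem mul_weight_apply (P w : Matrix (Fin 2) (Fin 2) ℂ) (m n : Fin 2) :
    (P * w) m n = (P - 1) m 0 * w 0 n + (P - 1) m 1 * w 1 n + w m n := by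
  have h : P * w = (P - 1) * w + w := by rw [sub_mul, one_mul, sub_add_cancel]
  rw [h, Matrix.add_apply, Matrix.mul_apply, Fin.sum_univ_two]

theorem tendsto_entry {X : Type*} {l : Filter X} {F : X → Matrix (Fin 2) (Fin 2) ℂ}
    {P : Matrix (Fin 2) (Fin 2) ℂ} (h : Tendsto F l (𝓝 P)) (m n : Fin 2) :
    Tendsto (fun x => F x m n) l (𝓝 (P m n)) :=
  (tendsto_pi_nhds.1 ((tendsto_pi_nhds.1 h) m)) n

theorem IsWeight.lt_half_pi (hW : IsWeight b₀ W) {β : ℝ} (h : β < b₀) : β < Real.pi / 2 :=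
  h.trans_le hW.le_half_pi

theorem IsWeight.continuousAt (hW : IsWeight b₀ W) {i : Fin 6} {β r : ℝ} (h₀ : 0 < β)
    (h : β < b₀) (hr : 0 < r) : ContinuousAt (W i) (polar r (rayAngle β i)) :=
  continuousAt_pi.2 fun m => continuousAt_pi.2 fun n =>
    (hW.differentiableAt i β r h₀ h hr m n).continuousAt

theorem IsWeight.integrableOn_ray (hW : IsWeight b₀ W) {β : ℝ} (h₀ : 0 < β) (h : β < b₀)
    {P : ℝ → Matrix (Fin 2) (Fin 2) ℂ}
    (hP : ∀ m n, MemLp (fun r => (P r - 1) m n) 2 (volume.restrict (Set.Ioi 0))) (i : Fin 6)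
    (m n : Fin 2) :
    IntegrableOn (fun r => (P r * W i (polar r (rayAngle β i))) m n) (Set.Ioi 0) := by
  obtain ⟨A, c, hA, hc, hbd⟩ := hW.bound β β h₀ h
  have hm : ∀ m n, AEStronglyMeasurable (fun r => W i (polar r (rayAngle β i)) m n)
      (volume.restrict (Set.Ioi 0)) := fun m n =>
    ContinuousOn.aestronglyMeasurable (fun r hr => (ContinuousAt.comp
      (f := fun r : ℝ => polar r (rayAngle β i))
      (hW.differentiableAt i β r h₀ h hr m n).continuousAt
      (continuous_polar_left _).continuousAt).continuousWithinAt) measurableSet_Ioi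
  have h1 : ∀ m n, IntegrableOn (fun r => W i (polar r (rayAngle β i)) m n) (Set.Ioi 0) :=
    fun m n => Integrable.mono' ((integrableOn_exp_neg_mul hc).const_mul A) (hm m n) (by
      filter_upwards [ae_restrict_mem measurableSet_Ioi] with r hr
      exact hbd i β r le_rfl le_rfl hr m n)
  have h2 : ∀ m n, MemLp (fun r => W i (polar r (rayAngle β i)) m n) 2
      (volume.restrict (Set.Ioi 0)) := fun m n =>
    memLp_two_of_lintegral_le (lintegral_exp_ne_top hc) (hm m n) (lintegral_sq_le_of_exp hc
      fun r hr => hbd i β r le_rfl le_rfl hr m n)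
  simp_rw [mul_weight_apply]
  exact ((memLp_one_iff_integrable.1 ((h2 0 n).mul' (hP m 0))).add
    (memLp_one_iff_integrable.1 ((h2 1 n).mul' (hP m 1)))).add (h1 m n)

/-- The Cauchy representation of a solution. -/
theorem IsSolution.sum_cauchyRay (hα₀ : 0 < α) (hα : α < Real.pi / 2)
    (hM : IsSolution α (weightJump α W) M) {A B : Fin 6 → ℝ → Matrix (Fin 2) (Fin 2) ℂ}
    (hAB : ∀ i, ∀ᵐ r ∂(volume.restrict (Set.Ioi (0 : ℝ))), BoundaryRel α W M i r (A i r) (B i r))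
    (m n : Fin 2) {z : ℂ} (hz : z ∉ contour α) :
    ∑ i, raySign i * cauchyRay (rayAngle α i)
      (fun r => (A i r * W i (polar r (rayAngle α i))) m n) z =
      2 * Real.pi * Complex.I * (M z - 1) m n := by
  rw [← (hM.1 m n).sum_cauchyRay hα₀ hα (A := fun i r => (A i r - 1) m n)
    (B := fun i r => (B i r - 1) m n)
    (fun i => (hAB i).mono fun _ hr => tendsto_entry (hr.1.sub_const 1) m n)
    (fun i => (hAB i).mono fun r hr => tendsto_entry (hr.2.1.sub_const 1) m n) hz]
  refine Finset.sum_congr rfl fun i _ => ?_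
  rw [cauchyRay, cauchyRay, ← integral_const_mul]
  refine integral_congr_ae ((hAB i).mono fun r hr => ?_)
  have h : (A i r - 1) m n - (B i r - 1) m n =
      raySign i * (A i r * W i (polar r (rayAngle α i))) m n := by
    have := congrFun (congrFun hr.2.2.1 m) n
    simp only [Matrix.sub_apply, Matrix.smul_apply, smul_eq_mul] at this ⊢
    rw [← this]; ring
  simp only
  rw [h]; ring

theorem IsSolution.memLp_boundary (hα₀ : 0 < α) (hα : α < Real.pi / 2)
    (hM : IsSolution α (weightJump α W) M) {A B : Fin 6 → ℝ → Matrix (Fin 2) (Fin 2) ℂ}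
    (hAB : ∀ i, ∀ᵐ r ∂(volume.restrict (Set.Ioi (0 : ℝ))), BoundaryRel α W M i r (A i r) (B i r))
    (i : Fin 6) (m n : Fin 2) :
    MemLp (fun r => (A i r - 1) m n) 2 (volume.restrict (Set.Ioi 0)) :=
  ((hM.1 m n).hardySector hα₀ hα i).memLp_of_tendsto
    (Ioo_mem_nhdsGT (rayAngle_lt_nextAngle hα₀ hα i))
    ((hAB i).mono fun _ hr => tendsto_entry (hr.1.sub_const 1) m n)

/-- Every solution has potentials. -/
theorem IsSolution.exists_hasPotentials (hα₀ : 0 < α) (hα : α < b₀) (hW : IsWeight b₀ W)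
    (hM : IsSolution α (weightJump α W) M) : ∃ u v, HasPotentials α M u v := by
  have hα' := hW.lt_half_pi hα
  obtain ⟨A, B, hAB⟩ := hM.exists_boundaryValues hα₀ hα' hW
  have key : ∀ m n : Fin 2, m ≠ n → ∃ u : ℂ, ∀ c : ℝ, 0 < c →
      Tendsto (fun z : ℂ => z * M z m n)
        (Bornology.cobounded ℂ ⊓ 𝓟 {z | c * ‖z‖ ≤ Metric.infDist z (contour α)}) (𝓝 u) := by
    intro m n hmn
    -- The value is read off termwise from the Cauchy representation; `m ≠ n` makes the identity
    -- matrix drop out.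
    refine ⟨(2 * Real.pi * Complex.I)⁻¹ * ∑ i, raySign i * ∫ r in Set.Ioi (0 : ℝ),
      (A i r * W i (polar r (rayAngle α i))) m n * -Complex.exp (Complex.I * rayAngle α i),
      fun c hc => ?_⟩
    have hint := fun i => hW.integrableOn_ray hα₀ hα (hM.memLp_boundary hα₀ hα' hAB i) i m n
    have h1 := (tendsto_finsetSum Finset.univ fun i _ =>
      (tendsto_mul_cauchyRay (α := α) (i := i) (hint i) hc).const_mul (raySign i)).const_mul
        (2 * Real.pi * Complex.I)⁻¹
    refine h1.congr' ?_
    have hne : ∀ᶠ z in Bornology.cobounded ℂ ⊓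
        𝓟 {z | c * ‖z‖ ≤ Metric.infDist z (contour α)}, z ∉ contour α := by
      refine eventually_inf_principal.2 ?_
      filter_upwards [Bornology.eventually_ne_cobounded (0 : ℂ)] with z hz hz2 hmem
      have h3 : c * ‖z‖ ≤ Metric.infDist z (contour α) := hz2
      rw [Metric.infDist_zero_of_mem hmem] at h3
      exact absurd h3 (not_le.2 (mul_pos hc (norm_pos_iff.2 hz)))
    filter_upwards [hne] with z hz
    have h2 := hM.sum_cauchyRay hα₀ hα' hAB m n hz
    rw [Matrix.sub_apply, Matrix.one_apply_ne hmn, sub_zero] at h2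
    have h3 : M z m n = (2 * Real.pi * Complex.I)⁻¹ * (2 * Real.pi * Complex.I * M z m n) := by
      rw [inv_mul_cancel_left₀ Complex.two_pi_I_ne_zero]
    rw [h3, ← h2, mul_left_comm z]
    congr 1
    rw [Finset.mul_sum]
    exact Finset.sum_congr rfl fun i _ => by ring
  obtain ⟨u, hu⟩ := key 0 1 (by decide)
  obtain ⟨v, hv⟩ := key 1 0 (by decide)
  exact ⟨u, v, fun c hc => ⟨hu c hc, hv c hc⟩⟩

end Weights

/-! ### Change of the opening of the contour -/

/-- The candidate for the solution on the contour with opening `α'`, given a solution `M` on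
another contour. -/
noncomputable def deform (α' : ℝ) (W : Fin 6 → ℂ → Matrix (Fin 2) (Fin 2) ℂ)
    (M : ℂ → Matrix (Fin 2) (Fin 2) ℂ) (z : ℂ) : Matrix (Fin 2) (Fin 2) ℂ :=
  Matrix.of fun m n => (1 : Matrix (Fin 2) (Fin 2) ℂ) m n + (2 * Real.pi * Complex.I)⁻¹ *
    ∑ i, raySign i * cauchyRay (rayAngle α' i)
      (fun r => (M (polar r (rayAngle α' i)) * W i (polar r (rayAngle α' i))) m n) z

/-- The angles between the `i`-th rays of two contours. -/
def wedge (α α' : ℝ) (i : Fin 6) : Set ℝ :=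
  Set.Ioo (min (rayAngle α i) (rayAngle α' i)) (max (rayAngle α i) (rayAngle α' i))

open Classical in
/-- The orientation of the wedge between the `i`-th rays. -/
noncomputable def wedgeSign (α α' : ℝ) (i : Fin 6) : ℂ :=
  if rayAngle α i < rayAngle α' i then 1 else -1

section Deform

variable {α α' b₀ : ℝ} {W : Fin 6 → ℂ → Matrix (Fin 2) (Fin 2) ℂ}
  {M : ℂ → Matrix (Fin 2) (Fin 2) ℂ}

/-- The properties in `IsWeight` are stated on rays of contours. Sweeping the wedge by intermediate
openings makes them available throughout it, with uniform decay. -/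
theorem exists_eq_of_mem_wedge {i : Fin 6} {θ : ℝ} (h : θ ∈ wedge α α' i) :
    ∃ β, min α α' ≤ β ∧ β ≤ max α α' ∧ θ = rayAngle β i := by
  obtain ⟨h1, h2⟩ := h
  rw [min_lt_iff] at h1
  rw [lt_max_iff] at h2
  simp only [min_le_iff, le_max_iff]
  fin_cases i <;> simp [rayAngle] at h1 h2 ⊢
  · linarith
  · rcases h1 with h1 | h1
    · rcases h2 with h2 | h2
      · exact ⟨.inl h1.le, .inl h2.le⟩
      · exact ⟨.inl h1.le, .inr h2.le⟩
    · rcases h2 with h2 | h2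
      · exact ⟨.inr h1.le, .inl h2.le⟩
      · exact ⟨.inr h1.le, .inr h2.le⟩
  · refine ⟨Real.pi - θ, ?_, ?_, by ring⟩
    · rcases h2 with h2 | h2
      · left; linarith
      · right; linarith
    · rcases h1 with h1 | h1
      · left; linarith
      · right; linarith
  · linarith
  · refine ⟨θ - Real.pi, ?_, ?_, by ring⟩
    · rcases h1 with h1 | h1
      · left; linarith
      · right; linarith
    · rcases h2 with h2 | h2
      · left; linarith
      · right; linarith
  · refine ⟨2 * Real.pi - θ, ?_, ?_, by ring⟩
    · rcases h2 with h2 | h2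
      · left; linarith
      · right; linarith
    · rcases h1 with h1 | h1
      · left; linarith
      · right; linarith

/-- A wedge lies in a single sector of the contour with opening `α`, where a solution is analytic
and satisfies the Hardy bound. The tables record which sector: the nonreal rays move towards the
imaginary axis when the opening grows. -/
theorem exists_sector_wedge (hα₀ : 0 < α) (hα : α < Real.pi / 2) (hα'₀ : 0 < α')
    (hα' : α' < Real.pi / 2) (i : Fin 6) :
    ∃ j, rayAngle α j ≤ min (rayAngle α i) (rayAngle α' i) ∧
      max (rayAngle α i) (rayAngle α' i) ≤ nextAngle α j := by
  simp only [le_min_iff, max_le_iff]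
  rcases le_total α α' with h | h
  · refine ⟨(![0, 1, 1, 3, 4, 4] : Fin 6 → Fin 6) i, ?_⟩
    fin_cases i <;> simp [rayAngle, nextAngle] <;> (repeat' constructor) <;> linarith
  · refine ⟨(![0, 0, 2, 3, 3, 5] : Fin 6 → Fin 6) i, ?_⟩
    fin_cases i <;> simp [rayAngle, nextAngle] <;> (repeat' constructor) <;> linarith

theorem max_lt_min_of_lt (hα₀ : 0 < α) (hα : α < Real.pi / 2) (hα'₀ : 0 < α')
    (hα' : α' < Real.pi / 2) {i j : Fin 6} (hij : i < j) :
    max (rayAngle α i) (rayAngle α' i) < min (rayAngle α j) (rayAngle α' j) :=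
  max_lt
    (lt_min (rayAngle_lt_rayAngle hα₀ hα hα₀ hα hij) (rayAngle_lt_rayAngle hα₀ hα hα'₀ hα' hij))
    (lt_min (rayAngle_lt_rayAngle hα'₀ hα' hα₀ hα hij)
      (rayAngle_lt_rayAngle hα'₀ hα' hα'₀ hα' hij))

theorem rayAngle_ne_rayAngle (h : α ≠ α') {i : Fin 6} (h0 : i ≠ 0) (h3 : i ≠ 3) :
    rayAngle α i ≠ rayAngle α' i := by
  fin_cases i <;> simp [rayAngle] at h0 h3 ⊢ <;> exact h

theorem rayAngle_zero (α : ℝ) : rayAngle α 0 = 0 := rfl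

theorem IsSolution.hardySector_wedge (hα₀ : 0 < α) (hα : α < b₀) (hα'₀ : 0 < α') (hα' : α' < b₀)
    (hW : IsWeight b₀ W) {j : Fin 6 → ℝ → Matrix (Fin 2) (Fin 2) ℂ} (hM : IsSolution α j M)
    (i : Fin 6) (m n : Fin 2) :
    HardySector (fun z => (M z - 1) m n) (min (rayAngle α i) (rayAngle α' i))
        (max (rayAngle α i) (rayAngle α' i)) ∧
      HardySector (fun z => (M z * W i z) m n) (min (rayAngle α i) (rayAngle α' i))
        (max (rayAngle α i) (rayAngle α' i)) := by
  obtain ⟨l, h1, h2⟩ := exists_sector_wedge hα₀ (hW.lt_half_pi hα) hα'₀ (hW.lt_half_pi hα') i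
  have hF := fun m n => ((hM.1 m n).hardySector hα₀ (hW.lt_half_pi hα) l).mono h1 h2
  obtain ⟨A, c, hA, hc, hbd⟩ := hW.bound (min α α') (max α α') (lt_min hα₀ hα'₀) (max_lt hα hα')
  have hd : ∀ m n (r : ℝ), 0 < r → ∀ θ ∈ wedge α α' i,
      DifferentiableAt ℂ (fun z => W i z m n) (polar r θ) := by
    intro m n r hr θ hθ
    obtain ⟨β, hβ1, hβ2, rfl⟩ := exists_eq_of_mem_wedge hθ
    exact hW.differentiableAt i β r ((lt_min hα₀ hα'₀).trans_le hβ1)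
      (hβ2.trans_lt (max_lt hα hα')) hr m n
  have hb : ∀ m n (r : ℝ), 0 < r → ∀ θ ∈ wedge α α' i,
      ‖W i (polar r θ) m n‖ ≤ A * Real.exp (-(c * r)) := by
    intro m n r hr θ hθ
    obtain ⟨β, hβ1, hβ2, rfl⟩ := exists_eq_of_mem_wedge hθ
    exact hbd i β r hβ1 hβ2 hr m n
  have hb' : ∀ m n (r : ℝ), 0 < r → ∀ θ ∈ wedge α α' i, ‖W i (polar r θ) m n‖ ≤ A := by
    intro m n r hr θ hθ
    refine (hb m n r hr θ hθ).trans (mul_le_of_le_one_right hA (Real.exp_le_one_iff.2 ?_))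
    have := mul_pos hc hr
    linarith
  refine ⟨hF m n, ?_⟩
  simp_rw [mul_weight_apply]
  exact (((hF m 0).mul_bounded (hd 0 n) (hb' 0 n)).add
    ((hF m 1).mul_bounded (hd 1 n) (hb' 1 n))).add (HardySector.of_exp hc (hd m n) (hb m n))

theorem IsSolution.continuousAt {j : Fin 6 → ℝ → Matrix (Fin 2) (Fin 2) ℂ}
    (hM : IsSolution α j M) {z : ℂ} (hz : z ∉ contour α) : ContinuousAt M z := by
  refine continuousAt_pi.2 fun m => continuousAt_pi.2 fun n => ?_
  have h := ((hM.1 m n).1.differentiableAt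
    (isClosed_contour.isOpen_compl.mem_nhds hz)).continuousAt
  have h2 := h.add_const ((1 : Matrix (Fin 2) (Fin 2) ℂ) m n)
  simpa using h2

theorem IsSolution.integrableOn_density (hα₀ : 0 < α) (hα : α < b₀) (hα'₀ : 0 < α')
    (hα' : α' < b₀) (hne : α ≠ α') (hW : IsWeight b₀ W)
    {j : Fin 6 → ℝ → Matrix (Fin 2) (Fin 2) ℂ} (hM : IsSolution α j M) (i : Fin 6)
    (m n : Fin 2) : IntegrableOn
      (fun r => (M (polar r (rayAngle α' i)) * W i (polar r (rayAngle α' i))) m n)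
      (Set.Ioi 0) := by
  rcases eq_or_ne i 0 with rfl | h0
  · simp [hW.zero]
  rcases eq_or_ne i 3 with rfl | h3
  · simp [hW.three]
  have hα2 := hW.lt_half_pi hα
  have hα'2 := hW.lt_half_pi hα'
  have hray : ∀ l, rayAngle α' i ≠ rayAngle α l := by
    intro l
    rcases lt_trichotomy i l with h | rfl | h
    · exact (rayAngle_lt_rayAngle hα'₀ hα'2 hα₀ hα2 h).ne
    · exact (rayAngle_ne_rayAngle hne h0 h3).symm
    · exact (rayAngle_lt_rayAngle hα₀ hα2 hα'₀ hα'2 h).ne'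
  obtain ⟨l, hl⟩ := exists_Ioo_of_ne (rayAngle_nonneg hα'₀ hα'2 i)
    (rayAngle_lt_two_pi hα'₀ hα'2 i) hray
  exact hW.integrableOn_ray (P := fun r => M (polar r (rayAngle α' i))) hα'₀ hα'
    (fun m n => ((hM.1 m n).hardySector hα₀ hα2 l).memLp hl) i m n

theorem tendsto_mul_weight (hW : IsWeight b₀ W) {i : Fin 6} {β r : ℝ} (hβ₀ : 0 < β) (hβ : β < b₀)
    (hr : 0 < r) {l : Filter ℝ} (hl : l ≤ 𝓝 (rayAngle β i)) {P : Matrix (Fin 2) (Fin 2) ℂ}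
    (h : Tendsto (fun θ => M (polar r θ)) l (𝓝 P)) (m n : Fin 2) :
    Tendsto (fun θ => (M (polar r θ) * W i (polar r θ)) m n) l
      (𝓝 ((P * W i (polar r (rayAngle β i))) m n)) := by
  have h1 : Tendsto (fun θ => W i (polar r θ)) l (𝓝 (W i (polar r (rayAngle β i)))) :=
    (hW.continuousAt hβ₀ hβ hr).tendsto.comp
      (((continuous_polar_right r).tendsto _).mono_left hl)
  exact tendsto_entry (h.mul h1) m n

-- This is Cauchy's formula in the wedge for the product of `M` and the continued weight, at a point
-- inside or outside the wedge. The sign records which of the two rays comes first.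
open Classical in
theorem IsSolution.cauchyRay_sub_cauchyRay (hα₀ : 0 < α) (hα : α < b₀) (hα'₀ : 0 < α')
    (hα' : α' < b₀) (hne : α ≠ α') (hW : IsWeight b₀ W) (hM : IsSolution α (weightJump α W) M)
    {A B : Fin 6 → ℝ → Matrix (Fin 2) (Fin 2) ℂ}
    (hAB : ∀ i, ∀ᵐ r ∂(volume.restrict (Set.Ioi (0 : ℝ))), BoundaryRel α W M i r (A i r) (B i r))
    {ρ φ : ℝ} (hρ : 0 < ρ) (hφ₀ : 0 ≤ φ) (hφ : φ < 2 * Real.pi) {i : Fin 6}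
    (h : φ ≠ rayAngle α i) (h' : φ ≠ rayAngle α' i) (m n : Fin 2) :
    cauchyRay (rayAngle α i) (fun r => (A i r * W i (polar r (rayAngle α i))) m n) (polar ρ φ) -
      cauchyRay (rayAngle α' i) (fun r => (M (polar r (rayAngle α' i)) *
        W i (polar r (rayAngle α' i))) m n) (polar ρ φ) =
      if φ ∈ wedge α α' i then
        wedgeSign α α' i * (2 * Real.pi * Complex.I * (M (polar ρ φ) * W i (polar ρ φ)) m n)
      else 0 := by
  have hα2 := hW.lt_half_pi hα
  have hα'2 := hW.lt_half_pi hα'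
  rcases eq_or_ne i 0 with rfl | h0
  · simp [hW.zero, cauchyRay]
  rcases eq_or_ne i 3 with rfl | h3
  · simp [hW.three, cauchyRay]
  have hpi := Real.pi_pos
  have hray : ∀ l, rayAngle α' i ≠ rayAngle α l := by
    intro l
    rcases lt_trichotomy i l with h | rfl | h
    · exact (rayAngle_lt_rayAngle hα'₀ hα'2 hα₀ hα2 h).ne
    · exact (rayAngle_ne_rayAngle hne h0 h3).symm
    · exact (rayAngle_lt_rayAngle hα₀ hα2 hα'₀ hα'2 h).ne'
  have hn1 := rayAngle_nonneg hα₀ hα2 i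
  have hn2 := rayAngle_nonneg hα'₀ hα'2 i
  have ht1 := rayAngle_lt_two_pi hα₀ hα2 i
  have ht2 := rayAngle_lt_two_pi hα'₀ hα'2 i
  have hcont : ∀ r : ℝ, 0 < r → Tendsto (fun θ => M (polar r θ)) (𝓝 (rayAngle α' i))
      (𝓝 (M (polar r (rayAngle α' i)))) := fun r hr =>
    (hM.continuousAt (polar_notMem_contour hα₀ hα2 hr hn2 ht2 hray)).tendsto.comp
      ((continuous_polar_right r).tendsto _)
  have hG := (hM.hardySector_wedge hα₀ hα hα'₀ hα' hW i m n).2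
  have hsub : max (rayAngle α i) (rayAngle α' i) - min (rayAngle α i) (rayAngle α' i) <
      Real.pi := by
    obtain ⟨l, h1, h2⟩ := exists_sector_wedge hα₀ hα2 hα'₀ hα'2 i
    linarith [nextAngle_sub_rayAngle_lt hα₀ hα2 l]
  rcases lt_or_gt_of_ne (hray i).symm with hlt | hlt
  · rw [wedgeSign, if_pos hlt, one_mul, wedge]
    rw [min_eq_left hlt.le, max_eq_right hlt.le] at *
    have hb1 : ∀ᵐ r ∂(volume.restrict (Set.Ioi (0 : ℝ))),
        Tendsto (fun θ => (M (polar r θ) * W i (polar r θ)) m n) (𝓝[>] (rayAngle α i))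
          (𝓝 ((A i r * W i (polar r (rayAngle α i))) m n)) := by
      filter_upwards [hAB i, ae_restrict_mem measurableSet_Ioi] with r hr hr0
      exact tendsto_mul_weight hW hα₀ hα hr0 nhdsWithin_le_nhds hr.1 m n
    have hb2 : ∀ᵐ r ∂(volume.restrict (Set.Ioi (0 : ℝ))),
        Tendsto (fun θ => (M (polar r θ) * W i (polar r θ)) m n) (𝓝[<] (rayAngle α' i))
          (𝓝 ((M (polar r (rayAngle α' i)) * W i (polar r (rayAngle α' i))) m n)) := by
      filter_upwards [ae_restrict_mem measurableSet_Ioi] with r hr0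
      exact tendsto_mul_weight hW hα'₀ hα' hr0 nhdsWithin_le_nhds
        ((hcont r hr0).mono_left nhdsWithin_le_nhds) m n
    split_ifs with hw
    · exact hG.cauchy_formula hsub hρ hw hb1 hb2
    · rcases lt_or_gt_of_ne h with h1 | h1
      · rw [← polar_add_two_pi]
        exact hG.cauchy_formula_outside hlt hρ (by linarith) (by linarith) hb1 hb2
      · have h2 : rayAngle α' i < φ := lt_of_le_of_ne (not_lt.1 fun h3 => hw ⟨h1, h3⟩) h'.symm
        exact hG.cauchy_formula_outside hlt hρ h2 (by linarith) hb1 hb2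
  · rw [wedgeSign, if_neg (not_lt.2 hlt.le), wedge]
    rw [min_eq_right hlt.le, max_eq_left hlt.le] at *
    have hb1 : ∀ᵐ r ∂(volume.restrict (Set.Ioi (0 : ℝ))),
        Tendsto (fun θ => (M (polar r θ) * W i (polar r θ)) m n) (𝓝[<] (rayAngle α i))
          (𝓝 ((A i r * W i (polar r (rayAngle α i))) m n)) := by
      filter_upwards [hAB i, ae_restrict_mem measurableSet_Ioi] with r hr hr0
      -- Here the wedge borders `Γᵢ` from the right, where the boundary value is `B`; by nilpotency
      -- it gives the same product with the weight as `A`.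
      rw [hr.2.2.2]
      exact tendsto_mul_weight hW hα₀ hα hr0 nhdsWithin_le_nhds hr.2.1 m n
    have hb2 : ∀ᵐ r ∂(volume.restrict (Set.Ioi (0 : ℝ))),
        Tendsto (fun θ => (M (polar r θ) * W i (polar r θ)) m n) (𝓝[>] (rayAngle α' i))
          (𝓝 ((M (polar r (rayAngle α' i)) * W i (polar r (rayAngle α' i))) m n)) := by
      filter_upwards [ae_restrict_mem measurableSet_Ioi] with r hr0
      exact tendsto_mul_weight hW hα'₀ hα' hr0 nhdsWithin_le_nhds
        ((hcont r hr0).mono_left nhdsWithin_le_nhds) m n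
    split_ifs with hw
    · rw [neg_one_mul, ← hG.cauchy_formula hsub hρ hw hb2 hb1, neg_sub]
    · rw [← neg_sub, neg_eq_zero]
      rcases lt_or_gt_of_ne h' with h1 | h1
      · rw [← polar_add_two_pi]
        exact hG.cauchy_formula_outside hlt hρ (by linarith) (by linarith) hb2 hb1
      · have h2 : rayAngle α i < φ := lt_of_le_of_ne (not_lt.1 fun h3 => hw ⟨h1, h3⟩) h.symm
        exact hG.cauchy_formula_outside hlt hρ h2 (by linarith) hb2 hb1

-- Moving each density from the old ray to the new one changes the Cauchy representation of `M` by
-- the contribution of the wedge between them.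
open Classical in
theorem IsSolution.deform_apply (hα₀ : 0 < α) (hα : α < b₀) (hα'₀ : 0 < α')
    (hα' : α' < b₀) (hne : α ≠ α') (hW : IsWeight b₀ W) (hM : IsSolution α (weightJump α W) M)
    {ρ φ : ℝ} (hρ : 0 < ρ) (hφ₀ : 0 ≤ φ) (hφ : φ < 2 * Real.pi)
    (h : ∀ i, φ ≠ rayAngle α i) (h' : ∀ i, φ ≠ rayAngle α' i) (m n : Fin 2) :
    deform α' W M (polar ρ φ) m n = M (polar ρ φ) m n - ∑ i, if φ ∈ wedge α α' i then
      raySign i * wedgeSign α α' i * (M (polar ρ φ) * W i (polar ρ φ)) m n else 0 := by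
  have hα2 := hW.lt_half_pi hα
  obtain ⟨A, B, hAB⟩ := hM.exists_boundaryValues hα₀ hα2 hW
  have h1 := hM.sum_cauchyRay hα₀ hα2 hAB m n (polar_notMem_contour hα₀ hα2 hρ hφ₀ hφ h)
  have h2 : ∀ i, raySign i * cauchyRay (rayAngle α' i) (fun r => (M (polar r (rayAngle α' i)) *
        W i (polar r (rayAngle α' i))) m n) (polar ρ φ) =
      raySign i * cauchyRay (rayAngle α i)
        (fun r => (A i r * W i (polar r (rayAngle α i))) m n) (polar ρ φ) -
      2 * Real.pi * Complex.I * (if φ ∈ wedge α α' i then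
        raySign i * wedgeSign α α' i * (M (polar ρ φ) * W i (polar ρ φ)) m n else 0) := by
    intro i
    have h3 := hM.cauchyRay_sub_cauchyRay hα₀ hα hα'₀ hα' hne hW hAB hρ hφ₀ hφ (h i) (h' i) m n
    split_ifs at h3 ⊢ with hw
    · linear_combination -raySign i * h3
    · linear_combination -raySign i * h3
  rw [deform, Matrix.of_apply]
  simp_rw [h2]
  rw [Finset.sum_sub_distrib, h1, ← Finset.mul_sum, ← mul_sub,
    inv_mul_cancel_left₀ Complex.two_pi_I_ne_zero, Matrix.sub_apply]
  ring

theorem IsSolution.deform_eq (hα₀ : 0 < α) (hα : α < b₀) (hα'₀ : 0 < α')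
    (hα' : α' < b₀) (hne : α ≠ α') (hW : IsWeight b₀ W) (hM : IsSolution α (weightJump α W) M)
    {ρ φ : ℝ} (hρ : 0 < ρ) (hφ₀ : 0 ≤ φ) (hφ : φ < 2 * Real.pi)
    (h : ∀ i, φ ≠ rayAngle α i) (h' : ∀ i, φ ≠ rayAngle α' i) (hw : ∀ i, φ ∉ wedge α α' i) :
    deform α' W M (polar ρ φ) = M (polar ρ φ) := by
  ext m n
  rw [hM.deform_apply hα₀ hα hα'₀ hα' hne hW hρ hφ₀ hφ h h']
  simp [hw]

/-- Wedges of different rays are disjoint, so a single correction survives and `M` is multiplied by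
`1 ± W i`, as in the classical deformation. -/
theorem IsSolution.deform_eq_of_mem (hα₀ : 0 < α) (hα : α < b₀) (hα'₀ : 0 < α')
    (hα' : α' < b₀) (hne : α ≠ α') (hW : IsWeight b₀ W) (hM : IsSolution α (weightJump α W) M)
    {ρ φ : ℝ} (hρ : 0 < ρ) {i : Fin 6} (hi : φ ∈ wedge α α' i) :
    deform α' W M (polar ρ φ) = M (polar ρ φ) -
      (raySign i * wedgeSign α α' i) • (M (polar ρ φ) * W i (polar ρ φ)) := by
  have hα2 := hW.lt_half_pi hα
  have hα'2 := hW.lt_half_pi hα'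
  have hlt : ∀ j, i < j → φ < min (rayAngle α j) (rayAngle α' j) := fun j hij =>
    hi.2.trans (max_lt_min_of_lt hα₀ hα2 hα'₀ hα'2 hij)
  have hgt : ∀ j, j < i → max (rayAngle α j) (rayAngle α' j) < φ := fun j hij =>
    (max_lt_min_of_lt hα₀ hα2 hα'₀ hα'2 hij).trans hi.1
  have hsep : ∀ j, j ≠ i → φ ∉ wedge α α' j := by
    intro j hij hj
    rcases lt_or_gt_of_ne hij with h | h
    · exact absurd (hgt j h) (not_lt.2 hj.2.le)
    · exact absurd (hlt j h) (not_lt.2 hj.1.le)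
  have h1 : ∀ j, φ ≠ rayAngle α j ∧ φ ≠ rayAngle α' j := by
    intro j
    rcases lt_trichotomy i j with h | rfl | h
    · exact ⟨((hlt j h).trans_le (min_le_left _ _)).ne, ((hlt j h).trans_le (min_le_right _ _)).ne⟩
    · rcases le_total (rayAngle α i) (rayAngle α' i) with h2 | h2
      · have := hi.1; have h3 := hi.2
        rw [min_eq_left h2] at this
        rw [max_eq_right h2] at h3
        exact ⟨this.ne', h3.ne⟩
      · have := hi.1; have h3 := hi.2
        rw [min_eq_right h2] at this
        rw [max_eq_left h2] at h3
        exact ⟨h3.ne, this.ne'⟩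
    · exact ⟨((le_max_left _ _).trans_lt (hgt j h)).ne', ((le_max_right _ _).trans_lt (hgt j h)).ne'⟩
  ext m n
  rw [hM.deform_apply hα₀ hα hα'₀ hα' hne hW hρ
    ((le_min (rayAngle_nonneg hα₀ hα2 i) (rayAngle_nonneg hα'₀ hα'2 i)).trans hi.1.le)
    (hi.2.trans (max_lt (rayAngle_lt_two_pi hα₀ hα2 i) (rayAngle_lt_two_pi hα'₀ hα'2 i)))
    (fun j => (h1 j).1) (fun j => (h1 j).2), Finset.sum_eq_single i, if_pos hi]
  · simp
  · exact fun j _ hj => if_neg (hsep j hj)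
  · simp

end Deform

/-! ### The deformed function solves the problem on the new contour -/

section DeformSolution

variable {α α' b₀ : ℝ} {W : Fin 6 → ℂ → Matrix (Fin 2) (Fin 2) ℂ}
  {M : ℂ → Matrix (Fin 2) (Fin 2) ℂ}

theorem cauchyRay_zero (θ : ℝ) : cauchyRay θ (fun _ => 0) = fun _ => 0 := by
  funext z
  simp [cauchyRay]

/-- The densities vanish on the two real rays, so `hz` need not exclude these. This gives continuity
across the real half-axes later on. -/
theorem IsSolution.differentiableAt_deform (hα₀ : 0 < α) (hα : α < b₀) (hα'₀ : 0 < α')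
    (hα' : α' < b₀) (hne : α ≠ α') (hW : IsWeight b₀ W) (hM : IsSolution α (weightJump α W) M)
    {z : ℂ} (hz : ∀ i, i ≠ 0 → i ≠ 3 → ∀ r : ℝ, 0 ≤ r → z ≠ polar r (rayAngle α' i))
    (m n : Fin 2) : DifferentiableAt ℂ (fun z => deform α' W M z m n) z := by
  simp only [deform, Matrix.of_apply]
  refine (DifferentiableAt.const_mul (DifferentiableAt.fun_sum fun i _ => ?_) _).const_add _
  refine DifferentiableAt.const_mul ?_ _
  rcases eq_or_ne i 0 with rfl | h0
  · simp [hW.zero, cauchyRay_zero]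
  rcases eq_or_ne i 3 with rfl | h3
  · simp [hW.three, cauchyRay_zero]
  exact differentiableAt_cauchyRay (hM.integrableOn_density hα₀ hα hα'₀ hα' hne hW i m n)
    (hz i h0 h3)

theorem IsSolution.differentiableAt_deform_compl (hα₀ : 0 < α) (hα : α < b₀) (hα'₀ : 0 < α')
    (hα' : α' < b₀) (hne : α ≠ α') (hW : IsWeight b₀ W) (hM : IsSolution α (weightJump α W) M)
    {z : ℂ} (hz : z ∉ contour α') (m n : Fin 2) :
    DifferentiableAt ℂ (fun z => deform α' W M z m n) z :=
  hM.differentiableAt_deform hα₀ hα hα'₀ hα' hne hW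
    (fun i _ _ r hr h => hz ⟨i, r, hr, h⟩) m n

/-- At such angles the function is `M` or `M` times `1 ± W i`, so Hardy bounds on the sectors and on
the wedges suffice. The omitted angles of old rays are recovered by Fatou's lemma in
`IsSolution.memHardyTwo_deform`. -/
theorem IsSolution.lintegral_deform_le (hα₀ : 0 < α) (hα : α < b₀) (hα'₀ : 0 < α')
    (hα' : α' < b₀) (hne : α ≠ α') (hW : IsWeight b₀ W) (hM : IsSolution α (weightJump α W) M)
    (m n : Fin 2) : ∃ C : ℝ≥0∞, C ≠ ∞ ∧ ∀ φ : ℝ, 0 ≤ φ → φ < 2 * Real.pi →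
      (∀ i, φ ≠ rayAngle α i) → (∀ i, φ ≠ rayAngle α' i) →
      ∫⁻ r in Set.Ioi (0 : ℝ), ‖(deform α' W M (polar r φ) - 1) m n‖ₑ ^ 2 ≤ C := by
  have hα2 := hW.lt_half_pi hα
  have h1 : ∀ i, ∃ C : ℝ≥0∞, C ≠ ∞ ∧ ∀ φ ∈ Set.Ioo (rayAngle α i) (nextAngle α i),
      ∫⁻ r in Set.Ioi (0 : ℝ), ‖(M (polar r φ) - 1) m n‖ₑ ^ 2 ≤ C := fun i =>
    ((hM.1 m n).hardySector hα₀ hα2 i).2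
  have h2 : ∀ i, ∃ C : ℝ≥0∞, C ≠ ∞ ∧ ∀ φ ∈ wedge α α' i, ∫⁻ r in Set.Ioi (0 : ℝ),
      ‖(M (polar r φ) - 1) m n + (M (polar r φ) * W i (polar r φ)) m n *
        -(raySign i * wedgeSign α α' i)‖ₑ ^ 2 ≤ C := fun i =>
    ((hM.hardySector_wedge hα₀ hα hα'₀ hα' hW i m n).1.add
      ((hM.hardySector_wedge hα₀ hα hα'₀ hα' hW i m n).2.mul_bounded
        (w := fun _ => -(raySign i * wedgeSign α α' i))
        (fun _ _ _ _ => differentiableAt_const _) (fun _ _ _ _ => le_rfl))).2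
  choose C hC hCb using h1
  choose D hD hDb using h2
  refine ⟨∑ i, C i + ∑ i, D i, ENNReal.add_ne_top.2
    ⟨ENNReal.sum_ne_top.2 fun i _ => hC i, ENNReal.sum_ne_top.2 fun i _ => hD i⟩,
    fun φ hφ₀ hφ h h' => ?_⟩
  by_cases hw : ∃ i, φ ∈ wedge α α' i
  · obtain ⟨i, hi⟩ := hw
    have heq : ∫⁻ r in Set.Ioi (0 : ℝ), ‖(deform α' W M (polar r φ) - 1) m n‖ₑ ^ 2 =
        ∫⁻ r in Set.Ioi (0 : ℝ), ‖(M (polar r φ) - 1) m n +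
          (M (polar r φ) * W i (polar r φ)) m n * -(raySign i * wedgeSign α α' i)‖ₑ ^ 2 := by
      refine setLIntegral_congr_fun measurableSet_Ioi fun r hr => ?_
      rw [hM.deform_eq_of_mem hα₀ hα hα'₀ hα' hne hW hr hi]
      simp only [Matrix.sub_apply, Matrix.smul_apply, smul_eq_mul]
      congr 2
      ring
    rw [heq]
    exact (hDb i φ hi).trans ((Finset.single_le_sum (fun _ _ => zero_le) (Finset.mem_univ i)).trans
      le_add_self)
  · push Not at hw
    have heq : ∫⁻ r in Set.Ioi (0 : ℝ), ‖(deform α' W M (polar r φ) - 1) m n‖ₑ ^ 2 =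
        ∫⁻ r in Set.Ioi (0 : ℝ), ‖(M (polar r φ) - 1) m n‖ₑ ^ 2 := by
      refine setLIntegral_congr_fun measurableSet_Ioi fun r hr => ?_
      rw [hM.deform_eq hα₀ hα hα'₀ hα' hne hW hr hφ₀ hφ h h' hw]
    rw [heq]
    obtain ⟨i, hi⟩ := exists_Ioo_of_ne hφ₀ hφ h
    exact (hCb i φ hi).trans ((Finset.single_le_sum (fun _ _ => zero_le) (Finset.mem_univ i)).trans
      le_self_add)

theorem IsSolution.memHardyTwo_deform (hα₀ : 0 < α) (hα : α < b₀) (hα'₀ : 0 < α')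
    (hα' : α' < b₀) (hne : α ≠ α') (hW : IsWeight b₀ W) (hM : IsSolution α (weightJump α W) M)
    (m n : Fin 2) : MemHardyTwo α' (fun z => (deform α' W M z - 1) m n) := by
  have hα'2 := hW.lt_half_pi hα'
  have hdiff : ∀ z, z ∉ contour α' →
      DifferentiableAt ℂ (fun z => (deform α' W M z - 1) m n) z := fun z hz => by
    simpa only [Matrix.sub_apply] using
      (hM.differentiableAt_deform_compl hα₀ hα hα'₀ hα' hne hW hz m n).sub_const _
  refine ⟨fun z hz => (hdiff z hz).differentiableWithinAt, fun i => ?_⟩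
  obtain ⟨C, hC, hCb⟩ := hM.lintegral_deform_le hα₀ hα hα'₀ hα' hne hW m n
  refine ⟨C.toNNReal, fun θ h1 h2 => ?_⟩
  rw [ENNReal.coe_toNNReal hC]
  have hev : ∀ᶠ φ in 𝓝[>] θ, φ ∈ Set.Ioo (rayAngle α' i) (nextAngle α' i) ∧
      ∀ j, φ ≠ rayAngle α j := by
    refine (eventually_of_mem (Ioo_mem_nhdsGT h2) fun φ hφ => ⟨h1.trans hφ.1, hφ.2⟩).and
      (eventually_all.2 fun j => ?_)
    rcases le_or_gt (rayAngle α j) θ with h | h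
    · filter_upwards [self_mem_nhdsWithin] with φ hφ
      exact (h.trans_lt hφ).ne'
    · filter_upwards [Ioo_mem_nhdsGT h] with φ hφ
      exact hφ.2.ne
  obtain ⟨u, hu⟩ := exists_seq_tendsto (𝓝[>] θ)
  obtain ⟨N, hN⟩ := eventually_atTop.1 (hu.eventually hev)
  have hu' : Tendsto (fun k => u (k + N)) atTop (𝓝 θ) :=
    ((tendsto_add_atTop_iff_nat N).2 hu).mono_right nhdsWithin_le_nhds
  have hmem := fun k => hN (k + N) (Nat.le_add_left _ _)
  have hmeas : ∀ k, AEStronglyMeasurable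
      (fun r => (deform α' W M (polar r (u (k + N))) - 1) m n)
      (volume.restrict (Set.Ioi 0)) := fun k =>
    ContinuousOn.aestronglyMeasurable (fun r hr => (ContinuousAt.comp
      (f := fun r : ℝ => polar r (u (k + N)))
      (hdiff _ (notMem_contour_of_mem_Ioo hα'₀ hα'2 hr (hmem k).1)).continuousAt
      (continuous_polar_left _).continuousAt).continuousWithinAt) measurableSet_Ioi
  refine lintegral_sq_le_of_tendsto (l := atTop) hmeas (.of_forall fun k => ?_) ?_
  · exact hCb _ ((rayAngle_nonneg hα'₀ hα'2 i).trans (hmem k).1.1.le)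
      ((hmem k).1.2.trans_le (nextAngle_le_two_pi hα'₀ hα'2 i)) (hmem k).2
      (ne_rayAngle_of_mem_Ioo hα'₀ hα'2 (hmem k).1)
  · filter_upwards [ae_restrict_mem measurableSet_Ioi] with r hr
    exact (hdiff _ (notMem_contour_of_mem_Ioo hα'₀ hα'2 hr ⟨h1, h2⟩)).continuousAt.tendsto.comp
      (((continuous_polar_right r).tendsto θ).comp hu')

/-- On one side of the ray `F` coincides with a function that is continuous at the point, so the
limit exists without any restriction to a cone. -/
theorem hasNontangentialLimit_left (hα'₀ : 0 < α') (hα' : α' < Real.pi / 2) {i : Fin 6}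
    {r : ℝ} (hr : 0 < r) {F N : ℂ → Matrix (Fin 2) (Fin 2) ℂ}
    (hN : ContinuousAt N (polar r (rayAngle α' i)))
    (hFN : ∀ᶠ θ in 𝓝 (rayAngle α' i), rayAngle α' i < θ →
      ∀ s : ℝ, 0 < s → F (polar s θ) = N (polar s θ)) :
    HasNontangentialLimit α' (leftOf α' i) F (polar r (rayAngle α' i))
      (N (polar r (rayAngle α' i))) := by
  intro c _
  obtain ⟨ε, hε, hgap⟩ := exists_gap hα'₀ hα'
  obtain ⟨η, hη, hη'⟩ := Metric.eventually_nhds_iff.1 hFN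
  refine (hN.tendsto.mono_left nhdsWithin_le_nhds).congr' ?_
  refine eventually_nhdsWithin_iff.2 ?_
  filter_upwards [eventually_polar (φ := rayAngle α' i) hr (lt_min hε hη)] with z hz hzR
  obtain ⟨s, θ, hs, -, hθ, rfl⟩ := hz
  have hθε := abs_lt.1 (hθ.trans_le (min_le_left _ _))
  refine (hη' (by rw [Real.dist_eq]; exact hθ.trans_le (min_le_right _ _)) ?_ s hs).symm
  by_contra hcon
  rcases lt_or_eq_of_le (not_lt.1 hcon) with h | h
  · exact Set.disjoint_left.1 (disjoint_leftOf_rightOf hα'₀ hα' i) hzR.1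
      ((hgap i).2 s θ hs (by linarith) h)
  · exact leftOf_subset_compl hα'₀ hα' i hzR.1 (h ▸ polar_ray_mem_contour i hs.le)

theorem hasNontangentialLimit_right (hα'₀ : 0 < α') (hα' : α' < Real.pi / 2) {i : Fin 6}
    {r : ℝ} (hr : 0 < r) {F N : ℂ → Matrix (Fin 2) (Fin 2) ℂ}
    (hN : ContinuousAt N (polar r (rayAngle α' i)))
    (hFN : ∀ᶠ θ in 𝓝 (rayAngle α' i), θ < rayAngle α' i →
      ∀ s : ℝ, 0 < s → F (polar s θ) = N (polar s θ)) :
    HasNontangentialLimit α' (rightOf α' i) F (polar r (rayAngle α' i))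
      (N (polar r (rayAngle α' i))) := by
  intro c _
  obtain ⟨ε, hε, hgap⟩ := exists_gap hα'₀ hα'
  obtain ⟨η, hη, hη'⟩ := Metric.eventually_nhds_iff.1 hFN
  refine (hN.tendsto.mono_left nhdsWithin_le_nhds).congr' ?_
  refine eventually_nhdsWithin_iff.2 ?_
  filter_upwards [eventually_polar (φ := rayAngle α' i) hr (lt_min hε hη)] with z hz hzR
  obtain ⟨s, θ, hs, -, hθ, rfl⟩ := hz
  have hθε := abs_lt.1 (hθ.trans_le (min_le_left _ _))
  refine (hη' (by rw [Real.dist_eq]; exact hθ.trans_le (min_le_right _ _)) ?_ s hs).symm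
  by_contra hcon
  rcases lt_or_eq_of_le (not_lt.1 hcon) with h | h
  · exact Set.disjoint_left.1 (disjoint_leftOf_rightOf hα'₀ hα' i)
      (polar_mem_leftOf hs ⟨h, by linarith [(hgap i).1]⟩) hzR.1
  · exact rightOf_subset_compl hα'₀ hα' i hzR.1 (h ▸ polar_ray_mem_contour i hs.le)

theorem eventually_generic (hα₀ : 0 < α) (hα : α < Real.pi / 2) (hα'₀ : 0 < α')
    (hα' : α' < Real.pi / 2) (hne : α ≠ α') {i : Fin 6} (h0 : i ≠ 0) (h3 : i ≠ 3) :
    ∀ᶠ θ in 𝓝 (rayAngle α' i), (0 ≤ θ ∧ θ < 2 * Real.pi ∧ (∀ j, θ ≠ rayAngle α j) ∧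
      (∀ j, j ≠ i → θ ≠ rayAngle α' j) ∧ ∀ j, j ≠ i → θ ∉ wedge α α' j) := by
  have hpos : 0 < rayAngle α' i := by
    have := rayAngle_lt_rayAngle hα'₀ hα' hα'₀ hα' (Fin.pos_iff_ne_zero.2 h0)
    rwa [rayAngle_zero] at this
  have hsep : ∀ j, j ≠ i → ∀ᶠ θ in 𝓝 (rayAngle α' i), θ ≠ rayAngle α j ∧ θ ≠ rayAngle α' j ∧
      θ ∉ wedge α α' j := by
    intro j hj
    rcases lt_or_gt_of_ne hj with h | h
    · filter_upwards [lt_mem_nhds ((max_lt_min_of_lt hα₀ hα hα'₀ hα' h).trans_le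
        (min_le_right _ _))] with θ hθ
      exact ⟨((le_max_left _ _).trans_lt hθ).ne', ((le_max_right _ _).trans_lt hθ).ne',
        fun hw => absurd hθ (not_lt.2 hw.2.le)⟩
    · filter_upwards [gt_mem_nhds ((le_max_right _ _).trans_lt
        (max_lt_min_of_lt hα₀ hα hα'₀ hα' h))] with θ hθ
      exact ⟨(hθ.trans_le (min_le_left _ _)).ne, (hθ.trans_le (min_le_right _ _)).ne,
        fun hw => absurd hθ (not_lt.2 hw.1.le)⟩
  have hsep' : ∀ᶠ θ in 𝓝 (rayAngle α' i), ∀ j, j ≠ i → θ ≠ rayAngle α j ∧ θ ≠ rayAngle α' j ∧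
      θ ∉ wedge α α' j := by
    refine eventually_all.2 fun j => ?_
    by_cases hj : j = i
    · exact .of_forall fun _ h => absurd hj h
    · exact (hsep j hj).mono fun _ h _ => h
  have hni : ∀ᶠ θ in 𝓝 (rayAngle α' i), θ ≠ rayAngle α i :=
    eventually_ne_nhds (rayAngle_ne_rayAngle hne h0 h3).symm
  filter_upwards [hsep', hni, lt_mem_nhds hpos, gt_mem_nhds (rayAngle_lt_two_pi hα'₀ hα' i)]
    with θ h1 h2 h4 h5
  refine ⟨h4.le, h5, fun j => ?_, fun j hj => (h1 j hj).2.1, fun j hj => (h1 j hj).2.2⟩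
  by_cases hj : j = i
  · exact hj ▸ h2
  · exact (h1 j hj).1

/-- Since `w * w = 0`, the inverse of `1 - w` is `1 + w`. -/
theorem jump_algebra {P w : Matrix (Fin 2) (Fin 2) ℂ} (hw : w * w = 0) :
    (P - (1 : ℂ) • (P * w)) = P * (1 - w) ∧ P = (P - (-1 : ℂ) • (P * w)) * (1 - w) := by
  refine ⟨by rw [one_smul, mul_sub, mul_one], ?_⟩
  have h : P * w * w = 0 := by rw [mul_assoc, hw, mul_zero]
  rw [neg_one_smul, sub_neg_eq_add, add_mul, mul_sub, mul_sub, mul_one, mul_one, h]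
  abel

/-- A nonreal new ray is off the old contour, so `M` is continuous there. One side of the ray
belongs to the wedge, where `M` acquires the factor `1 ± W i`, and the other does not, which is
exactly the required jump. On the real rays the jump is trivial and the function is continuous. -/
theorem IsSolution.exists_limits_deform (hα₀ : 0 < α) (hα : α < b₀) (hα'₀ : 0 < α')
    (hα' : α' < b₀) (hne : α ≠ α') (hW : IsWeight b₀ W) (hM : IsSolution α (weightJump α W) M)
    (i : Fin 6) {r : ℝ} (hr : 0 < r) : ∃ L R : Matrix (Fin 2) (Fin 2) ℂ,
      HasNontangentialLimit α' (leftOf α' i) (deform α' W M) (polar r (rayAngle α' i)) L ∧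
      HasNontangentialLimit α' (rightOf α' i) (deform α' W M) (polar r (rayAngle α' i)) R ∧
      (raySign i = -1 → L = R * weightJump α' W i r) ∧
      (raySign i = 1 → R = L * weightJump α' W i r) := by
  have hα2 := hW.lt_half_pi hα
  have hα'2 := hW.lt_half_pi hα'
  set ζ := polar r (rayAngle α' i) with hζ
  by_cases h03 : i = 0 ∨ i = 3
  · have hcont : ContinuousAt (deform α' W M) ζ := by
      refine continuousAt_pi.2 fun m => continuousAt_pi.2 fun n =>
        (hM.differentiableAt_deform hα₀ hα hα'₀ hα' hne hW (fun j h0 h3 s hs h => ?_)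
          m n).continuousAt
      have h1 := (polar_injective hr hs h (abs_lt.2
        ⟨by linarith [rayAngle_nonneg hα'₀ hα'2 i, rayAngle_lt_two_pi hα'₀ hα'2 j],
          by linarith [rayAngle_nonneg hα'₀ hα'2 j, rayAngle_lt_two_pi hα'₀ hα'2 i]⟩)).2
      rcases lt_trichotomy i j with h2 | h2 | h2
      · exact absurd h1 (rayAngle_lt_rayAngle hα'₀ hα'2 hα'₀ hα'2 h2).ne
      · rcases h03 with h4 | h4
        · exact h0 (h2 ▸ h4)
        · exact h3 (h2 ▸ h4)
      · exact absurd h1 (rayAngle_lt_rayAngle hα'₀ hα'2 hα'₀ hα'2 h2).ne'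
    have hj : weightJump α' W i r = 1 := by
      rcases h03 with rfl | rfl
      · simp [weightJump, hW.zero]
      · simp [weightJump, hW.three]
    exact ⟨_, _, hasNontangentialLimit_left hα'₀ hα'2 hr hcont (.of_forall fun _ _ _ _ => rfl),
      hasNontangentialLimit_right hα'₀ hα'2 hr hcont (.of_forall fun _ _ _ _ => rfl),
      by simp [hj], by simp [hj]⟩
  · obtain ⟨h0, h3⟩ := not_or.1 h03
    have hgen := eventually_generic hα₀ hα2 hα'₀ hα'2 hne h0 h3
    have hcM : ContinuousAt M ζ := hM.continuousAt (polar_notMem_contour hα₀ hα2 hr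
      (rayAngle_nonneg hα'₀ hα'2 i) (rayAngle_lt_two_pi hα'₀ hα'2 i) hgen.self_of_nhds.2.2.1)
    have hcW : ContinuousAt (W i) ζ := hW.continuousAt hα'₀ hα' hr
    have hcN : ∀ c : ℂ, ContinuousAt (fun z => M z - c • (M z * W i z)) ζ := fun c =>
      hcM.sub ((hcM.mul hcW).const_smul c)
    have hout : ∀ᶠ θ in 𝓝 (rayAngle α' i), θ ≠ rayAngle α' i → θ ∉ wedge α α' i →
        ∀ s : ℝ, 0 < s → deform α' W M (polar s θ) = M (polar s θ) := by
      filter_upwards [hgen] with θ ⟨g0, g1, g2, g3, g4⟩ hθ hw s hs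
      refine hM.deform_eq hα₀ hα hα'₀ hα' hne hW hs g0 g1 g2 (fun j => ?_) fun j => ?_
      · by_cases hj : j = i
        · exact hj ▸ hθ
        · exact g3 j hj
      · by_cases hj : j = i
        · exact hj ▸ hw
        · exact g4 j hj
    have halg := jump_algebra (P := M ζ) (hW.nilpotent i ζ)
    rcases lt_or_gt_of_ne (rayAngle_ne_rayAngle hne h0 h3) with hlt | hlt
    · refine ⟨M ζ, M ζ - raySign i • (M ζ * W i ζ), ?_, ?_, ?_, ?_⟩
      · refine hasNontangentialLimit_left hα'₀ hα'2 hr hcM ?_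
        filter_upwards [hout] with θ hθ h
        exact hθ h.ne' fun hw => absurd hw.2 (not_lt.2 (by rw [max_eq_right hlt.le]; exact h.le))
      · refine hasNontangentialLimit_right hα'₀ hα'2 hr (hcN (raySign i)) ?_
        filter_upwards [lt_mem_nhds hlt] with θ h1 h2 s hs
        rw [hM.deform_eq_of_mem hα₀ hα hα'₀ hα' hne hW hs (i := i)
          ⟨by rwa [min_eq_left hlt.le], by rwa [max_eq_right hlt.le]⟩, wedgeSign, if_pos hlt,
          mul_one]
      · intro hs
        rw [hs, weightJump]
        exact halg.2
      · intro hs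
        rw [hs, weightJump]
        exact halg.1
    · refine ⟨M ζ - (-raySign i) • (M ζ * W i ζ), M ζ, ?_, ?_, ?_, ?_⟩
      · refine hasNontangentialLimit_left hα'₀ hα'2 hr (hcN (-raySign i)) ?_
        filter_upwards [gt_mem_nhds hlt] with θ h1 h2 s hs
        rw [hM.deform_eq_of_mem hα₀ hα hα'₀ hα' hne hW hs (i := i)
          ⟨by rwa [min_eq_right hlt.le], by rwa [max_eq_left hlt.le]⟩, wedgeSign,
          if_neg (not_lt.2 hlt.le), mul_neg_one]
      · refine hasNontangentialLimit_right hα'₀ hα'2 hr hcM ?_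
        filter_upwards [hout] with θ hθ h
        exact hθ h.ne fun hw => absurd hw.1 (not_lt.2 (by rw [min_eq_right hlt.le]; exact h.le))
      · intro hs
        rw [hs, weightJump, neg_neg]
        exact halg.1
      · intro hs
        rw [hs, weightJump]
        exact halg.2

/-- A solution on one contour yields a solution on every other contour. -/
theorem IsSolution.deform (hα₀ : 0 < α) (hα : α < b₀) (hα'₀ : 0 < α')
    (hα' : α' < b₀) (hne : α ≠ α') (hW : IsWeight b₀ W) (hM : IsSolution α (weightJump α W) M) :
    IsSolution α' (weightJump α' W) (deform α' W M) := by
  refine ⟨hM.memHardyTwo_deform hα₀ hα hα'₀ hα' hne hW, fun i => ?_⟩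
  filter_upwards [ae_restrict_mem measurableSet_Ioi] with r hr
  obtain ⟨L, R, hL, hR, hout, hin⟩ := hM.exists_limits_deform hα₀ hα hα'₀ hα' hne hW i hr
  have h1 : leftOf α' i = plusSide α' → rightOf α' i = minusSide α' → raySign i = -1 →
      ∃ P Q, HasNontangentialLimit α' (plusSide α') (ModelRHP.deform α' W M)
          (polar r (rayAngle α' i)) P ∧
        HasNontangentialLimit α' (minusSide α') (ModelRHP.deform α' W M)
          (polar r (rayAngle α' i)) Q ∧ P = Q * weightJump α' W i r :=
    fun a1 a2 a3 => ⟨L, R, a1 ▸ hL, a2 ▸ hR, hout a3⟩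
  have h2 : leftOf α' i = minusSide α' → rightOf α' i = plusSide α' → raySign i = 1 →
      ∃ P Q, HasNontangentialLimit α' (plusSide α') (ModelRHP.deform α' W M)
          (polar r (rayAngle α' i)) P ∧
        HasNontangentialLimit α' (minusSide α') (ModelRHP.deform α' W M)
          (polar r (rayAngle α' i)) Q ∧ P = Q * weightJump α' W i r :=
    fun a1 a2 a3 => ⟨R, L, a2 ▸ hR, a1 ▸ hL, hin a3⟩
  fin_cases i
  exacts [h1 rfl rfl rfl, h2 rfl rfl rfl, h1 rfl rfl rfl, h2 rfl rfl rfl, h1 rfl rfl rfl,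
    h2 rfl rfl rfl]

theorem pi_div_two_ne_rayAngle (hα₀ : 0 < α) (hα : α < Real.pi / 2) (i : Fin 6) :
    Real.pi / 2 ≠ rayAngle α i := by
  have hpi := Real.pi_pos
  fin_cases i <;> simp [rayAngle] <;> intro h <;> linarith

/-- The solutions on different contours agree on the imaginary half-axis. -/
theorem IsSolution.exists_change_opening (hα₀ : 0 < α) (hα : α < b₀) (hα'₀ : 0 < α')
    (hα' : α' < b₀) (hW : IsWeight b₀ W) (hM : IsSolution α (weightJump α W) M) :
    ∃ N, IsSolution α' (weightJump α' W) N ∧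
      ∀ r : ℝ, 0 < r → N (polar r (Real.pi / 2)) = M (polar r (Real.pi / 2)) := by
  rcases eq_or_ne α α' with rfl | hne
  · exact ⟨M, hM, fun _ _ => rfl⟩
  · have hpi := Real.pi_pos
    refine ⟨_, hM.deform hα₀ hα hα'₀ hα' hne hW, fun r hr => hM.deform_eq hα₀ hα hα'₀ hα' hne hW hr
      (by linarith) (by linarith) (pi_div_two_ne_rayAngle hα₀ (hW.lt_half_pi hα))
      (pi_div_two_ne_rayAngle hα'₀ (hW.lt_half_pi hα')) fun i hi => ?_⟩
    -- An angle of a wedge belongs to a contour with opening below π/2, and no such contour contains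
    -- the imaginary half-axis.
    obtain ⟨β, h1, h2, h3⟩ := exists_eq_of_mem_wedge hi
    exact pi_div_two_ne_rayAngle ((lt_min hα₀ hα'₀).trans_le h1)
      (hW.lt_half_pi (h2.trans_lt (max_lt hα hα'))) i h3

end DeformSolution

/-! ### Symmetries of Riemann-Hilbert problems -/

section HardyOperations

variable {α : ℝ} {F : ℂ → ℂ}

theorem MemHardyTwo.const_mul (hF : MemHardyTwo α F) (c : ℂ) :
    MemHardyTwo α (fun z => c * F z) := by
  refine ⟨hF.1.const_mul c, fun i => ?_⟩
  obtain ⟨C, hC⟩ := hF.2 i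
  refine ⟨‖c‖₊ ^ 2 * C, fun θ h1 h2 => ?_⟩
  simp only [enorm_mul, mul_pow]
  rw [lintegral_const_mul' _ _ (ENNReal.pow_ne_top enorm_ne_top), ENNReal.coe_mul, ENNReal.coe_pow]
  exact mul_le_mul_right (hC θ h1 h2) _

theorem memHardyTwo_zero : MemHardyTwo α (fun _ => 0) :=
  ⟨differentiableOn_const _, fun _ => ⟨0, fun _ _ _ => by simp⟩⟩

end HardyOperations

/-! ### Transport of limits and of unique solvability -/

section Transfer

variable {α κ : ℝ} {φ : ℂ → ℂ}

/-- Scaling the distances between points and the distances to the contour by the same factor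
preserves the approach regions. This serves dilations and, with `κ = 1`, reflection. -/
theorem HasNontangentialLimit.comp_similarity (hκ : 0 < κ) (hφ : Continuous φ)
    (hd : ∀ z w, ‖φ z - φ w‖ = κ * ‖z - w‖)
    (hinf : ∀ z, Metric.infDist (φ z) (contour α) = κ * Metric.infDist z (contour α))
    {R R' : Set ℂ} (hR : Set.MapsTo φ R R') {F : ℂ → Matrix (Fin 2) (Fin 2) ℂ} {ζ : ℂ}
    {L : Matrix (Fin 2) (Fin 2) ℂ} (h : HasNontangentialLimit α R' F (φ ζ) L) :
    HasNontangentialLimit α R (fun z => F (φ z)) ζ L := by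
  intro c hc
  refine (h c hc).comp (tendsto_nhdsWithin_of_tendsto_nhds_of_eventually_within _
    (hφ.continuousAt.tendsto.mono_left nhdsWithin_le_nhds) ?_)
  filter_upwards [self_mem_nhdsWithin] with z ⟨h1, h2⟩
  refine ⟨hR h1, ?_⟩
  rw [hd, hinf]
  nlinarith

theorem HasNontangentialLimit.map {R : Set ℂ} {F : ℂ → Matrix (Fin 2) (Fin 2) ℂ} {ζ : ℂ}
    {L : Matrix (Fin 2) (Fin 2) ℂ} (h : HasNontangentialLimit α R F ζ L)
    {f : Matrix (Fin 2) (Fin 2) ℂ → Matrix (Fin 2) (Fin 2) ℂ} (hf : Continuous f) :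
    HasNontangentialLimit α R (fun z => f (F z)) ζ (f L) := fun c hc =>
  (hf.tendsto L).comp (h c hc)

theorem tendsto_cobounded_nontangential (hκ : 0 < κ) (hn : ∀ z, ‖φ z‖ = κ * ‖z‖)
    (hinf : ∀ z, Metric.infDist (φ z) (contour α) = κ * Metric.infDist z (contour α)) (c : ℝ) :
    Tendsto φ (Bornology.cobounded ℂ ⊓ 𝓟 {z | c * ‖z‖ ≤ Metric.infDist z (contour α)})
      (Bornology.cobounded ℂ ⊓ 𝓟 {z | c * ‖z‖ ≤ Metric.infDist z (contour α)}) := by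
  refine tendsto_inf.2 ⟨(tendsto_norm_atTop_iff_cobounded.1 ?_).mono_left inf_le_left,
    tendsto_principal.2 (mem_inf_of_right fun z hz => ?_)⟩
  · simp only [hn]
    exact tendsto_norm_cobounded_atTop.const_mul_atTop hκ
  · show c * ‖φ z‖ ≤ _
    rw [hn, hinf]
    have : c * ‖z‖ ≤ Metric.infDist z (contour α) := hz
    nlinarith

/-- Unique solvability is preserved by an invertible correspondence of solutions. -/
theorem IsUniquelySolvable.transfer {j j' : Fin 6 → ℝ → Matrix (Fin 2) (Fin 2) ℂ}
    {T T' : (ℂ → Matrix (Fin 2) (Fin 2) ℂ) → ℂ → Matrix (Fin 2) (Fin 2) ℂ}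
    (hT : ∀ M, IsSolution α j M → IsSolution α j' (T M))
    (hT' : ∀ M, IsSolution α j' M → IsSolution α j (T' M))
    (hcongr : ∀ M N, Set.EqOn M N (contour α)ᶜ → Set.EqOn (T M) (T N) (contour α)ᶜ)
    (hinv : ∀ M, T (T' M) = M) (h : IsUniquelySolvable α j) : IsUniquelySolvable α j' := by
  refine ⟨let ⟨M, hM⟩ := h.1; ⟨T M, hT M hM⟩, fun M N hM hN => ?_⟩
  have := hcongr _ _ (h.2 _ _ (hT' M hM) (hT' N hN))
  rwa [hinv, hinv] at this

end Transfer

/-! ### Dilations -/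

section Scaling

open scoped Pointwise

variable {α κ : ℝ}

theorem polar_mul (κ r θ : ℝ) : polar (κ * r) θ = κ * polar r θ := by
  simp [polar, mul_assoc]

theorem mul_mem_sector (hκ : 0 < κ) {i : Fin 6} {z : ℂ} (hz : z ∈ sector α i) :
    (κ : ℂ) * z ∈ sector α i := by
  obtain ⟨r, θ, hr, h1, h2, rfl⟩ := hz
  exact ⟨κ * r, θ, by positivity, h1, h2, (polar_mul _ _ _).symm⟩

theorem mul_mem_plusSide (hκ : 0 < κ) : Set.MapsTo (fun z : ℂ => κ * z) (plusSide α) (plusSide α) :=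
  fun _ hz => hz.imp (Or.imp (mul_mem_sector hκ) (mul_mem_sector hκ)) (mul_mem_sector hκ)

theorem mul_mem_minusSide (hκ : 0 < κ) :
    Set.MapsTo (fun z : ℂ => κ * z) (minusSide α) (minusSide α) :=
  fun _ hz => hz.imp (Or.imp (mul_mem_sector hκ) (mul_mem_sector hκ)) (mul_mem_sector hκ)

theorem mul_mem_contour_iff (hκ : 0 < κ) {z : ℂ} : (κ : ℂ) * z ∈ contour α ↔ z ∈ contour α := by
  have hκ' : (κ : ℂ) ≠ 0 := by exact_mod_cast hκ.ne'
  constructor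
  · rintro ⟨i, r, hr, h⟩
    refine ⟨i, κ⁻¹ * r, by positivity, ?_⟩
    rw [polar_mul, ← h, Complex.ofReal_inv, inv_mul_cancel_left₀ hκ']
  · rintro ⟨i, r, hr, rfl⟩
    exact ⟨i, κ * r, by positivity, (polar_mul _ _ _).symm⟩

theorem infDist_mul_contour (hκ : 0 < κ) (z : ℂ) :
    Metric.infDist ((κ : ℂ) * z) (contour α) = κ * Metric.infDist z (contour α) := by
  have hκ' : (κ : ℂ) ≠ 0 := by exact_mod_cast hκ.ne'
  have h := infDist_smul₀ hκ' (contour α) z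
  have hset : (κ : ℂ) • contour α = contour α := by
    ext w
    rw [Set.mem_smul_set_iff_inv_smul_mem₀ hκ', ← mul_mem_contour_iff hκ, smul_eq_mul,
      mul_inv_cancel_left₀ hκ']
  rwa [hset, smul_eq_mul, Complex.norm_real, Real.norm_of_nonneg hκ.le] at h

theorem map_mul_restrict_Ioi (hκ : 0 < κ) :
    (volume.restrict (Set.Ioi (0 : ℝ))).map (κ * ·) =
      ENNReal.ofReal κ⁻¹ • volume.restrict (Set.Ioi (0 : ℝ)) := by
  have hemb : MeasurableEmbedding (κ * · : ℝ → ℝ) :=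
    (Homeomorph.mulLeft₀ κ hκ.ne').measurableEmbedding
  have h := hemb.restrict_map volume (Set.Ioi 0)
  rw [Real.map_volume_mul_left hκ.ne', abs_of_pos (inv_pos.2 hκ), Measure.restrict_smul] at h
  rw [h]
  congr 2
  ext r
  simp [hκ]

theorem lintegral_comp_mul_Ioi (hκ : 0 < κ) (f : ℝ → ℝ≥0∞) :
    ∫⁻ r in Set.Ioi (0 : ℝ), f (κ * r) =
      ENNReal.ofReal κ⁻¹ * ∫⁻ r in Set.Ioi (0 : ℝ), f r := by
  have hemb : MeasurableEmbedding (κ * · : ℝ → ℝ) :=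
    (Homeomorph.mulLeft₀ κ hκ.ne').measurableEmbedding
  rw [← hemb.lintegral_map, map_mul_restrict_Ioi hκ, lintegral_smul_measure, smul_eq_mul]

theorem ae_comp_mul_Ioi (hκ : 0 < κ) {P : ℝ → Prop}
    (h : ∀ᵐ r ∂(volume.restrict (Set.Ioi (0 : ℝ))), P r) :
    ∀ᵐ r ∂(volume.restrict (Set.Ioi (0 : ℝ))), P (κ * r) := by
  have hemb : MeasurableEmbedding (κ * · : ℝ → ℝ) :=
    (Homeomorph.mulLeft₀ κ hκ.ne').measurableEmbedding
  refine (hemb.ae_map_iff (p := P)).1 ?_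
  rw [map_mul_restrict_Ioi hκ]
  exact Measure.ae_smul_measure h _

theorem MemHardyTwo.comp_mul (hκ : 0 < κ) {F : ℂ → ℂ} (hF : MemHardyTwo α F) :
    MemHardyTwo α (fun z => F (κ * z)) := by
  refine ⟨hF.1.comp ((differentiable_id.const_mul (κ : ℂ)).differentiableOn) fun z hz h =>
    hz ((mul_mem_contour_iff hκ).1 h), fun i => ?_⟩
  obtain ⟨C, hC⟩ := hF.2 i
  refine ⟨Real.toNNReal κ⁻¹ * C, fun θ h1 h2 => ?_⟩
  simp only [← polar_mul]
  rw [lintegral_comp_mul_Ioi hκ fun r => ‖F (polar r θ)‖ₑ ^ 2, ENNReal.coe_mul]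
  exact mul_le_mul_right (hC θ h1 h2) _

variable {j : Fin 6 → ℝ → Matrix (Fin 2) (Fin 2) ℂ} {M : ℂ → Matrix (Fin 2) (Fin 2) ℂ}

theorem IsSolution.comp_mul (hκ : 0 < κ) (hM : IsSolution α j M) :
    IsSolution α (fun i r => j i (κ * r)) (fun z => M (κ * z)) := by
  refine ⟨fun m n => (hM.1 m n).comp_mul hκ, fun i => ?_⟩
  have hd : ∀ z w : ℂ, ‖(κ : ℂ) * z - κ * w‖ = κ * ‖z - w‖ := fun z w => by
    rw [← mul_sub, norm_mul, Complex.norm_real, Real.norm_of_nonneg hκ.le]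
  filter_upwards [ae_comp_mul_Ioi hκ (hM.2 i)] with r ⟨P, Q, hP, hQ, hPQ⟩
  rw [polar_mul] at hP hQ
  exact ⟨P, Q, hP.comp_similarity hκ (continuous_const_mul _) hd (infDist_mul_contour hκ)
      (mul_mem_plusSide hκ),
    hQ.comp_similarity hκ (continuous_const_mul _) hd (infDist_mul_contour hκ)
      (mul_mem_minusSide hκ), hPQ⟩

theorem IsUniquelySolvable.comp_mul (hκ : 0 < κ) (h : IsUniquelySolvable α j) :
    IsUniquelySolvable α (fun i r => j i (κ * r)) := by
  have hκ' : (κ : ℂ) ≠ 0 := by exact_mod_cast hκ.ne'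
  refine h.transfer (T := fun M z => M (κ * z)) (T' := fun M z => M ((κ⁻¹ : ℝ) * z))
    (fun M hM => hM.comp_mul hκ) (fun M hM => ?_)
    (fun M N hMN z hz => hMN fun h => hz ((mul_mem_contour_iff hκ).1 h)) fun M => ?_
  · simpa only [mul_inv_cancel_left₀ hκ.ne'] using hM.comp_mul (inv_pos.2 hκ)
  · funext z
    simp [hκ']

theorem HasPotentials.comp_mul (hκ : 0 < κ) {u v : ℂ} (h : HasPotentials α M u v) :
    HasPotentials α (fun z => M (κ * z)) ((κ : ℂ)⁻¹ * u) ((κ : ℂ)⁻¹ * v) := by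
  have hκ' : (κ : ℂ) ≠ 0 := by exact_mod_cast hκ.ne'
  have hn : ∀ z : ℂ, ‖(κ : ℂ) * z‖ = κ * ‖z‖ := fun z => by
    rw [norm_mul, Complex.norm_real, Real.norm_of_nonneg hκ.le]
  intro c hc
  have ht := tendsto_cobounded_nontangential hκ hn (infDist_mul_contour (α := α) hκ) c
  have key : ∀ z x : ℂ, z * x = (κ : ℂ)⁻¹ * ((κ * z) * x) := fun z x => by
    rw [mul_assoc, inv_mul_cancel_left₀ hκ']
  constructor
  · exact (((h c hc).1.comp ht).const_mul (κ : ℂ)⁻¹).congr fun z => (key _ _).symm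
  · exact (((h c hc).2.comp ht).const_mul (κ : ℂ)⁻¹).congr fun z => (key _ _).symm

end Scaling

/-! ### Conjugation by diagonal matrices -/

section DiagonalConjugation

variable {α : ℝ} {j : Fin 6 → ℝ → Matrix (Fin 2) (Fin 2) ℂ} {M : ℂ → Matrix (Fin 2) (Fin 2) ℂ}

/-- Conjugation of `A` by the diagonal matrix with entries `d` and `1`. -/
noncomputable def diagConj (d : ℂ) (A : Matrix (Fin 2) (Fin 2) ℂ) : Matrix (Fin 2) (Fin 2) ℂ :=
  !![A 0 0, d * A 0 1; d⁻¹ * A 1 0, A 1 1]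

theorem diagConj_mul {d : ℂ} (hd : d ≠ 0) (A B : Matrix (Fin 2) (Fin 2) ℂ) :
    diagConj d (A * B) = diagConj d A * diagConj d B := by
  ext m n
  fin_cases m <;> fin_cases n <;> simp [diagConj, Matrix.mul_apply, Fin.sum_univ_two] <;>
    field_simp

theorem continuous_diagConj (d : ℂ) : Continuous (diagConj d) := by
  refine continuous_matrix fun m n => ?_
  fin_cases m <;> fin_cases n <;> simp [diagConj] <;> fun_prop

theorem IsSolution.diagConj {d : ℂ} (hd : d ≠ 0) (hM : IsSolution α j M) :
    IsSolution α (fun i r => diagConj d (j i r)) (fun z => diagConj d (M z)) := by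
  refine ⟨fun m n => ?_, fun i => ?_⟩
  · have h00 := hM.1 0 0
    have h01 := (hM.1 0 1).const_mul d
    have h10 := (hM.1 1 0).const_mul d⁻¹
    have h11 := hM.1 1 1
    fin_cases m <;> fin_cases n <;> simp [ModelRHP.diagConj] at h00 h01 h10 h11 ⊢ <;> assumption
  · filter_upwards [hM.2 i] with r ⟨P, Q, hP, hQ, hPQ⟩
    exact ⟨_, _, hP.map (continuous_diagConj d), hQ.map (continuous_diagConj d), by
      rw [hPQ, diagConj_mul hd]⟩

end DiagonalConjugation

/-! ### Jumps with a trivial row -/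

section Triangular

variable {α : ℝ} {j : Fin 6 → ℝ → Matrix (Fin 2) (Fin 2) ℂ} {M : ℂ → Matrix (Fin 2) (Fin 2) ℂ}

/-- If a row of the jump matrix is that of the identity, then so is that row of the solution. -/
theorem IsUniquelySolvable.row_eq (h : IsUniquelySolvable α j) (hM : IsSolution α j M)
    {m : Fin 2} (hj : ∀ i r, 0 < r → j i r m = (1 : Matrix (Fin 2) (Fin 2) ℂ) m) {z : ℂ}
    (hz : z ∉ contour α) : M z m = (1 : Matrix (Fin 2) (Fin 2) ℂ) m := by
  -- Right multiplication by the jump does not mix the rows of a solution, so one row may be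
  -- replaced by that of the identity. Uniqueness then identifies the two solutions.
  have hN : IsSolution α j (fun z => (M z).updateRow m ((1 : Matrix (Fin 2) (Fin 2) ℂ) m)) := by
    refine ⟨fun k n => ?_, fun i => ?_⟩
    · rcases eq_or_ne k m with rfl | hk
      · simpa [Matrix.sub_apply] using memHardyTwo_zero
      · simpa [Matrix.sub_apply, hk] using hM.1 k n
    · filter_upwards [hM.2 i, ae_restrict_mem measurableSet_Ioi] with r ⟨P, Q, hP, hQ, hPQ⟩ hr
      have hcont : Continuous fun A : Matrix (Fin 2) (Fin 2) ℂ =>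
          A.updateRow m ((1 : Matrix (Fin 2) (Fin 2) ℂ) m) :=
        continuous_id.matrix_updateRow m continuous_const
      refine ⟨_, _, hP.map hcont, hQ.map hcont, ?_⟩
      ext k n
      rcases eq_or_ne k m with rfl | hk
      · simp [Matrix.mul_apply, Matrix.one_apply, hj i r hr]
      · simp [Matrix.mul_apply, hk, hPQ]
  have := congrFun (h.2 _ _ hM hN hz) m
  simpa using this

end Triangular

/-! ### Reflection in the real axis -/

section Reflection

variable {α : ℝ}

/-- The index of the mirror image of `Γᵢ`. -/
def mirror : Fin 6 → Fin 6 := ![0, 5, 4, 3, 2, 1]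

theorem conj_polar (r θ : ℝ) : conj (polar r θ) = polar r (2 * Real.pi - θ) := by
  have h : polar r (2 * Real.pi - θ) = polar r (-θ) := by
    rw [sub_eq_neg_add, polar_add_two_pi]
  rw [h]
  simp [polar, ← Complex.exp_conj]

theorem rayAngle_mirror {i : Fin 6} (hi : i ≠ 0) :
    rayAngle α (mirror i) = 2 * Real.pi - rayAngle α i := by
  fin_cases i <;> simp [mirror, rayAngle] at hi ⊢ <;> ring

theorem conj_polar_rayAngle (r : ℝ) (i : Fin 6) :
    conj (polar r (rayAngle α i)) = polar r (rayAngle α (mirror i)) := by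
  rw [conj_polar]
  rcases eq_or_ne i 0 with rfl | hi
  · simpa [mirror, rayAngle] using polar_add_two_pi r 0
  · rw [rayAngle_mirror hi]

/-- A sector is indexed by the ray at which it starts, and reflection exchanges start and end. Its
index therefore becomes `5 - i`, while that of a ray becomes `-i`. -/
theorem rayAngle_rev (i : Fin 6) : rayAngle α i.rev = 2 * Real.pi - nextAngle α i := by
  fin_cases i <;> simp [rayAngle, nextAngle, Fin.rev] <;> ring

theorem nextAngle_rev (i : Fin 6) : nextAngle α i.rev = 2 * Real.pi - rayAngle α i := by
  fin_cases i <;> simp [rayAngle, nextAngle, Fin.rev] <;> ring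

theorem conj_mem_sector {i : Fin 6} {z : ℂ} (hz : z ∈ sector α i) :
    conj z ∈ sector α i.rev := by
  obtain ⟨r, θ, hr, h1, h2, rfl⟩ := hz
  refine ⟨r, 2 * Real.pi - θ, hr, ?_, ?_, conj_polar r θ⟩
  · rw [rayAngle_rev]; linarith
  · rw [nextAngle_rev]; linarith

theorem conj_mem_minusSide : Set.MapsTo (fun z : ℂ => conj z) (plusSide α) (minusSide α) := by
  rintro z ((hz | hz) | hz)
  · exact Or.inr (conj_mem_sector hz)
  · exact Or.inl (Or.inr (conj_mem_sector hz))
  · exact Or.inl (Or.inl (conj_mem_sector hz))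

theorem conj_mem_plusSide : Set.MapsTo (fun z : ℂ => conj z) (minusSide α) (plusSide α) := by
  rintro z ((hz | hz) | hz)
  · exact Or.inr (conj_mem_sector hz)
  · exact Or.inl (Or.inr (conj_mem_sector hz))
  · exact Or.inl (Or.inl (conj_mem_sector hz))

theorem conj_mem_contour {z : ℂ} (hz : z ∈ contour α) : conj z ∈ contour α := by
  obtain ⟨i, r, hr, rfl⟩ := hz
  exact ⟨mirror i, r, hr, conj_polar_rayAngle r i⟩

theorem conj_mem_contour_iff {z : ℂ} : conj z ∈ contour α ↔ z ∈ contour α :=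
  ⟨fun h => by simpa using conj_mem_contour h, conj_mem_contour⟩

theorem infDist_conj_contour (z : ℂ) :
    Metric.infDist (conj z) (contour α) = 1 * Metric.infDist z (contour α) := by
  have h := Metric.infDist_image (t := contour α) (x := z) Complex.isometry_conj
  have hset : (conj : ℂ → ℂ) '' contour α = contour α := by
    ext w
    exact ⟨by rintro ⟨z, hz, rfl⟩; exact conj_mem_contour hz,
      fun hw => ⟨conj w, conj_mem_contour hw, Complex.conj_conj w⟩⟩
  rwa [hset, ← one_mul (Metric.infDist z _)] at h

theorem MemHardyTwo.conj_conj {F : ℂ → ℂ} (hF : MemHardyTwo α F) :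
    MemHardyTwo α (fun z => conj (F (conj z))) := by
  refine ⟨fun z hz => ?_, fun i => ?_⟩
  · have hz' : conj z ∉ contour α := fun h => hz (conj_mem_contour_iff.1 h)
    have h := (hF.1.differentiableAt
      ((isClosed_contour).isOpen_compl.mem_nhds hz')).conj_conj
    rw [Complex.conj_conj] at h
    exact h.differentiableWithinAt
  · obtain ⟨C, hC⟩ := hF.2 i.rev
    refine ⟨C, fun θ h1 h2 => ?_⟩
    have h := hC (2 * Real.pi - θ) (by rw [rayAngle_rev]; linarith)
      (by rw [nextAngle_rev]; linarith)
    refine le_of_eq_of_le ?_ h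
    refine lintegral_congr fun r => ?_
    simp only [conj_polar, RCLike.enorm_conj]

/-- The inverse of the adjoint of a matrix with determinant one. -/
noncomputable def starAdj (A : Matrix (Fin 2) (Fin 2) ℂ) : Matrix (Fin 2) (Fin 2) ℂ :=
  !![conj (A 1 1), -conj (A 1 0); -conj (A 0 1), conj (A 0 0)]

theorem starAdj_starAdj (A : Matrix (Fin 2) (Fin 2) ℂ) : starAdj (starAdj A) = A := by
  ext m n
  fin_cases m <;> fin_cases n <;> simp [starAdj]

/-- `starAdj` is the adjugate of the adjoint, hence multiplicative, and for determinant one it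
inverts the adjoint of `J`. Neither `P` nor `Q` has to be invertible, so nothing about the
determinant of a solution is needed. -/
theorem starAdj_eq_mul {P Q J : Matrix (Fin 2) (Fin 2) ℂ} (hJ : J.det = 1) (h : P = Q * J) :
    starAdj Q = starAdj P * J.conjTranspose := by
  rw [Matrix.det_fin_two] at hJ
  have hJ' := congrArg (starRingEnd ℂ) hJ
  simp only [map_sub, map_mul, map_one] at hJ'
  subst h
  ext m n
  fin_cases m <;> fin_cases n <;>
    simp [starAdj, Matrix.mul_apply, Fin.sum_univ_two, Matrix.conjTranspose_apply]
  · linear_combination (-conj (Q 1 1)) * hJ'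
  · linear_combination (conj (Q 1 0)) * hJ'
  · linear_combination (conj (Q 0 1)) * hJ'
  · linear_combination (-conj (Q 0 0)) * hJ'

theorem continuous_starAdj : Continuous starAdj := by
  refine continuous_matrix fun m n => ?_
  fin_cases m <;> fin_cases n <;> simp [starAdj] <;> fun_prop

variable {j : Fin 6 → ℝ → Matrix (Fin 2) (Fin 2) ℂ} {M : ℂ → Matrix (Fin 2) (Fin 2) ℂ}

/-- Reflection exchanges the sides of the contour, and `starAdj` moves the jump to the other side of
the relation. The two reversals cancel and leave a relation of the original form with the adjoint
jump. -/
theorem IsSolution.mirror (hj : ∀ i r, (j i r).det = 1) (hM : IsSolution α j M) :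
    IsSolution α (fun i r => (j (mirror i) r).conjTranspose)
      (fun z => starAdj (M (conj z))) := by
  refine ⟨fun m n => ?_, fun i => ?_⟩
  · have h00 := (hM.1 0 0).conj_conj
    have h01 := (hM.1 0 1).conj_conj.const_mul (-1)
    have h10 := (hM.1 1 0).conj_conj.const_mul (-1)
    have h11 := (hM.1 1 1).conj_conj
    fin_cases m <;> fin_cases n <;> simp [starAdj] at h00 h01 h10 h11 ⊢ <;> assumption
  · have hd : ∀ z w : ℂ, ‖conj z - conj w‖ = 1 * ‖z - w‖ := fun z w => by
      rw [← map_sub, RCLike.norm_conj, one_mul]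
    filter_upwards [hM.2 (ModelRHP.mirror i)] with r ⟨P, Q, hP, hQ, hPQ⟩
    rw [← conj_polar_rayAngle] at hP hQ
    exact ⟨_, _, (hQ.comp_similarity one_pos Complex.continuous_conj hd infDist_conj_contour
        conj_mem_minusSide).map continuous_starAdj,
      (hP.comp_similarity one_pos Complex.continuous_conj hd infDist_conj_contour
        conj_mem_plusSide).map continuous_starAdj, starAdj_eq_mul (hj _ _) hPQ⟩

theorem IsUniquelySolvable.mirror (hj : ∀ i r, (j i r).det = 1) (h : IsUniquelySolvable α j) :
    IsUniquelySolvable α (fun i r => (j (mirror i) r).conjTranspose) := by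
  have hinv : ∀ M : ℂ → Matrix (Fin 2) (Fin 2) ℂ,
      (fun z => starAdj (starAdj (M (conj (conj z))))) = M := fun M => by
    funext z
    rw [starAdj_starAdj, Complex.conj_conj]
  refine h.transfer (T := fun M z => starAdj (M (conj z))) (T' := fun M z => starAdj (M (conj z)))
    (fun M hM => hM.mirror hj) (fun M hM => ?_)
    (fun M N hMN z hz => congrArg starAdj (hMN fun h => hz (conj_mem_contour_iff.1 h))) hinv
  have := hM.mirror (fun i r => by rw [Matrix.det_conjTranspose, hj, star_one])
  convert! this using 3 with i r
  rw [Matrix.conjTranspose_conjTranspose]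
  congr 1
  fin_cases i <;> rfl

theorem HasPotentials.mirror {u v : ℂ} (h : HasPotentials α M u v) :
    HasPotentials α (fun z => starAdj (M (conj z))) (-conj v) (-conj u) := by
  have hn : ∀ z : ℂ, ‖conj z‖ = 1 * ‖z‖ := fun z => by rw [RCLike.norm_conj, one_mul]
  intro c hc
  have ht := tendsto_cobounded_nontangential one_pos hn (infDist_conj_contour (α := α)) c
  have hcont : Continuous fun w : ℂ => -conj w := Complex.continuous_conj.neg
  constructor
  · refine ((hcont.tendsto v).comp ((h c hc).2.comp ht)).congr fun z => ?_
    simp [starAdj]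
  · refine ((hcont.tendsto u).comp ((h c hc).1.comp ht)).congr fun z => ?_
    simp [starAdj]

end Reflection

/-! ### The normalized model weights -/

section Phase

variable {k : ℕ} {a b s : ℝ}

theorem deriv_phase (x : ℝ) :
    deriv (fun y : ℝ => a + b * y ^ (k + 1)) x = ((k : ℝ) + 1) * (b * x ^ k) := by
  have h : HasDerivAt (fun y : ℝ => a + b * y ^ (k + 1)) (b * (((k + 1 : ℕ) : ℝ) * x ^ k)) x := by
    simpa using ((hasDerivAt_pow (k + 1) x).const_mul b).const_add a
  rw [h.deriv]
  push_cast
  ring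

theorem mem_Dplus {x : ℝ} : x ∈ Dplus k a b ↔ 0 < b * x ^ k := by
  show 0 < deriv (fun y : ℝ => a + b * y ^ (k + 1)) x ↔ _
  rw [deriv_phase]
  exact mul_pos_iff_of_pos_left (by positivity)

theorem mem_Dminus {x : ℝ} : x ∈ Dminus k a b ↔ b * x ^ k < 0 := by
  show deriv (fun y : ℝ => a + b * y ^ (k + 1)) x < 0 ↔ _
  rw [deriv_phase, ← neg_pos, ← neg_pos, ← mul_neg]
  exact mul_pos_iff_of_pos_left (by positivity)

theorem beta_eq_beta (a a' : ℝ) : beta k a b s = beta k a' b s := by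
  have h : Dminus k a b = Dminus k a' b := Set.ext fun x => by rw [mem_Dminus, mem_Dminus]
  funext z
  unfold beta
  rw [h]

theorem eps_cases (hb : b ≠ 0) : eps k b = 0 ∨ eps k b = 1 ∨ eps k b = -1 := by
  rw [eps]
  split_ifs
  · exact Or.inl rfl
  · rcases Real.sign_apply_eq_of_ne_zero b hb with h | h
    · exact Or.inr (Or.inr h)
    · exact Or.inr (Or.inl h)

theorem abs_eps_le (hb : b ≠ 0) : |eps k b| ≤ 1 := by
  rcases eps_cases (k := k) hb with h | h | h <;> simp [h]

/-- For odd `k` and `b ≠ 0` the derivative of the phase changes sign at 0, so 0 cannot be an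
interior point. -/
theorem eps_eq_zero_of_zero_mem_interior
    (h : (0 : ℝ) ∈ interior (closure (Dminus k a b))) : eps k b = 0 := by
  by_contra hne
  have hk' : ¬ Even k := fun he => hne (if_pos he)
  have hodd : Odd k := Nat.not_even_iff_odd.1 hk'
  have hsub : ∀ x ∈ closure (Dminus k a b), b * x ^ k ≤ 0 := by
    have hclosed : IsClosed {x : ℝ | b * x ^ k ≤ 0} :=
      isClosed_le (by fun_prop) continuous_const
    exact fun x hx => closure_minimal (fun x hx => (mem_Dminus.1 hx).le) hclosed hx
  obtain ⟨ε, hε, hball⟩ := Metric.mem_nhds_iff.1 (mem_interior_iff_mem_nhds.1 h)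
  have h1 := hsub (ε / 2) (hball (by simp [abs_of_pos hε]; linarith))
  have h2 := hsub (-(ε / 2)) (hball (by simp [abs_of_pos hε]; linarith))
  rw [hodd.neg_pow] at h2
  have hpos : 0 < (ε / 2) ^ k := by positivity
  have hb0 : b = 0 := by nlinarith
  exact hne (by simp [eps, hb0])

/-- Only the logarithm of the endpoint case feels a positive dilation; in the other two cases `eps k
b` vanishes. -/
theorem beta_mul (hb : b ≠ 0) {κ : ℝ} (hκ : 0 < κ) {z : ℂ} (hz : z ≠ 0) :
    beta k a b s (κ * z) =
      beta k a b s z + Complex.I * (eps k b : ℂ) * (nu s : ℂ) * (Real.log κ : ℂ) := by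
  rw [beta, beta]
  split_ifs with h1 h2
  · have him : Real.sign ((κ : ℂ) * z).im = Real.sign z.im := by
      rw [Complex.im_ofReal_mul]
      rcases lt_trichotomy z.im 0 with h | h | h
      · rw [Real.sign_of_neg h, Real.sign_of_neg (mul_neg_of_pos_of_neg hκ h)]
      · rw [h, mul_zero]
      · rw [Real.sign_of_pos h, Real.sign_of_pos (mul_pos hκ h)]
    rw [him, eps_eq_zero_of_zero_mem_interior h1]
    simp
  · by_cases he : (eps k b : ℂ) = 0
    · simp [he]
    · rw [mul_left_comm, Complex.log_ofReal_mul hκ (mul_ne_zero he hz)]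
      ring
  · have he : eps k b = 0 := by
      rw [eps, if_pos]
      by_contra hk'
      have hodd : Odd k := Nat.not_even_iff_odd.1 hk'
      refine h2 (Metric.mem_closure_iff.2 fun ε hε => ?_)
      have hpos : 0 < (ε / 2) ^ k := by positivity
      rcases lt_or_gt_of_ne hb with hb' | hb'
      · exact ⟨ε / 2, mem_Dminus.2 (mul_neg_of_neg_of_pos hb' hpos), by
          simp [abs_of_pos hε]; linarith⟩
      · refine ⟨-(ε / 2), mem_Dminus.2 ?_, by simp [abs_of_pos hε]; linarith⟩
        rw [hodd.neg_pow]
        nlinarith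
    simp [he]

/-- A bounded real part keeps `δ` and its inverse bounded, so the phase alone decides the decay of
the weights. -/
theorem abs_re_beta_le (hb : b ≠ 0) (z : ℂ) : |(beta k a b s z).re| ≤ Real.pi * |nu s| := by
  have hpi := Real.pi_pos
  rw [beta]
  split_ifs
  · rw [Complex.ofReal_re, abs_neg, abs_mul, abs_mul, abs_of_pos hpi]
    have : |Real.sign z.im| ≤ 1 := by
      rcases Real.sign_apply_eq z.im with h | h | h <;> simp [h]
    nlinarith [mul_nonneg hpi.le (abs_nonneg (nu s))]
  · have h : (Complex.I * (eps k b : ℂ) * (nu s : ℂ) * Complex.log ((eps k b : ℂ) * z)).re =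
        -(eps k b * nu s * Complex.arg ((eps k b : ℂ) * z)) := by
      simp [Complex.mul_re, Complex.mul_im, Complex.log_im]
    rw [h, abs_neg, abs_mul, abs_mul]
    have h1 := Complex.abs_arg_le_pi ((eps k b : ℂ) * z)
    have h2 := abs_eps_le (k := k) hb
    calc |eps k b| * |nu s| * |Complex.arg ((eps k b : ℂ) * z)| ≤ 1 * |nu s| * Real.pi := by
          gcongr
      _ = _ := by ring
  · simp
    positivity

theorem conj_beta_conj {z : ℂ} (hz : z.im ≠ 0) :
    conj (beta k a b s (conj z)) = -beta k a b s z := by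
  rw [beta, beta]
  split_ifs
  · rw [Complex.conj_ofReal, Complex.conj_im, Real.sign_neg]
    push_cast
    ring
  · by_cases he : (eps k b : ℂ) = 0
    · simp [he]
    · have harg : Complex.arg ((eps k b : ℂ) * z) ≠ Real.pi := fun h => by
        have := (Complex.arg_eq_pi_iff.1 h).2
        rw [Complex.im_ofReal_mul] at this
        exact (mul_ne_zero (by exact_mod_cast he) hz) this
      have hlog : Complex.log ((eps k b : ℂ) * conj z) =
          conj (Complex.log ((eps k b : ℂ) * z)) := by
        rw [← Complex.log_conj _ harg, map_mul, Complex.conj_ofReal]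
      rw [hlog]
      simp only [map_mul, Complex.conj_I, Complex.conj_ofReal, Complex.conj_conj]
      ring
  · simp

theorem differentiableAt_beta {z : ℂ} (hz : z.im ≠ 0) :
    DifferentiableAt ℂ (beta k a b s) z := by
  unfold beta
  split_ifs
  · have hev : (fun w : ℂ => ((-(Real.pi * nu s * Real.sign w.im) : ℝ) : ℂ)) =ᶠ[𝓝 z]
        fun _ => ((-(Real.pi * nu s * Real.sign z.im) : ℝ) : ℂ) := by
      rcases lt_or_gt_of_ne hz with h | h
      · filter_upwards [Complex.continuous_im.continuousAt.eventually_lt continuousAt_const h]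
          with w hw
        rw [Real.sign_of_neg h, Real.sign_of_neg hw]
      · filter_upwards [continuousAt_const.eventually_lt Complex.continuous_im.continuousAt h]
          with w hw
        rw [Real.sign_of_pos h, Real.sign_of_pos hw]
    exact (differentiableAt_const _).congr_of_eventuallyEq hev
  · by_cases he : eps k b = 0
    · simp [he]
    · refine ((differentiableAt_id.const_mul _).clog (Or.inr ?_)).const_mul _
      simp [he, hz]
  · exact differentiableAt_const _

end Phase

/-! ### Decay and analyticity of the normalized weights -/

section NormalWeight

variable {k : ℕ} {b s : ℝ} {p q : ℂ}

/-- The function `2 β(z) - i b z^{k+1}`. -/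
noncomputable def exponent (k : ℕ) (b s : ℝ) (z : ℂ) : ℂ :=
  2 * beta k 0 b s z - Complex.I * ((b : ℂ) * z ^ (k + 1))

/-- On `Γᵢ` the weight is upper triangular if this number is positive. -/
noncomputable def raySlope (k : ℕ) (b : ℝ) : Fin 6 → ℝ :=
  ![0, -b, -(b * (-1) ^ k), 0, b * (-1) ^ k, b]

/-- The coefficients of `p` in the weights. -/
noncomputable def upperCoeff (s : ℝ) : Fin 6 → ℝ := ![0, 1 / (1 + s), 1 / (1 + s), 0, 1, 1]

/-- The coefficients of `q` in the weights. -/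
noncomputable def lowerCoeff (s : ℝ) : Fin 6 → ℝ := ![0, 1, 1, 0, 1 / (1 + s), 1 / (1 + s)]

/-- The model weights for `a = ω = 0` and `t = 1`. -/
noncomputable def normalWeight (k : ℕ) (b s : ℝ) (p q : ℂ) (i : Fin 6) (z : ℂ) :
    Matrix (Fin 2) (Fin 2) ℂ :=
  if 0 < raySlope k b i then !![0, upperCoeff s i * p * Complex.exp (exponent k b s z); 0, 0]
  else !![0, 0; lowerCoeff s i * q * Complex.exp (-exponent k b s z), 0]

/-- Up to the factor r^{k+1} this is the imaginary part of b z^{k+1} on a ray. The sign of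
`raySlope` selects the triangular form, so the exponential in the weight decays on every nonreal ray
as long as 0 < (k + 1)β < π. -/
theorem sin_mul_rayAngle (k : ℕ) (b β : ℝ) {i : Fin 6} (h0 : i ≠ 0) (h3 : i ≠ 3) :
    b * Real.sin (((k : ℝ) + 1) * rayAngle β i) =
      -(raySlope k b i * Real.sin (((k : ℝ) + 1) * β)) := by
  have hc : ∀ n : ℕ, Real.cos ((n : ℝ) * Real.pi) = (-1) ^ n := Real.cos_nat_mul_pi
  have h1 := Real.sin_nat_mul_pi (k + 1)
  have h2 := Real.cos_nat_mul_pi (k + 1)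
  push_cast at h1 h2
  have h4 : ((k : ℝ) + 1) * (Real.pi - β) = ((k : ℝ) + 1) * Real.pi - ((k : ℝ) + 1) * β := by ring
  have h5 : ((k : ℝ) + 1) * (Real.pi + β) = ((k : ℝ) + 1) * Real.pi + ((k : ℝ) + 1) * β := by ring
  have h6 : Real.sin (((k : ℝ) + 1) * (2 * Real.pi - β)) = -Real.sin (((k : ℝ) + 1) * β) := by
    have := Real.sin_nat_mul_two_pi_sub (((k : ℝ) + 1) * β) (k + 1)
    push_cast at this
    rw [← this]
    ring_nf
  fin_cases i
  · exact absurd rfl h0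
  · simp [rayAngle, raySlope]
  · simp [rayAngle, raySlope, h4, Real.sin_sub, h1, h2]
    ring
  · exact absurd rfl h3
  · simp [rayAngle, raySlope, h5, Real.sin_add, h1, h2]
    ring
  · simp [rayAngle, raySlope, h6]

theorem abs_raySlope {i : Fin 6} (h0 : i ≠ 0) (h3 : i ≠ 3) : |raySlope k b i| = |b| := by
  fin_cases i <;> simp [raySlope, abs_mul, abs_pow] at h0 h3 ⊢

theorem normalWeight_eq_zero {i : Fin 6} (h : i = 0 ∨ i = 3) (z : ℂ) :
    normalWeight k b s p q i z = 0 := by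
  rcases h with rfl | rfl <;> ext m n <;> fin_cases m <;> fin_cases n <;>
    simp [normalWeight, raySlope, lowerCoeff]

theorem re_exponent (r β : ℝ) {i : Fin 6} (h0 : i ≠ 0) (h3 : i ≠ 3) :
    (exponent k b s (polar r (rayAngle β i))).re =
      2 * (beta k 0 b s (polar r (rayAngle β i))).re -
        raySlope k b i * (Real.sin (((k : ℝ) + 1) * β) * r ^ (k + 1)) := by
  have hpow : polar r (rayAngle β i) ^ (k + 1) =
      polar (r ^ (k + 1)) (((k : ℝ) + 1) * rayAngle β i) := by
    rw [polar, mul_pow, ← Complex.exp_nat_mul, polar]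
    push_cast
    ring_nf
  have h := sin_mul_rayAngle k b β h0 h3
  rw [exponent, hpow, Complex.sub_re, Complex.I_mul_re, Complex.im_ofReal_mul, polar_im]
  simp only [Complex.mul_re, Complex.re_ofNat, Complex.im_ofNat]
  linear_combination r ^ (k + 1) * h

theorem im_polar_rayAngle_ne_zero {β r : ℝ} (hβ₀ : 0 < β) (hβ : β < Real.pi / 2) (hr : 0 < r)
    {i : Fin 6} (h0 : i ≠ 0) (h3 : i ≠ 3) : (polar r (rayAngle β i)).im ≠ 0 := by
  have hpi := Real.pi_pos
  have hs : Real.sin β ≠ 0 := (Real.sin_pos_of_pos_of_lt_pi hβ₀ (by linarith)).ne'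
  rw [polar_im]
  refine mul_ne_zero hr.ne' ?_
  fin_cases i
  · exact absurd rfl h0
  · simpa [rayAngle] using hs
  · simpa [rayAngle] using hs
  · exact absurd rfl h3
  · show Real.sin (Real.pi + β) ≠ 0
    rw [add_comm, Real.sin_add_pi]
    exact neg_ne_zero.2 hs
  · simpa [rayAngle] using hs

theorem differentiableAt_exponent {z : ℂ} (hz : z.im ≠ 0) :
    DifferentiableAt ℂ (exponent k b s) z :=
  ((differentiableAt_beta hz).const_mul _).sub (by fun_prop)

theorem differentiableAt_normalWeight {i : Fin 6} {z : ℂ} (hz : z.im ≠ 0) (m n : Fin 2) :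
    DifferentiableAt ℂ (fun z => normalWeight k b s p q i z m n) z := by
  have h := differentiableAt_exponent (k := k) (b := b) (s := s) hz
  unfold normalWeight
  split_ifs
  · fin_cases m <;> fin_cases n <;> simp
    exact h.cexp.const_mul _
  · fin_cases m <;> fin_cases n <;> simp
    exact h.neg.cexp.const_mul _

/-- This weakens decay like e^{-c r^{k+1}} to e^{-cr}, at the price of a constant factor e^c. -/
theorem sub_one_le_pow {r : ℝ} (hr : 0 < r) (n : ℕ) : r - 1 ≤ r ^ (n + 1) := by
  rcases le_or_gt 1 r with h | h
  · have := le_self_pow₀ h (Nat.succ_ne_zero n)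
    simp only [Nat.succ_eq_add_one] at this
    linarith
  · linarith [pow_pos hr (n + 1)]

theorem opening_le_half_pi (hk : 1 ≤ k) : Real.pi / (k + 1) ≤ Real.pi / 2 := by
  have : (1 : ℝ) ≤ k := by exact_mod_cast hk
  exact div_le_div_of_nonneg_left Real.pi_pos.le two_pos (by linarith)

theorem coeff_le (hs : 0 < 1 + s) (i : Fin 6) :
    |upperCoeff s i| ≤ 1 + 1 / (1 + s) ∧ |lowerCoeff s i| ≤ 1 + 1 / (1 + s) := by
  have h : 0 < 1 / (1 + s) := by positivity
  have h' : 0 < (1 + s)⁻¹ := by positivity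
  fin_cases i <;> simp [upperCoeff, lowerCoeff, abs_of_pos hs] <;> linarith

theorem norm_normalWeight_le (hb : b ≠ 0) (hs : 0 < 1 + s) {β r S : ℝ} (hr : 0 < r)
    (hS₀ : 0 ≤ S) (hS : S ≤ Real.sin (((k : ℝ) + 1) * β)) (i : Fin 6) (m n : Fin 2) :
    ‖normalWeight k b s p q i (polar r (rayAngle β i)) m n‖ ≤
      (1 + 1 / (1 + s)) * (‖p‖ + ‖q‖) * Real.exp (2 * (Real.pi * |nu s|) + |b| * S) *
        Real.exp (-(|b| * S * r)) := by
  have hA : 0 ≤ 1 + 1 / (1 + s) := by positivity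
  by_cases h03 : i = 0 ∨ i = 3
  · rw [normalWeight_eq_zero h03]
    simp only [Matrix.zero_apply, norm_zero]
    positivity
  obtain ⟨h0, h3⟩ := not_or.1 h03
  set z := polar r (rayAngle β i) with hz
  have hre := re_exponent (k := k) (b := b) (s := s) r β h0 h3
  rw [← hz] at hre
  have hβ := abs_le.1 (abs_re_beta_le (k := k) (a := 0) (s := s) hb z)
  have hτ := abs_raySlope (k := k) (b := b) h0 h3
  have hpow := sub_one_le_pow hr k
  have hmul : S * (r - 1) ≤ Real.sin (((k : ℝ) + 1) * β) * r ^ (k + 1) := by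
    calc S * (r - 1) ≤ S * r ^ (k + 1) := by gcongr
      _ ≤ _ := by gcongr
  have hmul' := mul_le_mul_of_nonneg_left hmul (abs_nonneg b)
  obtain ⟨hu, hl⟩ := coeff_le hs i
  have key : ∀ (c : ℝ) (x e : ℂ), |c| ≤ 1 + 1 / (1 + s) → ‖x‖ ≤ ‖p‖ + ‖q‖ →
      e.re ≤ 2 * (Real.pi * |nu s|) + |b| * S - |b| * S * r →
      ‖(c : ℂ) * x * Complex.exp e‖ ≤ (1 + 1 / (1 + s)) * (‖p‖ + ‖q‖) *
        Real.exp (2 * (Real.pi * |nu s|) + |b| * S) * Real.exp (-(|b| * S * r)) := by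
    intro c x e hc hx he
    rw [norm_mul, norm_mul, Complex.norm_real, Real.norm_eq_abs, Complex.norm_exp, mul_assoc _
      (Real.exp _), ← Real.exp_add]
    have := Real.exp_le_exp.2 (he.trans_eq (sub_eq_add_neg _ _))
    gcongr
  have hnn : 0 ≤ (1 + 1 / (1 + s)) * (‖p‖ + ‖q‖) *
      Real.exp (2 * (Real.pi * |nu s|) + |b| * S) * Real.exp (-(|b| * S * r)) := by positivity
  rw [normalWeight]
  split_ifs with hpos
  · rw [abs_of_pos hpos] at hτ
    rw [hτ] at hre
    have h1 := key (upperCoeff s i) p (exponent k b s z) hu (by linarith [norm_nonneg q])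
      (by linarith)
    fin_cases m <;> fin_cases n <;> first | exact h1 | simpa using hnn
  · rw [abs_of_nonpos (not_lt.1 hpos)] at hτ
    have h1 := key (lowerCoeff s i) q (-exponent k b s z) hl (by linarith [norm_nonneg p])
      (by rw [Complex.neg_re, hre, ← neg_neg (raySlope k b i), hτ]; linarith)
    fin_cases m <;> fin_cases n <;> first | exact h1 | simpa using hnn

theorem isWeight_normalWeight (hk : 1 ≤ k) (hb : b ≠ 0) (hs : 0 < 1 + s) :
    IsWeight (Real.pi / (k + 1)) (normalWeight k b s p q) where
  le_half_pi := opening_le_half_pi hk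
  zero := normalWeight_eq_zero (Or.inl rfl)
  three := normalWeight_eq_zero (Or.inr rfl)
  nilpotent i z := by
    ext m n
    rw [normalWeight]
    split_ifs <;> fin_cases m <;> fin_cases n <;> simp [Matrix.mul_apply, Fin.sum_univ_two]
  differentiableAt i β r hβ₀ hβ hr m n := by
    by_cases h03 : i = 0 ∨ i = 3
    · simp [normalWeight_eq_zero h03]
    · obtain ⟨h0, h3⟩ := not_or.1 h03
      exact differentiableAt_normalWeight (im_polar_rayAngle_ne_zero hβ₀
        (hβ.trans_le (opening_le_half_pi hk)) hr h0 h3) m n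
  bound β₁ β₂ h1 h2 := by
    rcases lt_or_ge β₂ β₁ with hlt | hle
    · exact ⟨0, 1, le_rfl, one_pos, fun i β r h3 h4 => absurd (h3.trans h4) (not_le.2 hlt)⟩
    have hk0 : (0 : ℝ) < (k : ℝ) + 1 := by positivity
    have hlt : ∀ β, β ≤ β₂ → ((k : ℝ) + 1) * β < Real.pi := fun β hβ =>
      (mul_le_mul_of_nonneg_left hβ hk0.le).trans_lt ((lt_div_iff₀' hk0).1 h2)
    -- The sine is concave on [0, π], so on an interval it is bounded below by the smaller of its
    -- end values.
    set S := min (Real.sin (((k : ℝ) + 1) * β₁)) (Real.sin (((k : ℝ) + 1) * β₂)) with hS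
    have hS₀ : 0 < S := lt_min
      (Real.sin_pos_of_pos_of_lt_pi (by positivity) (hlt _ hle))
      (Real.sin_pos_of_pos_of_lt_pi (mul_pos hk0 (h1.trans_le hle)) (hlt _ le_rfl))
    refine ⟨(1 + 1 / (1 + s)) * (‖p‖ + ‖q‖) * Real.exp (2 * (Real.pi * |nu s|) + |b| * S),
      |b| * S, by positivity, mul_pos (abs_pos.2 hb) hS₀, fun i β r h3 h4 hr m n =>
      norm_normalWeight_le hb hs hr hS₀.le ?_ i m n⟩
    exact strictConcaveOn_sin_Icc.concaveOn.min_le_of_mem_Icc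
      ⟨by positivity, (hlt _ hle).le⟩ ⟨(mul_pos hk0 (h1.trans_le hle)).le, (hlt _ le_rfl).le⟩
      ⟨by gcongr, by gcongr⟩

end NormalWeight

/-! ### Symmetries of the normalized problem and reduction of the model problem to it -/

section NormalProblem

variable {k : ℕ} {b s α : ℝ} {p q : ℂ}

theorem det_weightJump_normalWeight (i : Fin 6) (r : ℝ) :
    (weightJump α (normalWeight k b s p q) i r).det = 1 := by
  rw [weightJump, normalWeight, Matrix.det_fin_two]
  split_ifs <;> simp

theorem diagConj_weightJump_normalWeight (d : ℂ) (i : Fin 6) (r : ℝ) :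
    diagConj d (weightJump α (normalWeight k b s p q) i r) =
      weightJump α (normalWeight k b s (d * p) (d⁻¹ * q)) i r := by
  simp only [weightJump, normalWeight]
  ext m n
  split_ifs <;> fin_cases m <;> fin_cases n <;> simp [diagConj] <;> ring

theorem conj_exponent_conj {z : ℂ} (hz : z.im ≠ 0) :
    conj (exponent k b s (conj z)) = -exponent k b s z := by
  have h := conj_beta_conj (k := k) (a := 0) (b := b) (s := s) hz
  simp only [exponent, map_sub, map_mul, map_pow, Complex.conj_I, Complex.conj_ofReal,
    Complex.conj_conj, h, map_ofNat]
  ring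

theorem mirror_coeff (i : Fin 6) : raySlope k b (mirror i) = -raySlope k b i ∧
    upperCoeff s (mirror i) = lowerCoeff s i ∧ lowerCoeff s (mirror i) = upperCoeff s i := by
  fin_cases i <;> simp [mirror, raySlope, upperCoeff, lowerCoeff]

/-- Conjugation negates the exponent, and the mirrored ray has the opposite slope and exchanged
coefficients. Transposition restores the triangular type, with `p` and `q` exchanged and conjugated.
-/
theorem conjTranspose_weightJump_normalWeight (hb : b ≠ 0) (hα₀ : 0 < α) (hα : α < Real.pi / 2)
    (i : Fin 6) {r : ℝ} (hr : 0 < r) :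
    (weightJump α (normalWeight k b s p q) (mirror i) r).conjTranspose =
      weightJump α (normalWeight k b s (conj q) (conj p)) i r := by
  by_cases h03 : i = 0 ∨ i = 3
  · have h03' : mirror i = 0 ∨ mirror i = 3 := by rcases h03 with rfl | rfl <;> decide
    simp [weightJump, normalWeight_eq_zero h03, normalWeight_eq_zero h03']
  obtain ⟨h0, h3⟩ := not_or.1 h03
  obtain ⟨h1, h2, h4⟩ := mirror_coeff (k := k) (b := b) (s := s) i
  have hτ : raySlope k b i ≠ 0 := by
    rw [← abs_pos, abs_raySlope h0 h3]
    exact abs_pos.2 hb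
  have he := conj_exponent_conj (k := k) (b := b) (s := s)
    (im_polar_rayAngle_ne_zero hα₀ hα hr h0 h3)
  have he' : conj (Complex.exp (exponent k b s (conj (polar r (rayAngle α i))))) =
      Complex.exp (-exponent k b s (polar r (rayAngle α i))) := by
    rw [← Complex.exp_conj, he]
  have he'' : conj (Complex.exp (-exponent k b s (conj (polar r (rayAngle α i))))) =
      Complex.exp (exponent k b s (polar r (rayAngle α i))) := by
    rw [← Complex.exp_conj, map_neg, he, neg_neg]
  rw [weightJump, weightJump, normalWeight, normalWeight, h1, h2, h4, ← conj_polar_rayAngle]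
  rcases lt_or_gt_of_ne hτ with h | h
  · rw [if_pos (neg_pos.2 h), if_neg (not_lt.2 h.le)]
    ext m n
    fin_cases m <;> fin_cases n <;> simp [Matrix.conjTranspose_apply, he']
  · rw [if_neg (not_lt.2 (neg_nonpos.2 h.le)), if_pos h]
    ext m n
    fin_cases m <;> fin_cases n <;> simp [Matrix.conjTranspose_apply, he'']

theorem IsSolution.congr {j j' : Fin 6 → ℝ → Matrix (Fin 2) (Fin 2) ℂ}
    {M : ℂ → Matrix (Fin 2) (Fin 2) ℂ} (h : ∀ i r, 0 < r → j i r = j' i r)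
    (hM : IsSolution α j M) : IsSolution α j' M := by
  refine ⟨hM.1, fun i => ?_⟩
  filter_upwards [hM.2 i, ae_restrict_mem measurableSet_Ioi] with r ⟨P, Q, hP, hQ, hPQ⟩ hr
  exact ⟨P, Q, hP, hQ, by rw [hPQ, h i r hr]⟩

theorem IsUniquelySolvable.congr {j j' : Fin 6 → ℝ → Matrix (Fin 2) (Fin 2) ℂ}
    (h : ∀ i r, 0 < r → j i r = j' i r) (hj : IsUniquelySolvable α j) :
    IsUniquelySolvable α j' :=
  hj.transfer (T := id) (T' := id) (fun _ hM => hM.congr h)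
    (fun _ hM => hM.congr fun i r hr => (h i r hr).symm) (fun _ _ h => h) fun _ => rfl

/-- For κ = t^{1/(k+1)} the term t b z^{k+1} becomes b(κz)^{k+1}, and passing from β(z) to β(κz)
costs iεν ln t/(k + 1). Everything independent of `z` collects in `Delta`. -/
theorem delta_sq_mul_exp (hb : b ≠ 0) (a ω : ℝ) {t : ℝ} (ht : 0 < t) {z : ℂ} (hz : z ≠ 0) :
    delta k a b s ω z ^ 2 * Complex.exp (-(Complex.I * (t : ℂ) * phase k a b z)) =
      Complex.exp (-2 * Delta k a b s ω t) *
        Complex.exp (exponent k b s (((t ^ (1 / ((k : ℝ) + 1)) : ℝ) : ℂ) * z)) := by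
  have hκ : 0 < t ^ (1 / ((k : ℝ) + 1)) := Real.rpow_pos_of_pos ht _
  have hk0 : (k : ℝ) + 1 ≠ 0 := by positivity
  have hpow : (((t ^ (1 / ((k : ℝ) + 1)) : ℝ) : ℂ)) ^ (k + 1) = t := by
    rw [← Complex.ofReal_pow, ← Real.rpow_natCast, ← Real.rpow_mul ht.le]
    push_cast
    rw [one_div_mul_cancel hk0, Real.rpow_one]
  rw [delta, ← Complex.exp_nat_mul, ← Complex.exp_add, ← Complex.exp_add, exponent,
    beta_mul hb hκ hz, mul_pow, hpow, Real.log_rpow ht, beta_eq_beta a 0, phase, Delta]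
  congr 1
  push_cast
  ring

theorem delta_zpow_mul_exp (hb : b ≠ 0) (a ω : ℝ) {t : ℝ} (ht : 0 < t) {z : ℂ} (hz : z ≠ 0) :
    delta k a b s ω z ^ (-2 : ℤ) * Complex.exp (Complex.I * (t : ℂ) * phase k a b z) =
      Complex.exp (2 * Delta k a b s ω t) *
        Complex.exp (-exponent k b s (((t ^ (1 / ((k : ℝ) + 1)) : ℝ) : ℂ) * z)) := by
  have h := congrArg (·⁻¹) (delta_sq_mul_exp (k := k) (s := s) hb a ω ht hz)
  simp only [mul_inv, ← Complex.exp_neg, neg_neg, neg_mul] at h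
  rw [← h, zpow_neg]
  rfl

/-- On `Γ₄` and `Γ₅` the jump is the inverse of `1 + W`; nilpotency gives it the form `1 - W` that
it has on `Γ₁` and `Γ₂`. -/
theorem one_add_inv_of_mul_self {A : Matrix (Fin 2) (Fin 2) ℂ} (h : A * A = 0) :
    (1 + A)⁻¹ = 1 - A :=
  Matrix.inv_eq_right_inv (by rw [mul_sub, mul_one, add_mul, one_mul, h]; abel)

theorem weightMinus_mul_self (a ω t x : ℝ) (z : ℂ) :
    weightMinus k a b s ω t p q x z * weightMinus k a b s ω t p q x z = 0 := by
  ext m n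
  rw [weightMinus]
  split_ifs <;> fin_cases m <;> fin_cases n <;> simp [Matrix.mul_apply, Fin.sum_univ_two]

/-- The model jump is a rescaled normalized jump. -/
theorem modelJump_eq (hb : b ≠ 0) (hpq : p * q = s) (a ω : ℝ) {t : ℝ} (ht : 0 < t) (i : Fin 6)
    {r : ℝ} (hr : 0 < r) : modelJump k a b s ω t p q α i r =
      weightJump α (normalWeight k b s (p * Complex.exp (-2 * Delta k a b s ω t))
        (q * Complex.exp (2 * Delta k a b s ω t))) i (t ^ (1 / ((k : ℝ) + 1)) * r) := by
  have hz : ∀ i, polar r (rayAngle α i) ≠ 0 := fun i => by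
    rw [← norm_pos_iff, norm_polar hr.le]
    exact hr
  have hup := fun i => delta_sq_mul_exp (k := k) (s := s) hb a ω ht (hz i)
  have hlow := fun i => delta_zpow_mul_exp (k := k) (s := s) hb a ω ht (hz i)
  have hupc : ∀ i c, delta k a b s ω (polar r (rayAngle α i)) ^ 2 * c *
      Complex.exp (-(Complex.I * (t : ℂ) * phase k a b (polar r (rayAngle α i)))) = _ :=
    fun i c => (mul_right_comm _ _ _).trans (congrArg (· * c) (hup i))
  have hlowc : ∀ i c, delta k a b s ω (polar r (rayAngle α i)) ^ (-2 : ℤ) * c *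
      Complex.exp (Complex.I * (t : ℂ) * phase k a b (polar r (rayAngle α i))) = _ :=
    fun i c => (mul_right_comm _ _ _).trans (congrArg (· * c) (hlow i))
  have hD : r ∈ Dplus k a b ↔ 0 < b := by
    rw [mem_Dplus]
    exact mul_pos_iff_of_pos_right (pow_pos hr k)
  have hD' : -r ∈ Dplus k a b ↔ 0 < b * (-1) ^ k := by
    rw [mem_Dplus, neg_pow, ← mul_assoc]
    exact mul_pos_iff_of_pos_right (pow_pos hr k)
  have hne : b * (-1) ^ k ≠ 0 := mul_ne_zero hb (pow_ne_zero _ (by norm_num))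
  have hneg : ∀ x : ℝ, x ≠ 0 → (0 < -x ↔ ¬ 0 < x) := fun x hx => by
    rw [neg_pos, not_lt]
    exact ⟨le_of_lt, fun h => lt_of_le_of_ne h hx⟩
  have hplus : ∀ i x, upperCoeff s i = 1 / (1 + s) → lowerCoeff s i = 1 →
      (0 < raySlope k b i ↔ x ∉ Dplus k a b) →
      weightPlus k a b s ω t p q x (polar r (rayAngle α i)) =
        normalWeight k b s (p * Complex.exp (-2 * Delta k a b s ω t))
          (q * Complex.exp (2 * Delta k a b s ω t)) i
          (polar (t ^ (1 / ((k : ℝ) + 1)) * r) (rayAngle α i)) := by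
    intro i x h1 h2 h3
    rw [weightPlus, normalWeight, hupc, hlowc, hpq, h1, h2, polar_mul]
    by_cases hx : x ∈ Dplus k a b
    · rw [if_pos hx, if_neg fun h => h3.1 h hx]
      ext m n
      fin_cases m <;> fin_cases n <;> simp
      ring
    · rw [if_neg hx, if_pos (h3.2 hx)]
      ext m n
      fin_cases m <;> fin_cases n <;> simp
      ring
  have hminus : ∀ i x, upperCoeff s i = 1 → lowerCoeff s i = 1 / (1 + s) →
      (0 < raySlope k b i ↔ x ∈ Dplus k a b) →
      weightMinus k a b s ω t p q x (polar r (rayAngle α i)) =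
        normalWeight k b s (p * Complex.exp (-2 * Delta k a b s ω t))
          (q * Complex.exp (2 * Delta k a b s ω t)) i
          (polar (t ^ (1 / ((k : ℝ) + 1)) * r) (rayAngle α i)) := by
    intro i x h1 h2 h3
    rw [weightMinus, normalWeight, hupc, hlowc, hpq, h1, h2, polar_mul]
    by_cases hx : x ∈ Dplus k a b
    · rw [if_pos hx, if_pos (h3.2 hx)]
      ext m n
      fin_cases m <;> fin_cases n <;> simp
      ring
    · rw [if_neg hx, if_neg fun h => hx (h3.1 h)]
      ext m n
      fin_cases m <;> fin_cases n <;> simp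
      ring
  have hzero : ∀ i, i = 0 ∨ i = 3 → modelJump k a b s ω t p q α i r =
      1 - normalWeight k b s (p * Complex.exp (-2 * Delta k a b s ω t))
        (q * Complex.exp (2 * Delta k a b s ω t)) i
        (polar (t ^ (1 / ((k : ℝ) + 1)) * r) (rayAngle α i)) := by
    intro i hi
    rw [normalWeight_eq_zero hi]
    rcases hi with rfl | rfl <;> simp [modelJump, deformedPlus, deformedMinus]
  rw [weightJump]
  fin_cases i
  · exact hzero 0 (Or.inl rfl)
  · refine Eq.trans ?_ (congrArg (1 - ·) (hplus 1 r rfl rfl ((hneg b hb).trans (not_congr hD.symm))))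
    simp [modelJump, deformedPlus, deformedMinus, sub_eq_add_neg]
  · refine Eq.trans ?_ (congrArg (1 - ·) (hplus 2 (-r) rfl rfl
      ((hneg _ hne).trans (not_congr hD'.symm))))
    simp [modelJump, deformedPlus, deformedMinus, sub_eq_add_neg]
  · exact hzero 3 (Or.inr rfl)
  · refine Eq.trans ?_ (congrArg (1 - ·) (hminus 4 (-r) rfl rfl hD'.symm))
    simp [modelJump, deformedPlus, deformedMinus, one_add_inv_of_mul_self, weightMinus_mul_self]
  · refine Eq.trans ?_ (congrArg (1 - ·) (hminus 5 r rfl rfl hD.symm))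
    simp [modelJump, deformedPlus, deformedMinus, one_add_inv_of_mul_self, weightMinus_mul_self]

end NormalProblem

/-! ### The potentials -/

section Potentials

variable {α : ℝ} {M : ℂ → Matrix (Fin 2) (Fin 2) ℂ} {u v : ℂ}

/-- The positive imaginary half-axis is a nontangential path to infinity for every admissible
opening, so potentials on different contours can be compared along it. -/
theorem cos_mul_le_infDist (hα₀ : 0 < α) (hα : α < Real.pi / 2) {r : ℝ} (hr : 0 ≤ r) :
    Real.cos α * ‖polar r (Real.pi / 2)‖ ≤
      Metric.infDist (polar r (Real.pi / 2)) (contour α) := by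
  have hcos : 0 < Real.cos α := Real.cos_pos_of_mem_Ioo ⟨by linarith, hα⟩
  refine (Metric.le_infDist ⟨0, zero_mem_contour⟩).2 ?_
  rintro w ⟨i, s, hs, rfl⟩
  rw [dist_eq_norm, norm_polar hr]
  refine le_trans ?_ mul_abs_sin_le_norm_sub
  rw [Real.sin_pi_div_two_sub, mul_comm]
  refine mul_le_mul_of_nonneg_left ?_ hr
  have h1 := Real.cos_le_one α
  have h2 := le_abs_self (Real.cos α)
  fin_cases i <;> simp [rayAngle, Real.cos_add] <;> assumption

theorem tendsto_polar_pi_div_two (hα₀ : 0 < α) (hα : α < Real.pi / 2) :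
    Tendsto (fun r : ℝ => polar r (Real.pi / 2)) atTop
      (Bornology.cobounded ℂ ⊓
        𝓟 {z | Real.cos α * ‖z‖ ≤ Metric.infDist z (contour α)}) := by
  refine tendsto_inf.2 ⟨tendsto_norm_atTop_iff_cobounded.1 ?_, tendsto_principal.2 ?_⟩
  · refine tendsto_id.congr' ?_
    filter_upwards [eventually_ge_atTop 0] with r hr
    rw [norm_polar hr, id]
  · filter_upwards [eventually_ge_atTop 0] with r hr
    exact cos_mul_le_infDist hα₀ hα hr

theorem HasPotentials.tendsto_upper (hα₀ : 0 < α) (hα : α < Real.pi / 2)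
    (h : HasPotentials α M u v) :
    Tendsto (fun r : ℝ => polar r (Real.pi / 2) * M (polar r (Real.pi / 2)) 0 1) atTop (𝓝 u) :=
  (h _ (Real.cos_pos_of_mem_Ioo ⟨by linarith, hα⟩)).1.comp (tendsto_polar_pi_div_two hα₀ hα)

theorem polar_pi_div_two_notMem (hα₀ : 0 < α) (hα : α < Real.pi / 2) {r : ℝ} (hr : 0 < r) :
    polar r (Real.pi / 2) ∉ contour α :=
  polar_notMem_contour hα₀ hα hr (by positivity) (by linarith)
    (pi_div_two_ne_rayAngle hα₀ hα)

variable {k : ℕ} {b s : ℝ} {p q : ℂ}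

/-- Without `p` all jumps are lower triangular with unit diagonal, so uniqueness makes the first row
of the solution trivial. -/
theorem potential_eq_zero (hα₀ : 0 < α) (hα : α < Real.pi / 2)
    (huniq : IsUniquelySolvable α (weightJump α (normalWeight k b s 0 q)))
    (hM : IsSolution α (weightJump α (normalWeight k b s 0 q)) M)
    (hpot : HasPotentials α M u v) : u = 0 := by
  have hrow : ∀ i r, 0 < r → weightJump α (normalWeight k b s 0 q) i r 0 =
      (1 : Matrix (Fin 2) (Fin 2) ℂ) 0 := by
    intro i r _
    ext n
    rw [weightJump, normalWeight]
    split_ifs <;> fin_cases n <;> simp [Matrix.one_apply]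
  refine tendsto_nhds_unique (hpot.tendsto_upper hα₀ hα) ?_
  refine tendsto_const_nhds.congr' ?_
  filter_upwards [eventually_gt_atTop 0] with r hr
  rw [huniq.row_eq hM hrow (polar_pi_div_two_notMem hα₀ hα hr)]
  simp

/-- Conjugation with `p₀ / p` carries (p, q) to (p₀, q₀) because the products agree. A change of
opening then gives a solution of the reference problem, where uniqueness identifies it with `M₀`. -/
theorem potential_eq_mul (hk : 1 ≤ k) (hb : b ≠ 0) (hs : 0 < 1 + s) {α₀ : ℝ} (hα₀ : 0 < α)
    (hα : α < Real.pi / (k + 1)) (hα₀₀ : 0 < α₀) (hα₀' : α₀ < Real.pi / (k + 1))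
    {p₀ q₀ u₀ v₀ : ℂ} {M₀ : ℂ → Matrix (Fin 2) (Fin 2) ℂ} (hpq₀ : p₀ * q₀ = s) (hp₀ : p₀ ≠ 0)
    (huniq : IsUniquelySolvable α₀ (weightJump α₀ (normalWeight k b s p₀ q₀)))
    (hM₀ : IsSolution α₀ (weightJump α₀ (normalWeight k b s p₀ q₀)) M₀)
    (hpot₀ : HasPotentials α₀ M₀ u₀ v₀) (hpq : p * q = s) (hp : p ≠ 0)
    (hM : IsSolution α (weightJump α (normalWeight k b s p q)) M)
    (hpot : HasPotentials α M u v) : u = p * (u₀ / p₀) := by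
  have hle := opening_le_half_pi hk
  have hd : p₀ / p ≠ 0 := div_ne_zero hp₀ hp
  have hp' : p₀ / p * p = p₀ := div_mul_cancel₀ _ hp
  have hq' : (p₀ / p)⁻¹ * q = q₀ := by
    field_simp
    rw [hpq, hpq₀]
  have hM₁ := hM.diagConj hd
  simp only [diagConj_weightJump_normalWeight, hp', hq'] at hM₁
  obtain ⟨N, hN, hNM⟩ := hM₁.exists_change_opening hα₀ hα hα₀₀ hα₀'
    (isWeight_normalWeight hk hb hs)
  have h1 := (hpot.tendsto_upper hα₀ (hα.trans_le hle)).const_mul (p₀ / p)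
  have h2 := hpot₀.tendsto_upper hα₀₀ (hα₀'.trans_le hle)
  have h3 : u₀ = p₀ / p * u := by
    refine tendsto_nhds_unique h2 (h1.congr' ?_)
    filter_upwards [eventually_gt_atTop 0] with r hr
    rw [← huniq.2 _ _ hN hM₀ (polar_pi_div_two_notMem hα₀₀ (hα₀'.trans_le hle) hr), hNM r hr]
    simp only [diagConj, Matrix.of_apply, Matrix.cons_val', Matrix.cons_val_zero,
      Matrix.cons_val_one, Matrix.cons_val_fin_one]
    ring
  rw [h3]
  field_simp

/-- The potential of a uniquely solvable normalized problem is a constant multiple of `p`. -/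
theorem exists_potential_constant (hk : 1 ≤ k) (hb : b ≠ 0) (hs : 0 < 1 + s) :
    ∃ U : ℂ, ∀ (p q : ℂ) (α : ℝ), p * q = s → 0 < α → α < Real.pi / (k + 1) →
      IsUniquelySolvable α (weightJump α (normalWeight k b s p q)) →
      ∀ (M : ℂ → Matrix (Fin 2) (Fin 2) ℂ) (u v : ℂ),
        IsSolution α (weightJump α (normalWeight k b s p q)) M → HasPotentials α M u v →
        u = p * U := by
  have hle := opening_le_half_pi hk
  -- The constant is read off from one uniquely solvable problem with `p ≠ 0`. If there is none,
  -- only `p = 0` can occur and any value serves.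
  by_cases hex : ∃ (p q : ℂ) (α : ℝ), p * q = s ∧ 0 < α ∧ α < Real.pi / (k + 1) ∧ p ≠ 0 ∧
      IsUniquelySolvable α (weightJump α (normalWeight k b s p q))
  · obtain ⟨p₀, q₀, α₀, hpq₀, hα₀₀, hα₀', hp₀, huniq⟩ := hex
    obtain ⟨M₀, hM₀⟩ := huniq.1
    obtain ⟨u₀, v₀, hpot₀⟩ :=
      hM₀.exists_hasPotentials hα₀₀ hα₀' (isWeight_normalWeight hk hb hs)
    refine ⟨u₀ / p₀, fun p q α hpq hα₀ hα hu M u v hM hpot => ?_⟩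
    rcases eq_or_ne p 0 with rfl | hp
    · rw [zero_mul]
      exact potential_eq_zero hα₀ (hα.trans_le hle) hu hM hpot
    · exact potential_eq_mul hk hb hs hα₀ hα hα₀₀ hα₀' hpq₀ hp₀ huniq hM₀ hpot₀ hpq hp hM hpot
  · refine ⟨0, fun p q α hpq hα₀ hα hu M u v hM hpot => ?_⟩
    rcases eq_or_ne p 0 with rfl | hp
    · rw [zero_mul]
      exact potential_eq_zero hα₀ (hα.trans_le hle) hu hM hpot
    · exact absurd ⟨p, q, α, hpq, hα₀, hα, hp, hu⟩ hex

/-- The mirrored problem has upper coefficient `conj q` and upper potential `-conj v`, so the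
statement about `u` applied to it determines `v`. -/
theorem exists_normal_constants (hk : 1 ≤ k) (hb : b ≠ 0) (hs : 0 < 1 + s) :
    ∃ U V : ℂ, U = -conj V ∧ ∀ (p q : ℂ) (α : ℝ), p * q = s → 0 < α → α < Real.pi / (k + 1) →
      IsUniquelySolvable α (weightJump α (normalWeight k b s p q)) →
      ∀ M : ℂ → Matrix (Fin 2) (Fin 2) ℂ,
        IsSolution α (weightJump α (normalWeight k b s p q)) M →
        HasPotentials α M (p * U) (q * V) := by
  obtain ⟨U, hU⟩ := exists_potential_constant hk hb hs
  refine ⟨U, -conj U, by simp, fun p q α hpq hα₀ hα hu M hM => ?_⟩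
  obtain ⟨u, v, hpot⟩ := hM.exists_hasPotentials hα₀ hα (isWeight_normalWeight hk hb hs)
  have hle := opening_le_half_pi hk
  have hmirror : ∀ i r, 0 < r →
      (weightJump α (normalWeight k b s p q) (mirror i) r).conjTranspose =
        weightJump α (normalWeight k b s (conj q) (conj p)) i r := fun i r hr =>
    conjTranspose_weightJump_normalWeight hb hα₀ (hα.trans_le hle) i hr
  have hpq' : conj q * conj p = (s : ℂ) := by
    rw [← map_mul, mul_comm, hpq, Complex.conj_ofReal]
  have h1 := hU p q α hpq hα₀ hα hu M u v hM hpot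
  have h2 := hU _ _ α hpq' hα₀ hα ((hu.mirror det_weightJump_normalWeight).congr hmirror) _ _ _
    ((hM.mirror det_weightJump_normalWeight).congr hmirror) hpot.mirror
  have h3 : v = q * -conj U := by
    have := congrArg (fun x => -conj x) h2
    simpa using this
  rw [← h1, ← h3]
  exact hpot

end Potentials

end ModelRHP

/-! ### Conclusion for general `a`, `ω` and `t` -/

theorem mainTheorem11 (k : ℕ) (hk : 1 ≤ k) (b : ℝ) (hb : b ≠ 0) (s : ℝ) (hs : 0 < 1 + s) :
    ∃ U V : ℂ, U = -conj V ∧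
      ∀ (p q : ℂ) (a ω t α : ℝ), p * q = (s : ℂ) → 0 < t → 0 < α → α < Real.pi / (k + 1) →
        ModelRHP.IsUniquelySolvable α (ModelRHP.modelJump k a b s ω t p q α) →
        ∀ M : ℂ → Matrix (Fin 2) (Fin 2) ℂ,
          ModelRHP.IsSolution α (ModelRHP.modelJump k a b s ω t p q α) M →
          ModelRHP.HasPotentials α M
            (p * U * ((t ^ (-(1 / ((k : ℝ) + 1))) : ℝ) : ℂ) *
              Complex.exp (-2 * ModelRHP.Delta k a b s ω t))
            (q * V * ((t ^ (-(1 / ((k : ℝ) + 1))) : ℝ) : ℂ) *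
              Complex.exp (2 * ModelRHP.Delta k a b s ω t)) := by
  obtain ⟨U, V, hUV, h⟩ := ModelRHP.exists_normal_constants hk hb hs
  refine ⟨U, V, hUV, fun p q a ω t α hpq ht hα₀ hα hu M hM => ?_⟩
  have hκ : 0 < t ^ (1 / ((k : ℝ) + 1)) := Real.rpow_pos_of_pos ht _
  have hκ' : ((t ^ (1 / ((k : ℝ) + 1)) : ℝ) : ℂ) ≠ 0 := by exact_mod_cast hκ.ne'
  set p' := p * Complex.exp (-2 * ModelRHP.Delta k a b s ω t) with hp'
  set q' := q * Complex.exp (2 * ModelRHP.Delta k a b s ω t) with hq'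
  have hpq' : p' * q' = s := by
    rw [hp', hq', mul_mul_mul_comm, ← Complex.exp_add, hpq, neg_mul, neg_add_cancel,
      Complex.exp_zero, mul_one]
  -- Dilation by the inverse of t^{1/(k+1)} turns the model jump into a normalized one.
  have hjump : ∀ i r, 0 < r →
      ModelRHP.modelJump k a b s ω t p q α i ((t ^ (1 / ((k : ℝ) + 1)))⁻¹ * r) =
        ModelRHP.weightJump α (ModelRHP.normalWeight k b s p' q') i r := fun i r hr => by
    rw [ModelRHP.modelJump_eq hb hpq a ω ht i (mul_pos (inv_pos.2 hκ) hr),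
      mul_inv_cancel_left₀ hκ.ne']
  -- Dilating back recovers `M` and multiplies the potentials by t^{-1/(k+1)}.
  have hpot := (h p' q' α hpq' hα₀ hα ((hu.comp_mul (inv_pos.2 hκ)).congr hjump) _
    ((hM.comp_mul (inv_pos.2 hκ)).congr hjump)).comp_mul hκ
  have hM' : (fun z : ℂ => M (((t ^ (1 / ((k : ℝ) + 1)))⁻¹ : ℝ) *
      (((t ^ (1 / ((k : ℝ) + 1)) : ℝ) : ℂ) * z))) = M := by
    funext z
    rw [Complex.ofReal_inv, inv_mul_cancel_left₀ hκ']
  rw [hM'] at hpot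
  convert! hpot using 1
  · rw [Real.rpow_neg ht.le, Complex.ofReal_inv, hp']
    ring
  · rw [Real.rpow_neg ht.le, Complex.ofReal_inv, hq']
    ring
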